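/- Let $\xi_0,\xi_1,\dots$ be nondegenerate i.i.d. complex random variables with $\mathbb P(\xi_0=0)=0$ and $\mathbb E\log(1+|\xi_0|)<\infty$. Let $p_{k,n}$ $(0\le k\le n)$ be deterministic complex coefficients, put $p_{k,n}=0$ for $k>n$, and let $p_n(z)=\sum_{k=0}^n \xi_k p_{k,n}z^k$. Assume that there are a function $p:[0,\infty)\to[0,\infty)$ and $T_0\in(0,\infty]$ such that (assumption A1): 1. $p(t)>0$ for $t<T_0$ and $p(t)=0$ for $t>T_0$; 2. $p$ is continuous on $[0,T_0)$ and, if $T_0<\infty$, left continuous at $T_0$; 3. $\lim_{n\to\infty}\sup_{k\in[0,An]}\bigl||p_{k,n}|^{1/n}-p(k/n)\bigr|=0$ for every $A>0$; 4. $R_0:=\liminf_{t\to\infty}p(t)^{-1/t}\in(0,\infty]$, $\liminf_{k\to\infty}|p_{k,n}|^{-1/k}\ge R_0$ for every fixed $n$, and $\liminf_{n,\,k/n\to\infty}|p_{k,n}|^{-1/k}\ge R_0$. Let $0\le N_n\le n$ be integers and $D_n=n-N_n$. Let $\mu_n$ and $\mu_{D_n}$ be the measures of zeros $\sum\delta_z$,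 counted with multiplicity, of $p_n$ and of the $N_n$-th derivative $p_n^{(N_n)}$, respectively (taken to be $0$ if the polynomial vanishes identically). Random measures $\nu_n$ on $\mathbb C$ are said to converge in probability to a deterministic measure $\nu$ if $\int\phi\,d\nu_n\to\int\phi\,d\nu$ in probability for every smooth compactly supported $\phi$. Write $\mathbb D_r=\{|z|<r\}$, let $'$ denote the left derivative, let $\log 0=-\infty$, $0\log 0=0$, and for $f:[0,\infty)\to[-\infty,\infty]$ let its Legendre–Fenchel transform be $s\mapsto\sup_{t\ge0}(st-f(t))$, $s\in\mathbb R$. (1) Suppose $N_n/n\to0$, and let $I$ be the Legendre–Fenchel transform of $-\log p$. Then $I$ is finite, and there is a rotationally invariant measure $\mu$ on $\mathbb C$ with $\mu(\mathbb D_r)=I'(\log r)$ for all $r>0$ such that $\frac1{D_n}\mu_{D_n}$ converges in probability to $\mu$; moreover $\frac1n\mu_n$ converges in probability to the same $\mu$. (2) Suppose $N_n/n\to a\in(0,1)$ with $a<T_0$. Let $\log u_a(t)=\log p(t+a)+(t+a)\log(t+a)-t\log t+(1-a)\log(1-a)$ for $0\le t\le 1-a$ and $\log u_a(t)=-\infty$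 for $t>1-a$, and let $I_a$ be the Legendre–Fenchel transform of $-\log u_a$. Then $I_a$ is finite, and there is a rotationally invariant measure $\mu_a$ on $\mathbb C$ with $\mu_a(\mathbb D_r)=\frac1{1-a}I_a'(\log r)$ for all $r>0$ such that $\frac1{D_n}\mu_{D_n}$ converges in probability to $\mu_a$. -/

import Mathlib

open MeasureTheory ProbabilityTheory Filter Set Topology
open scoped NNReal ENNReal

noncomputable section

namespace RandomZeros

/-- Assumption **A1** on a triangular or infinite array of deterministic coefficients,
where `c n k` stands for `p_{k,n}`, with profile `p : [0,∞) → [0,∞)` and threshold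
`T₀ ∈ (0,∞]`. In `ℝ≥0∞` one has `0 ^ (-1/t) = ∞` for `t > 0`. -/
structure AssumptionA1 (c : ℕ → ℕ → ℂ) (p : ℝ≥0 → ℝ≥0) (T₀ : ℝ≥0∞) : Prop where
  T₀_pos : 0 < T₀
  pos_of_lt : ∀ t : ℝ≥0, (t : ℝ≥0∞) < T₀ → 0 < p t
  zero_of_gt : ∀ t : ℝ≥0, T₀ < (t : ℝ≥0∞) → p t = 0
  continuousOn : ContinuousOn p {t : ℝ≥0 | (t : ℝ≥0∞) < T₀}
  leftContinuous : ∀ T : ℝ≥0, T₀ = (T : ℝ≥0∞) → ContinuousWithinAt p (Iic T) T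
  tendsto_sup : ∀ A : ℝ≥0, 0 < A →
    Tendsto (fun n : ℕ => ⨆ (k : ℕ) (_ : (k : ℝ≥0) ≤ A * n),
      edist (‖c n k‖₊ ^ (1 / (n : ℝ))) (p (k / n))) atTop (𝓝 0)
  R₀_pos : 0 < liminf (fun t : ℝ≥0 => (p t : ℝ≥0∞) ^ (-1 / (t : ℝ))) atTop
  R₀_le_of_fixed : ∀ n : ℕ,
    liminf (fun t : ℝ≥0 => (p t : ℝ≥0∞) ^ (-1 / (t : ℝ))) atTop
      ≤ liminf (fun k : ℕ => ‖c n k‖ₑ ^ (-1 / (k : ℝ))) atTop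
  R₀_le_of_joint :
    liminf (fun t : ℝ≥0 => (p t : ℝ≥0∞) ^ (-1 / (t : ℝ))) atTop
      ≤ liminf (fun q : ℕ × ℕ => ‖c q.1 q.2‖ₑ ^ (-1 / (q.2 : ℝ)))
          (comap (fun q : ℕ × ℕ => q.1) atTop ⊓
            comap (fun q : ℕ × ℕ => (q.2 : ℝ) / (q.1 : ℝ)) atTop)

/-- The polynomial `∑_{k=0}^n x_k c_{n,k} z^k`. -/
def poly (c : ℕ → ℕ → ℂ) (x : ℕ → ℂ) (n : ℕ) : Polynomial ℂ :=
  ∑ k ∈ Finset.range (n + 1), Polynomial.C (x k * c n k) * Polynomial.X ^ k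

/-- The measure of zeros `∑_{z : f z = 0} δ_z`, zeros being counted with multiplicity
(the zero measure if `f` is the zero polynomial). -/
def zeroMeasure (f : Polynomial ℂ) : Measure ℂ :=
  (f.roots.map fun z => Measure.dirac z).sum

/-- Convergence in probability of random measures on `ℂ` to a deterministic measure, tested
against smooth compactly supported functions. -/
def TendstoInProbability {Ω : Type*} [MeasurableSpace Ω] (P : Measure Ω)
    (ν : ℕ → Ω → Measure ℂ) (μ : Measure ℂ) : Prop :=
  ∀ φ : ℂ → ℝ, ContDiff ℝ ((⊤ : ℕ∞) : WithTop ℕ∞) φ → HasCompactSupport φ →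
    TendstoInMeasure P (fun n ω => ∫ z, φ z ∂(ν n ω)) atTop (fun _ => ∫ z, φ z ∂μ)

/-- The Legendre–Fenchel transform `s ↦ sup_{t ≥ 0} (s t - f t)` of a function on `[0,∞)`. -/
def legendreFenchel (f : ℝ≥0 → EReal) (s : ℝ) : EReal :=
  ⨆ t : ℝ≥0, (((s * t : ℝ) : EReal) - f t)

/-- `log p` with values in `[-∞,∞)`, where `log 0 = -∞`. -/
def logProfile (p : ℝ≥0 → ℝ≥0) (t : ℝ≥0) : EReal :=
  ENNReal.log (p t : ℝ≥0∞)

/-- `log u_a`, equal to `-∞` for `t > 1 - a`. -/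
def logProfileDeriv (p : ℝ≥0 → ℝ≥0) (a t : ℝ≥0) : EReal :=
  if (t : ℝ) ≤ 1 - a then
    logProfile p (t + a) +
      (((t + a) * Real.log (t + a) - t * Real.log t + (1 - a) * Real.log (1 - a) : ℝ) : EReal)
  else ⊥

/-- `I` is finite everywhere and has left derivative `d` at `s`. -/
def HasLeftDerivAt (I : ℝ → EReal) (d s : ℝ) : Prop :=
  ∃ J : ℝ → ℝ, (∀ x, I x = (J x : EReal)) ∧ HasDerivWithinAt J d (Iic s) s

/-- Invariance of a measure on the plane under all rotations about the origin. -/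
def RotationInvariant (μ : Measure ℂ) : Prop :=
  ∀ w : ℂ, ‖w‖ = 1 → μ.map (fun z => w * z) = μ

/-- `μ` is rotationally invariant and `μ(𝔻_r) = b * I'(log r) < ∞` for all `r > 0`, where `𝔻_r`
is the open disk and `I'` the left derivative. -/
def HasRadialProfile (μ : Measure ℂ) (b : ℝ) (I : ℝ → EReal) : Prop :=
  RotationInvariant μ ∧ ∀ r : ℝ, 0 < r → μ (Metric.ball 0 r) ≠ ∞ ∧
    ∃ d : ℝ, HasLeftDerivAt I d (Real.log r) ∧ μ.real (Metric.ball 0 r) = b * d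

end RandomZeros

end

namespace RandomZeros

open scoped RealInnerProductSpace ComplexConjugate MeasureTheory

/-! ### Anti-concentration for linear combinations of i.i.d. complex random variables -/

/-! Case (1) is case (2) at `a = 0`, where the entropy term vanishes, so one argument for `0 ≤ a <
T₀` gives both. Since the coefficients vanish for `k > n`, the threshold satisfies `T₀ ≤ 1`, and all
macroscopic degrees lie in a compact interval.

Growth. Up to a positive constant, which does not move zeros, the `N_n`-th derivative is a random
combination of the monomials `z^(k - N_n)`. By the factorial asymptotics, the `n`-th root of the
modulus of its `k`-th coefficient times `|z|^(k - N_n)` is uniformly close to `u_a(t) |z|^t` with `t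
= k/n - a` (truncated at `0`). The maximal exponential rate is therefore `I_a(log |z|)`, called
`growthRate`. Randomness does not change the rate. From above, `E log(1 + |ξ|) < ∞` makes all
`|ξ_k|`, `k ≤ n`, at most `e^(εn)` with high probability. From below, an unbounded number of terms
come within `e^(-εn)` of the maximal rate, and a linear combination of i.i.d. nondegenerate
variables with many coefficients of modulus at least `1` is unlikely to lie in the unit disk
(`exists_card_measure_norm_sum_le_one`). Hence `(1/n) log |q_n(z)|` converges in probability to
`I_a(log |z|)` for every `z ≠ 0` (`tendstoInMeasure_log_norm_sum`, `AssumptionA1.logConvergence`).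

From growth to zeros. The measure of zeros is the Laplacian of `log |q_n|` over `2π`. In place of
distributions, the difference of the circular means of radii `2ε` and `ε` plays the role of the
Laplacian: testing `log |z - w|` against the `ringMean` of `φ` yields `φ` smoothed near `w` by the
nonnegative, compactly supported `ringKernel`. This needs `L¹` convergence of the potentials on
disks, which follows from pointwise convergence and the uniform `L²` bound that Jensen's formula
provides (`exists_integral_log_norm_eval_sq_le`, `LogConvergence.tendsto_zeros`).

The limit. `I_a` is a supremum of affine functions with slopes in `[0,1]`, hence convex. The
Stieltjes measure of its right derivative, spread uniformly over circles, is a plane measure with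
potential `I_a(log |z|)` (`RadialPotential.isPotential`); an open disk receives the left derivative.
Normalizing by `D_n` instead of `n` contributes the factor `1/(1 - a)`. -/

lemma inner_mul_left_complex (b x t : ℂ) : ⟪b * x, t⟫ = ⟪x, conj b * t⟫ := by
  simp only [Complex.inner, map_mul]
  congr 1; ring

lemma charFun_map_const_mul (ν : Measure ℂ) (b t : ℂ) :
    charFun (ν.map (fun x => b * x)) t = charFun ν (conj b * t) := by
  rw [charFun_apply, charFun_apply, integral_map (by fun_prop) (by fun_prop)]
  simp_rw [inner_mul_left_complex]

/-- The law of the difference of two independent copies. -/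
noncomputable def symmetrization (ν : Measure ℂ) : Measure ℂ := ν ∗ (ν.map (fun x => -x))

instance isProbabilityMeasure_symmetrization (ν : Measure ℂ) [IsProbabilityMeasure ν] :
    IsProbabilityMeasure (symmetrization ν) := by
  unfold symmetrization
  have : IsProbabilityMeasure (ν.map (fun x : ℂ => -x)) :=
    Measure.isProbabilityMeasure_map (by fun_prop)
  infer_instance

lemma charFun_symmetrization (ν : Measure ℂ) [IsProbabilityMeasure ν] (t : ℂ) :
    charFun (symmetrization ν) t = ((‖charFun ν t‖ ^ 2 : ℝ) : ℂ) := by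
  have : IsProbabilityMeasure (ν.map (fun x : ℂ => -x)) :=
    Measure.isProbabilityMeasure_map (by fun_prop)
  have h : charFun (ν.map (fun x : ℂ => -x)) t = conj (charFun ν t) := by
    have := charFun_map_const_mul ν (-1) t
    simp only [neg_mul, one_mul, map_neg, map_one] at this
    rw [this, charFun_neg]
  rw [symmetrization, charFun_conv, h, Complex.mul_conj, Complex.normSq_eq_norm_sq]

/-- Convolve `l` copies of the symmetrization. Even powers of the modulus are thus characteristic
functions themselves, so their Gaussian integrals can be computed on the side of the measure. -/
lemma exists_charFun_eq_norm_pow (ν : Measure ℂ) [IsProbabilityMeasure ν] (l : ℕ) :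
    ∃ ρ : Measure ℂ, IsProbabilityMeasure ρ ∧
      ∀ t, charFun ρ t = ((‖charFun ν t‖ ^ (2 * l) : ℝ) : ℂ) := by
  induction l with
  | zero => exact ⟨Measure.dirac 0, inferInstance, fun t => by simp⟩
  | succ l ih =>
    obtain ⟨ρ, hρ, h⟩ := ih
    refine ⟨ρ ∗ symmetrization ν, inferInstance, fun t => ?_⟩
    rw [charFun_conv, h, charFun_symmetrization, ← Complex.ofReal_mul]
    congr 1; ring

/-- Fubini and the characteristic function of the Gaussian. -/
lemma integral_charFun_stdGaussian (ρ : Measure ℂ) [IsProbabilityMeasure ρ] (b : ℂ) :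
    ∫ t, charFun ρ (b * t) ∂(stdGaussian ℂ) =
      ((∫ x, Real.exp (-(‖b‖ ^ 2 * ‖x‖ ^ 2) / 2) ∂ρ : ℝ) : ℂ) := by
  simp_rw [charFun_apply]
  rw [integral_integral_swap]
  · rw [← integral_complex_ofReal]
    refine integral_congr_ae (ae_of_all _ fun x => ?_)
    have : ∀ t : ℂ, ⟪x, b * t⟫ = ⟪t, conj b * x⟫ := fun t => by
      rw [real_inner_comm, inner_mul_left_complex]
    simp only [this]
    rw [← charFun_apply, charFun_stdGaussian]
    simp only [norm_mul, RCLike.norm_conj]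
    push_cast
    congr 1; ring
  · refine Integrable.of_bound (C := 1) (Measurable.aestronglyMeasurable ?_)
      (ae_of_all _ fun x => ?_)
    · unfold Function.uncurry; fun_prop
    · simp only [Function.uncurry]
      rw [Complex.norm_exp_ofReal_mul_I]

/-- Both sides have the form `∫ exp(-|b|²|x|²/2) dρ(x)` with the same `ρ`, and the integrand
decreases in `|b|`. This makes the final concentration bound independent of the coefficients. -/
lemma integral_norm_charFun_pow_anti (ν : Measure ℂ) [IsProbabilityMeasure ν] (l : ℕ) {b : ℂ}
    (hb : 1 ≤ ‖b‖) :
    ∫ t, ‖charFun ν (b * t)‖ ^ (2 * l) ∂(stdGaussian ℂ) ≤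
      ∫ t, ‖charFun ν t‖ ^ (2 * l) ∂(stdGaussian ℂ) := by
  obtain ⟨ρ, hρ, h⟩ := exists_charFun_eq_norm_pow ν l
  have key : ∀ c : ℂ, ∫ t, ‖charFun ν (c * t)‖ ^ (2 * l) ∂(stdGaussian ℂ) =
      ∫ x, Real.exp (-(‖c‖ ^ 2 * ‖x‖ ^ 2) / 2) ∂ρ := fun c => by
    have := integral_charFun_stdGaussian ρ c
    simp_rw [h] at this
    rw [integral_complex_ofReal] at this
    exact_mod_cast this
  have hint : ∀ c : ℂ, Integrable (fun x => Real.exp (-(‖c‖ ^ 2 * ‖x‖ ^ 2) / 2)) ρ := fun c => by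
    refine Integrable.of_bound (C := 1) (by fun_prop) (ae_of_all _ fun x => ?_)
    rw [Real.norm_eq_abs, Real.abs_exp, Real.exp_le_one_iff]
    have : 0 ≤ ‖c‖ ^ 2 * ‖x‖ ^ 2 := by positivity
    linarith
  have h1 := key 1
  simp only [one_mul] at h1
  rw [key b, h1]
  refine integral_mono (hint b) (by simpa using hint 1) fun x => ?_
  simp only [norm_one, one_pow, one_mul]
  refine Real.exp_le_exp.2 ?_
  have : ‖x‖ ^ 2 ≤ ‖b‖ ^ 2 * ‖x‖ ^ 2 :=
    le_mul_of_one_le_left (by positivity) (one_le_pow₀ hb)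
  linarith

lemma symmetrization_compl_zero_pos (ν : Measure ℂ) [IsProbabilityMeasure ν]
    (hν : ¬ ∃ x, ∀ᵐ y ∂ν, y = x) : symmetrization ν {0}ᶜ ≠ 0 := by
  intro h
  have hms : MeasurableSet ({0}ᶜ : Set ℂ) := (measurableSet_singleton _).compl
  have h2 : ∀ᵐ z ∂(ν.prod (ν.map (fun x => -x))), z.1 + z.2 = 0 := by
    rw [symmetrization, Measure.conv, Measure.map_apply (by fun_prop) hms] at h
    rw [ae_iff]; exact h
  have : SFinite (ν.map (fun x : ℂ => -x)) := inferInstance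
  have h3 := Measure.ae_ae_of_ae_prod h2
  obtain ⟨x, hx⟩ := h3.exists
  refine hν ⟨x, ?_⟩
  have := ae_of_ae_map (by fun_prop) hx
  filter_upwards [this] with y hy
  rw [add_neg_eq_zero] at hy
  exact hy.symm

/-- The inner product with `x ≠ 0` is a nondegenerate real Gaussian, which has no atoms, while `cos
= 1` holds on a countable set. -/
lemma stdGaussian_cos_inner_eq_one {x : ℂ} (hx : x ≠ 0) :
    stdGaussian ℂ {t | Real.cos ⟪x, t⟫ = 1} = 0 := by
  have hm : (stdGaussian ℂ).map (fun t => ⟪x, t⟫) = gaussianReal 0 (‖x‖₊ ^ 2) := by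
    apply Measure.ext_of_charFun
    ext s
    rw [charFun_gaussianReal, charFun_apply_real, integral_map (by fun_prop) (by fun_prop)]
    have : ∀ t : ℂ, Complex.exp (s * (⟪x, t⟫ : ℝ) * Complex.I) =
        Complex.exp ((⟪t, s * x⟫ : ℝ) * Complex.I) := fun t => by
      have e : ⟪t, (s : ℂ) * x⟫ = s * ⟪x, t⟫ := by
        rw [← Complex.real_smul, real_inner_smul_right, real_inner_comm x t]
      rw [e]; push_cast; rfl
    simp_rw [this]
    rw [← charFun_apply, charFun_stdGaussian]
    congr 1
    simp only [norm_mul, Complex.norm_real, Real.norm_eq_abs]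
    push_cast
    rw [mul_pow, ← Complex.ofReal_pow, sq_abs]
    push_cast; ring
  have hcount : {s : ℝ | Real.cos s = 1}.Countable := by
    have : {s : ℝ | Real.cos s = 1} ⊆ range (fun n : ℤ => (n : ℝ) * (2 * Real.pi)) := by
      intro s hs
      exact (Real.cos_eq_one_iff s).1 hs
    exact (countable_range _).mono this
  have hv : (‖x‖₊ ^ 2 : ℝ≥0) ≠ 0 := by simpa using hx
  have : NullSingletonClass (gaussianReal 0 (‖x‖₊ ^ 2)) :=
    nullSingletonClass_gaussianReal hv
  have h0 : gaussianReal 0 (‖x‖₊ ^ 2) {s : ℝ | Real.cos s = 1} = 0 := hcount.measure_zero _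
  rw [← hm, Measure.map_apply (by fun_prop)
    (measurableSet_eq_fun (by fun_prop) (by fun_prop))] at h0
  exact h0

/-- Modulus `1` at `t` forces `cos ⟪x, t⟫ = 1` for almost every `x` under the symmetrized law. By
Fubini, for almost every `t` this can happen only if that law sits at `0`, i.e. if `ν` is a point
mass. -/
lemma ae_norm_charFun_lt_one (ν : Measure ℂ) [IsProbabilityMeasure ν]
    (hν : ¬ ∃ x, ∀ᵐ y ∂ν, y = x) : ∀ᵐ t ∂(stdGaussian ℂ), ‖charFun ν t‖ < 1 := by
  have hS : MeasurableSet {z : ℂ × ℂ | ¬ (z.1 ≠ 0 → Real.cos ⟪z.1, z.2⟫ ≠ 1)} := by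
    have h1 : MeasurableSet {z : ℂ × ℂ | z.1 = 0} :=
      measurableSet_eq_fun (by fun_prop) (by fun_prop)
    have h2 : MeasurableSet {z : ℂ × ℂ | Real.cos ⟪z.1, z.2⟫ = 1} :=
      measurableSet_eq_fun (by fun_prop) (by fun_prop)
    convert h2.diff h1 using 1
    ext z; simp only [mem_ofPred_eq, Set.mem_sdiff]; tauto
  have h1 : ∀ᵐ z ∂((symmetrization ν).prod (stdGaussian ℂ)),
      z.1 ≠ 0 → Real.cos ⟪z.1, z.2⟫ ≠ 1 := by
    rw [ae_iff, Measure.measure_prod_null hS]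
    refine ae_of_all _ fun x => ?_
    by_cases hx : x = 0
    · simp [hx]
    · have := stdGaussian_cos_inner_eq_one hx
      simpa [hx] using this
  have h2 : ∀ᵐ z ∂((stdGaussian ℂ).prod (symmetrization ν)),
      z.2 ≠ 0 → Real.cos ⟪z.2, z.1⟫ ≠ 1 := by
    have := Measure.prod_swap (μ := symmetrization ν) (ν := stdGaussian ℂ)
    rw [← this]
    refine (ae_map_iff (by fun_prop) ?_).2 h1
    have h3 : MeasurableSet {z : ℂ × ℂ | z.2 = 0} :=
      measurableSet_eq_fun (by fun_prop) (by fun_prop)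
    have h4 : MeasurableSet {z : ℂ × ℂ | Real.cos ⟪z.2, z.1⟫ = 1} :=
      measurableSet_eq_fun (by fun_prop) (by fun_prop)
    convert (h4.diff h3).compl using 1
    ext z; simp only [mem_ofPred_eq, Set.mem_sdiff, mem_compl_iff]; tauto
  filter_upwards [Measure.ae_ae_of_ae_prod h2] with t ht
  refine lt_of_le_of_ne (norm_charFun_le_one t) fun h => ?_
  have hc := charFun_symmetrization ν t
  rw [h, charFun_apply] at hc
  have hint : Integrable (fun x => Real.cos ⟪x, t⟫) (symmetrization ν) :=
    Integrable.of_bound (C := 1) (by fun_prop) (ae_of_all _ fun x => by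
      simpa using Real.abs_cos_le_one _)
  have hre : ∫ x, Real.cos ⟪x, t⟫ ∂(symmetrization ν) = 1 := by
    have h3 := congrArg Complex.re hc
    have h4 := integral_re (𝕜 := ℂ) (f := fun x => Complex.exp ((⟪x, t⟫ : ℝ) * Complex.I))
      (μ := symmetrization ν) (Integrable.of_bound (C := 1)
        (Measurable.aestronglyMeasurable (by fun_prop))
        (ae_of_all _ fun x => by rw [Complex.norm_exp_ofReal_mul_I]))
    simp only [RCLike.re_eq_complex_re, Complex.exp_ofReal_mul_I_re] at h4
    rw [h4, h3]; simp
  have h0 : ∫ x, (1 - Real.cos ⟪x, t⟫) ∂(symmetrization ν) = 0 := by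
    rw [integral_sub (by fun_prop) hint, hre]; simp
  rw [integral_eq_zero_iff_of_nonneg (f := fun x => 1 - Real.cos ⟪x, t⟫)
    (fun x => by simpa using Real.cos_le_one _) ((integrable_const _).sub hint)] at h0
  refine symmetrization_compl_zero_pos ν hν ?_
  have : ∀ᵐ x ∂(symmetrization ν), x = 0 := by
    filter_upwards [h0, ht] with x h5 h6
    by_contra hx
    exact h6 hx (by simp only [Pi.zero_apply] at h5; linarith)
  rwa [ae_iff] at this

lemma tendsto_integral_norm_charFun_pow (ν : Measure ℂ) [IsProbabilityMeasure ν]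
    (hν : ¬ ∃ x, ∀ᵐ y ∂ν, y = x) :
    Tendsto (fun l : ℕ => ∫ t, ‖charFun ν t‖ ^ (2 * l) ∂(stdGaussian ℂ)) atTop (𝓝 0) := by
  have := tendsto_integral_of_dominated_convergence (μ := stdGaussian ℂ)
    (F := fun (l : ℕ) t => ‖charFun ν t‖ ^ (2 * l)) (f := fun _ => 0) (fun _ => 1)
    (fun l => Measurable.aestronglyMeasurable (by fun_prop)) (by fun_prop)
    (fun l => ae_of_all _ fun t => by
      rw [Real.norm_eq_abs, abs_of_nonneg (by positivity)]
      exact pow_le_one₀ (norm_nonneg _) (norm_charFun_le_one t)) ?_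
  · simpa using this
  · filter_upwards [ae_norm_charFun_lt_one ν hν] with t ht
    have h1 : ‖charFun ν t‖ ^ 2 < 1 := pow_lt_one₀ (norm_nonneg _) ht (by norm_num)
    have := tendsto_pow_atTop_nhds_zero_of_lt_one (by positivity) h1
    simpa only [← pow_mul] using this

/-- Concentration bound for a linear combination in which at least `2 l` coefficients have modulus
at least `1`. -/
lemma measure_norm_sum_le_one_le {Ω : Type*} [MeasurableSpace Ω] (P : Measure Ω)
    [IsProbabilityMeasure P] (ξ : ℕ → Ω → ℂ) (hm : ∀ k, Measurable (ξ k)) (hind : iIndepFun ξ P)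
    (hid : ∀ k, IdentDistrib (ξ k) (ξ 0) P P) (s t : Finset ℕ) (hts : t ⊆ s) (b : ℕ → ℂ)
    (hb : ∀ k ∈ t, 1 ≤ ‖b k‖) (l : ℕ) (hl : 0 < l) (ht : t.card = 2 * l) :
    P.real {ω | ‖∑ k ∈ s, b k * ξ k ω‖ ≤ 1} ≤
      Real.exp (1 / 2) * ∫ u, ‖charFun (P.map (ξ 0)) u‖ ^ (2 * l) ∂(stdGaussian ℂ) := by
  set ν := P.map (ξ 0) with hν
  have : IsProbabilityMeasure ν := Measure.isProbabilityMeasure_map (hm 0).aemeasurable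
  set X : Ω → ℂ := fun ω => ∑ k ∈ s, b k * ξ k ω with hX
  have hXm : Measurable X := Finset.measurable_sum _ fun k _ => (hm k).const_mul _
  set ρ := P.map X with hρ
  have : IsProbabilityMeasure ρ := Measure.isProbabilityMeasure_map hXm.aemeasurable
  have hchar : ∀ u, charFun ρ u = ∏ k ∈ s, charFun ν (conj (b k) * u) := by
    intro u
    have hind' : iIndepFun (fun k ω => b k * ξ k ω) P :=
      hind.comp (fun k x => b k * x) (fun k => by fun_prop)
    have h1 := iIndepFun.charFun_map_fun_finsetSum_eq_prod (s := s)
      (X := fun k ω => b k * ξ k ω) (P := P)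
      (fun k _ => ((hm k).const_mul _).aemeasurable) 
      (iIndepFun.precomp (g := ((↑) : s → ℕ)) Subtype.val_injective hind')
    rw [hρ, hX, h1, Finset.prod_apply]
    refine Finset.prod_congr rfl fun k _ => ?_
    have h2 : P.map (fun ω => b k * ξ k ω) = ν.map (fun x => b k * x) := by
      rw [hν, ← (hid k).map_eq, Measure.map_map (by fun_prop) (hm k)]; rfl
    rw [h2, charFun_map_const_mul]
  -- The indicator of the unit disk is at most `e^(1/2) e^(-|x|²/2)`.
  have hstep1 : P.real {ω | ‖X ω‖ ≤ 1} ≤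
      Real.exp (1 / 2) * ∫ x, Real.exp (-(‖(1 : ℂ)‖ ^ 2 * ‖x‖ ^ 2) / 2) ∂ρ := by
    have e1 : P.real {ω | ‖X ω‖ ≤ 1} = ρ.real {x | ‖x‖ ≤ 1} := by
      rw [hρ, map_measureReal_apply hXm (measurableSet_le (by fun_prop) (by fun_prop))]; rfl
    rw [e1, ← integral_const_mul,
      ← integral_indicator_one (measurableSet_le (by fun_prop) (by fun_prop))]
    refine integral_mono_of_nonneg (ae_of_all _ fun x => indicator_nonneg (by simp) _) ?_
      (ae_of_all _ fun x => ?_)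
    · refine Integrable.const_mul (Integrable.of_bound (C := 1) (by fun_prop)
        (ae_of_all _ fun x => ?_)) _
      rw [Real.norm_eq_abs, Real.abs_exp, Real.exp_le_one_iff]
      have : 0 ≤ ‖(1 : ℂ)‖ ^ 2 * ‖x‖ ^ 2 := by positivity
      linarith
    · refine indicator_le' (g := fun x => Real.exp (1 / 2) *
        Real.exp (-(‖(1 : ℂ)‖ ^ 2 * ‖x‖ ^ 2) / 2)) (fun x hx => ?_) (fun x _ => by positivity) x
      rw [← Real.exp_add]
      simp only [Pi.one_apply]
      refine Real.one_le_exp ?_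
      have : ‖x‖ ^ 2 ≤ 1 := pow_le_one₀ (norm_nonneg _) hx
      simp only [norm_one]; linarith
  have hstep2 : ∫ x, Real.exp (-(‖(1 : ℂ)‖ ^ 2 * ‖x‖ ^ 2) / 2) ∂ρ ≤
      ∫ u, ‖charFun ρ u‖ ∂(stdGaussian ℂ) := by
    have h1 := integral_charFun_stdGaussian ρ 1
    have h2 : (∫ x, Real.exp (-(‖(1 : ℂ)‖ ^ 2 * ‖x‖ ^ 2) / 2) ∂ρ) ≤
        ‖∫ u, charFun ρ (1 * u) ∂(stdGaussian ℂ)‖ := by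
      rw [h1, Complex.norm_real]; exact le_abs_self _
    simp only [one_mul] at h2
    exact h2.trans (norm_integral_le_integral_norm _)
  have hint : ∀ k, Integrable (fun u => ‖charFun ν (conj (b k) * u)‖ ^ (2 * l))
      (stdGaussian ℂ) := fun k =>
    Integrable.of_bound (C := 1) (Measurable.aestronglyMeasurable (by fun_prop))
      (ae_of_all _ fun u => by
        rw [Real.norm_eq_abs, abs_of_nonneg (by positivity)]
        exact pow_le_one₀ (norm_nonneg _) (norm_charFun_le_one _))
  have hl' : (0 : ℝ) < 2 * l := by positivity
  -- Factors outside `t` are bounded by `1`; the remaining `2l` factors are separated by the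
  -- inequality of arithmetic and geometric means with equal weights.
  have hstep3 : ∫ u, ‖charFun ρ u‖ ∂(stdGaussian ℂ) ≤
      ∫ u, ∑ k ∈ t, (1 / (2 * l) : ℝ) * ‖charFun ν (conj (b k) * u)‖ ^ (2 * l)
        ∂(stdGaussian ℂ) := by
    refine integral_mono_of_nonneg (ae_of_all _ fun u => norm_nonneg _)
      (integrable_finsetSum _ fun k _ => (hint k).const_mul _) (ae_of_all _ fun u => ?_)
    simp only
    rw [hchar, norm_prod]
    calc ∏ k ∈ s, ‖charFun ν (conj (b k) * u)‖ ≤ ∏ k ∈ t, ‖charFun ν (conj (b k) * u)‖ :=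
          Finset.prod_le_prod_of_subset_of_le_one hts (fun k _ => norm_nonneg _)
            (fun k _ _ => norm_charFun_le_one _)
      _ = ∏ k ∈ t, (‖charFun ν (conj (b k) * u)‖ ^ (2 * l)) ^ (1 / (2 * l) : ℝ) := by
          refine Finset.prod_congr rfl fun k _ => ?_
          rw [← Real.rpow_natCast, ← Real.rpow_mul (norm_nonneg _)]
          push_cast
          rw [mul_one_div_cancel hl'.ne', Real.rpow_one]
      _ ≤ _ := Real.geom_mean_le_arith_mean_weighted t _ _ (fun _ _ => by positivity)
          (by rw [Finset.sum_const, ht, nsmul_eq_mul]; push_cast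
              field_simp) (fun _ _ => by positivity)
  have hstep4 : ∫ u, ∑ k ∈ t, (1 / (2 * l) : ℝ) * ‖charFun ν (conj (b k) * u)‖ ^ (2 * l)
        ∂(stdGaussian ℂ) ≤ ∫ u, ‖charFun ν u‖ ^ (2 * l) ∂(stdGaussian ℂ) := by
    rw [integral_finsetSum _ fun k _ => (hint k).const_mul _]
    simp_rw [integral_const_mul]
    calc _ ≤ ∑ k ∈ t, (1 / (2 * l) : ℝ) * ∫ u, ‖charFun ν u‖ ^ (2 * l) ∂(stdGaussian ℂ) :=
          Finset.sum_le_sum fun k hk => mul_le_mul_of_nonneg_left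
            (integral_norm_charFun_pow_anti ν l (by simpa using hb k hk)) (by positivity)
      _ = _ := by
          rw [Finset.sum_const, ht, nsmul_eq_mul]; push_cast; field_simp
  exact hstep1.trans (mul_le_mul_of_nonneg_left (hstep2.trans (hstep3.trans hstep4))
    (Real.exp_pos _).le)

/-- The point is uniformity: `m` depends on `η` and the law of `ξ 0` only, not on the coefficients
or the number of summands. -/
lemma exists_card_measure_norm_sum_le_one {Ω : Type*} [MeasurableSpace Ω] (P : Measure Ω)
    [IsProbabilityMeasure P] (ξ : ℕ → Ω → ℂ) (hm : ∀ k, Measurable (ξ k)) (hind : iIndepFun ξ P)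
    (hid : ∀ k, IdentDistrib (ξ k) (ξ 0) P P)
    (hnd : ¬ ∃ x : ℂ, ∀ᵐ ω ∂P, ξ 0 ω = x) {η : ℝ} (hη : 0 < η) :
    ∃ m : ℕ, ∀ (s : Finset ℕ) (b : ℕ → ℂ), m ≤ (s.filter fun k => 1 ≤ ‖b k‖).card →
      P.real {ω | ‖∑ k ∈ s, b k * ξ k ω‖ ≤ 1} ≤ η := by
  have : IsProbabilityMeasure (P.map (ξ 0)) :=
    Measure.isProbabilityMeasure_map (hm 0).aemeasurable
  have hν : ¬ ∃ x, ∀ᵐ y ∂(P.map (ξ 0)), y = x := by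
    rintro ⟨x, hx⟩
    exact hnd ⟨x, ae_of_ae_map (hm 0).aemeasurable hx⟩
  have h := (tendsto_integral_norm_charFun_pow _ hν).const_mul (Real.exp (1 / 2))
  rw [mul_zero] at h
  obtain ⟨l, hl, hl0⟩ := ((h.eventually (gt_mem_nhds hη)).and (eventually_gt_atTop 0)).exists
  refine ⟨2 * l, fun s b hs => ?_⟩
  obtain ⟨t, hts, ht⟩ := Finset.exists_subset_card_eq hs
  exact (measure_norm_sum_le_one_le P ξ hm hind hid s t
    (hts.trans (Finset.filter_subset _ _)) b (fun k hk => (Finset.mem_filter.1 (hts hk)).2)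
    l hl0 ht).trans hl.le

end RandomZeros

namespace RandomZeros

/-! ### Logarithmic asymptotics of random linear combinations -/

section Random

variable {Ω : Type*} [MeasurableSpace Ω] {P : Measure Ω} [IsProbabilityMeasure P] {ξ : ℕ → Ω → ℂ}

/-- Dominated convergence: `(n + 1) 1{εn < Y}` tends to `0` pointwise and is at most `Y/ε + 1`. The
factor `n + 1` is there for a union bound over `k ≤ n`. -/
lemma tendsto_mul_measure_lt {Y : Ω → ℝ} (hYm : Measurable Y) (hY : Integrable Y P)
    (hY0 : ∀ ω, 0 ≤ Y ω) {ε : ℝ} (hε : 0 < ε) :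
    Tendsto (fun n : ℕ => ((n : ℝ) + 1) * P.real {ω | ε * n < Y ω}) atTop (𝓝 0) := by
  have hms : ∀ n : ℕ, MeasurableSet {ω | ε * n < Y ω} := fun n =>
    measurableSet_lt measurable_const hYm
  have h := tendsto_integral_of_dominated_convergence (μ := P)
    (F := fun (n : ℕ) => {ω | ε * n < Y ω}.indicator (fun _ => (n : ℝ) + 1)) (f := fun _ => 0)
    (fun ω => ε⁻¹ * Y ω + 1)
    (fun n => (measurable_const.indicator (hms n)).aestronglyMeasurable)
    ((hY.const_mul _).add (integrable_const _))
    (fun n => ae_of_all _ fun ω => ?_) (ae_of_all _ fun ω => ?_)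
  · simp only [integral_zero] at h
    refine h.congr fun n => ?_
    rw [integral_indicator_const _ (hms n), smul_eq_mul, mul_comm]
  · rw [Real.norm_eq_abs, abs_of_nonneg (indicator_nonneg (fun _ _ => by positivity) _)]
    refine indicator_le' (g := fun ω => ε⁻¹ * Y ω + 1) (fun ω hω => ?_) (fun ω _ => ?_) ω
    · simp only [mem_ofPred_eq] at hω
      have : (n : ℝ) ≤ ε⁻¹ * Y ω := by
        rw [inv_mul_eq_div, le_div_iff₀ hε]; linarith
      linarith
    · have := hY0 ω
      positivity
  · refine tendsto_const_nhds.congr' ?_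
    have : ∀ᶠ n : ℕ in atTop, Y ω / ε < n := tendsto_natCast_atTop_atTop.eventually_gt_atTop _
    filter_upwards [this] with n hn
    rw [div_lt_iff₀ hε] at hn
    rw [indicator_of_notMem]
    simp only [mem_ofPred_eq, not_lt]
    linarith

lemma tendsto_measure_exists_exp_lt (hm : ∀ k, Measurable (ξ k))
    (hid : ∀ k, IdentDistrib (ξ k) (ξ 0) P P)
    (hlog : Integrable (fun ω => Real.log (1 + ‖ξ 0 ω‖)) P) {ε : ℝ} (hε : 0 < ε) :
    Tendsto (fun n : ℕ => P.real {ω | ∃ k ∈ Finset.range (n + 1), Real.exp (ε * n) < ‖ξ k ω‖})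
      atTop (𝓝 0) := by
  have h := tendsto_mul_measure_lt (P := P) (Y := fun ω => Real.log (1 + ‖ξ 0 ω‖))
    (by have := hm 0; fun_prop) hlog
    (fun ω => Real.log_nonneg (by linarith [norm_nonneg (ξ 0 ω)])) hε
  refine squeeze_zero (fun n => measureReal_nonneg) (fun n => ?_) h
  have e1 : {ω | ∃ k ∈ Finset.range (n + 1), Real.exp (ε * n) < ‖ξ k ω‖} =
      ⋃ k ∈ Finset.range (n + 1), {ω | Real.exp (ε * n) < ‖ξ k ω‖} := by
    ext ω; simp
  rw [e1]
  refine (measureReal_biUnion_finset_le _ _).trans ?_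
  calc _ ≤ ∑ k ∈ Finset.range (n + 1), P.real {ω | ε * n < Real.log (1 + ‖ξ 0 ω‖)} := by
        refine Finset.sum_le_sum fun k _ => ?_
        have : P.real {ω | Real.exp (ε * n) < ‖ξ k ω‖} =
            P.real {ω | Real.exp (ε * n) < ‖ξ 0 ω‖} :=
          congrArg ENNReal.toReal ((hid k).measure_mem_eq (s := {x | Real.exp (ε * n) < ‖x‖})
            (measurableSet_lt measurable_const measurable_norm))
        rw [this]
        refine measureReal_mono fun ω hω => ?_
        simp only [mem_ofPred_eq] at hω ⊢
        rw [Real.lt_log_iff_exp_lt (by positivity)]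
        linarith
    _ = _ := by simp

/-- Only the law of `ξ (κ n)` matters, so the index may vary with `n`; it will be the order of
differentiation. -/
lemma tendsto_measure_norm_lt_exp_neg (hm : ∀ k, Measurable (ξ k))
    (hid : ∀ k, IdentDistrib (ξ k) (ξ 0) P P) (h0 : P {ω | ξ 0 ω = 0} = 0) (κ : ℕ → ℕ) {ε : ℝ}
    (hε : 0 < ε) :
    Tendsto (fun n : ℕ => P.real {ω | ‖ξ (κ n) ω‖ < Real.exp (-(ε * n))}) atTop (𝓝 0) := by
  have e : ∀ n : ℕ, P.real {ω | ‖ξ (κ n) ω‖ < Real.exp (-(ε * n))} =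
      P.real {ω | ‖ξ 0 ω‖ < Real.exp (-(ε * n))} := fun n =>
    congrArg ENNReal.toReal ((hid (κ n)).measure_mem_eq (s := {x | ‖x‖ < Real.exp (-(ε * n))})
            (measurableSet_lt measurable_norm measurable_const))
  simp_rw [e]
  have hms : ∀ n : ℕ, MeasurableSet {ω | ‖ξ 0 ω‖ < Real.exp (-(ε * n))} := fun n =>
    measurableSet_lt (hm 0).norm measurable_const
  have hlim : Tendsto (fun n : ℕ => Real.exp (-(ε * n))) atTop (𝓝 0) := by
    refine Real.tendsto_exp_atBot.comp (tendsto_neg_atTop_atBot.comp ?_)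
    exact tendsto_natCast_atTop_atTop.const_mul_atTop hε
  have h := tendsto_integral_of_dominated_convergence (μ := P)
    (F := fun (n : ℕ) => {ω | ‖ξ 0 ω‖ < Real.exp (-(ε * n))}.indicator (fun _ => (1 : ℝ)))
    (f := fun _ => 0) (fun ω => 1)
    (fun n => (measurable_const.indicator (hms n)).aestronglyMeasurable)
    (integrable_const _)
    (fun n => ae_of_all _ fun ω => ?_) ?_
  · simp only [integral_zero] at h
    refine h.congr fun n => ?_
    rw [integral_indicator_const _ (hms n), smul_eq_mul, mul_one]
  · rw [Real.norm_eq_abs, abs_of_nonneg (indicator_nonneg (fun _ _ => by positivity) _)]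
    exact indicator_le' (g := fun _ => (1 : ℝ)) (fun ω hω => le_rfl) (fun ω _ => zero_le_one) ω
  · have : ∀ᵐ ω ∂P, ξ 0 ω ≠ 0 := by rw [ae_iff]; simpa using h0
    filter_upwards [this] with ω hω
    refine tendsto_const_nhds.congr' ?_
    filter_upwards [hlim.eventually (gt_mem_nhds (norm_pos_iff.2 hω))] with n hn
    rw [indicator_of_notMem]
    simp only [mem_ofPred_eq, not_lt]
    exact hn.le

lemma eventually_natCast_add_one_le_exp {ε : ℝ} (hε : 0 < ε) :
    ∀ᶠ n : ℕ in atTop, (n : ℝ) + 1 ≤ Real.exp (ε * n) := by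
  have h1 : Tendsto (fun n : ℕ => ε * n) atTop atTop :=
    tendsto_natCast_atTop_atTop.const_mul_atTop hε
  have h2 := ((Real.tendsto_exp_div_pow_atTop 1).comp h1).eventually_ge_atTop (2 / ε)
  filter_upwards [h2, eventually_ge_atTop 1] with n hn hn1
  have hn1' : (1 : ℝ) ≤ n := by exact_mod_cast hn1
  simp only [Function.comp, pow_one] at hn
  rw [div_le_div_iff₀ hε (by positivity)] at hn
  have : 2 * (n : ℝ) ≤ Real.exp (ε * n) := by
    have : ε * (2 * n) ≤ ε * Real.exp (ε * n) := by linarith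
    exact le_of_mul_le_mul_left this hε
  linarith

lemma norm_sum_mul_le {n : ℕ} {x a : ℕ → ℂ} {A B : ℝ}
    (hx : ∀ k ∈ Finset.range (n + 1), ‖x k‖ ≤ A) (ha : ∀ k ∈ Finset.range (n + 1), ‖a k‖ ≤ B) :
    ‖∑ k ∈ Finset.range (n + 1), x k * a k‖ ≤ (n + 1) * (A * B) := by
  have hA : 0 ≤ A := (norm_nonneg _).trans (hx 0 (by simp))
  calc _ ≤ ∑ k ∈ Finset.range (n + 1), ‖x k * a k‖ := norm_sum_le _ _
    _ ≤ ∑ k ∈ Finset.range (n + 1), A * B := Finset.sum_le_sum fun k hk => by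
        rw [norm_mul]
        exact mul_le_mul (hx k hk) (ha k hk) (norm_nonneg _) hA
    _ = _ := by simp

/-- If the coefficients `a n k`, `k ≤ n`, have exponential order at most `L`, and an unbounded
number of them is of exponential order `L`, then so is the random linear combination. -/
theorem tendstoInMeasure_log_norm_sum (hm : ∀ k, Measurable (ξ k)) (hind : iIndepFun ξ P)
    (hid : ∀ k, IdentDistrib (ξ k) (ξ 0) P P)
    (hnd : ¬ ∃ x : ℂ, ∀ᵐ ω ∂P, ξ 0 ω = x)
    (hlog : Integrable (fun ω => Real.log (1 + ‖ξ 0 ω‖)) P) (a : ℕ → ℕ → ℂ) (L : ℝ)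
    (hU : ∀ ε > 0, ∀ᶠ n : ℕ in atTop, ∀ k ∈ Finset.range (n + 1),
      ‖a n k‖ ≤ Real.exp (n * (L + ε)))
    (hL : ∀ ε > 0, ∀ m : ℕ, ∀ᶠ n : ℕ in atTop,
      m ≤ ((Finset.range (n + 1)).filter fun k => Real.exp (n * (L - ε)) ≤ ‖a n k‖).card) :
    TendstoInMeasure P
      (fun (n : ℕ) ω => (n : ℝ)⁻¹ * Real.log ‖∑ k ∈ Finset.range (n + 1), ξ k ω * a n k‖)
      atTop (fun _ => L) := by
  rw [tendstoInMeasure_iff_measureReal_dist]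
  intro ε hε
  have hmax := tendsto_measure_exists_exp_lt hm hid hlog (ε := ε / 4) (by positivity)
  have hsmall : Tendsto (fun n : ℕ => P.real {ω |
      ‖∑ k ∈ Finset.range (n + 1), ξ k ω * a n k‖ ≤ Real.exp (n * (L - ε / 2))}) atTop (𝓝 0) := by
    refine tendsto_order.2 ⟨fun x hx => Eventually.of_forall fun n =>
      hx.trans_le measureReal_nonneg, fun η hη => ?_⟩
    obtain ⟨m, hmm⟩ := exists_card_measure_norm_sum_le_one P ξ hm hind hid hnd (half_pos hη)
    filter_upwards [hL (ε / 2) (by positivity) m] with n hn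
    set E := Real.exp (n * (L - ε / 2)) with hE
    have hE0 : 0 < E := Real.exp_pos _
    -- Division by `E = e^(n(L - ε/2))` gives the large coefficients modulus at least `1` and turns
    -- the event into membership of the unit disk.
    have h1 := hmm (Finset.range (n + 1)) (fun k => ((E⁻¹ : ℝ) : ℂ) * a n k) (by
      convert hn using 3
      rw [norm_mul, Complex.norm_real, Real.norm_eq_abs, abs_of_pos (inv_pos.2 hE0),
        inv_mul_eq_div, le_div_iff₀ hE0, one_mul])
    refine lt_of_le_of_lt (le_trans (le_of_eq ?_) h1) (half_lt_self hη)
    congr 1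
    ext ω
    have : ∑ k ∈ Finset.range (n + 1), ((E⁻¹ : ℝ) : ℂ) * a n k * ξ k ω =
        ((E⁻¹ : ℝ) : ℂ) * ∑ k ∈ Finset.range (n + 1), ξ k ω * a n k := by
      rw [Finset.mul_sum]; exact Finset.sum_congr rfl fun k _ => by ring
    simp only [mem_ofPred_eq, this]
    rw [norm_mul, Complex.norm_real, Real.norm_eq_abs, abs_of_pos (inv_pos.2 hE0),
        inv_mul_eq_div, div_le_iff₀ hE0, one_mul]
  have hsum := hmax.add hsmall
  rw [add_zero] at hsum
  refine squeeze_zero' (Eventually.of_forall fun n => measureReal_nonneg) ?_ hsum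
  filter_upwards [hU (ε / 4) (by positivity),
    eventually_natCast_add_one_le_exp (ε := ε / 4) (by positivity),
    eventually_gt_atTop 0] with n hn hn1 hn0
  have hn0' : (0 : ℝ) < n := by exact_mod_cast hn0
  refine (measureReal_mono ?_).trans (measureReal_union_le _ _)
  intro ω hω
  simp only [mem_ofPred_eq, mem_union] at hω ⊢
  by_contra hcon
  push Not at hcon
  obtain ⟨hb, hs⟩ := hcon
  set S := ∑ k ∈ Finset.range (n + 1), ξ k ω * a n k
  have hSpos : 0 < ‖S‖ := (Real.exp_pos _).trans hs
  -- One `ε/4` each for the number of terms, the size of the `ξ k` and the coefficients.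
  have hup : ‖S‖ ≤ Real.exp (n * (L + 3 * ε / 4)) := by
    calc ‖S‖ ≤ (n + 1) * (Real.exp (ε / 4 * n) * Real.exp (n * (L + ε / 4))) :=
          norm_sum_mul_le hb hn
      _ ≤ Real.exp (ε / 4 * n) * (Real.exp (ε / 4 * n) * Real.exp (n * (L + ε / 4))) := by
          gcongr
      _ = _ := by rw [← Real.exp_add, ← Real.exp_add]; congr 1; ring
  have h1 : Real.log ‖S‖ ≤ n * (L + 3 * ε / 4) := (Real.log_le_iff_le_exp hSpos).2 hup
  have h2 : n * (L - ε / 2) < Real.log ‖S‖ := (Real.lt_log_iff_exp_lt hSpos).2 hs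
  have h3 : (n : ℝ)⁻¹ * Real.log ‖S‖ ≤ L + 3 * ε / 4 := by
    rw [inv_mul_eq_div, div_le_iff₀ hn0']; linarith
  have h4 : L - ε / 2 < (n : ℝ)⁻¹ * Real.log ‖S‖ := by
    rw [inv_mul_eq_div, lt_div_iff₀ hn0']; linarith
  rw [Real.dist_eq] at hω
  have : |(n : ℝ)⁻¹ * Real.log ‖S‖ - L| < ε := by
    rw [abs_lt]; constructor <;> linarith
  linarith

end Random

end RandomZeros

namespace RandomZeros

open Metric
open Real (circleAverage)

/-! ### Local integrability of the logarithmic kernel -/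

/-- In polar coordinates the integrand is `y (log y)² = 4 (√y log √y)²`, which is continuous up to
`0`. -/
lemma integrableOn_log_norm_sq (ρ : ℝ) :
    IntegrableOn (fun x : ℂ => (Real.log ‖x‖) ^ 2) (closedBall 0 ρ) := by
  have h1 : IntegrableOn (fun y : ℝ => y ^ (Module.finrank ℝ ℂ - 1) •
      (Iic ρ).indicator (fun y => (Real.log y) ^ 2) y) (Ioi 0) := by
    have h2 : Continuous fun y : ℝ => 4 * (√y * Real.log (√y)) ^ 2 :=
      continuous_const.mul ((Real.continuous_mul_log.comp Real.continuous_sqrt).pow 2)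
    have h3 : IntegrableOn (fun y : ℝ => 4 * (√y * Real.log (√y)) ^ 2) (Ioc 0 ρ) :=
      (h2.integrableOn_Icc (a := 0) (b := ρ)).mono_set Ioc_subset_Icc_self
    rw [← integrable_indicator_iff measurableSet_Ioc] at h3
    rw [← integrable_indicator_iff measurableSet_Ioi]
    refine h3.congr (ae_of_all _ fun y => ?_)
    by_cases hy : 0 < y
    · by_cases hyρ : y ≤ ρ
      · simp only [indicator_of_mem (show y ∈ Ioc 0 ρ from ⟨hy, hyρ⟩),
          indicator_of_mem (show y ∈ Ioi (0 : ℝ) from hy),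
          indicator_of_mem (show y ∈ Iic ρ from hyρ), Complex.finrank_real_complex]
        rw [Real.log_sqrt hy.le, mul_pow, Real.sq_sqrt hy.le, smul_eq_mul]
        ring
      · simp [indicator, hy, hyρ]
    · simp [indicator, hy]
  have h4 := (integrable_fun_norm_addHaar (volume : Measure ℂ)).2 h1
  rw [← integrable_indicator_iff measurableSet_closedBall]
  refine h4.congr (ae_of_all _ fun x => ?_)
  simp [indicator]

/-- The integral of `(log |x|)²` over the disk of radius `ρ`. -/
noncomputable def logSqIntegral (ρ : ℝ) : ℝ := ∫ x : ℂ in closedBall 0 ρ, (Real.log ‖x‖) ^ 2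

lemma closedBall_subset_preimage_sub {R M : ℝ} {w : ℂ} (hw : ‖w‖ ≤ M) :
    closedBall (0 : ℂ) R ⊆ (fun z => z - w) ⁻¹' closedBall 0 (R + M) := by
  intro z hz
  simp only [mem_preimage, mem_closedBall, dist_zero_right] at hz ⊢
  exact (norm_sub_le _ _).trans (add_le_add hz hw)

lemma integrableOn_log_norm_sub_sq (R : ℝ) (w : ℂ) :
    IntegrableOn (fun z : ℂ => (Real.log ‖z - w‖) ^ 2) (closedBall 0 R) := by
  have h := ((measurePreserving_sub_right volume w).integrableOn_comp_preimage
    (measurableEmbedding_subRight w)).2 (integrableOn_log_norm_sq (R + ‖w‖))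
  exact h.mono_set (closedBall_subset_preimage_sub le_rfl)

lemma integral_log_norm_sub_sq_le {R M : ℝ} {w : ℂ} (hw : ‖w‖ ≤ M) :
    ∫ z in closedBall 0 R, (Real.log ‖z - w‖) ^ 2 ≤ logSqIntegral (R + M) := by
  have h := (measurePreserving_sub_right volume w).setIntegral_preimage_emb
    (measurableEmbedding_subRight w) (fun x : ℂ => (Real.log ‖x‖) ^ 2) (closedBall 0 (R + M))
  rw [logSqIntegral, ← h]
  refine setIntegral_mono_set ?_ (ae_of_all _ fun z => sq_nonneg _)
    (closedBall_subset_preimage_sub hw).eventuallyLE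
  exact ((measurePreserving_sub_right volume w).integrableOn_comp_preimage
    (measurableEmbedding_subRight w)).2 (integrableOn_log_norm_sq (R + M))

lemma abs_le_one_add_sq (x : ℝ) : |x| ≤ 1 + x ^ 2 := by
  rw [← sq_abs]; nlinarith [sq_nonneg (|x| - 1), abs_nonneg x]

lemma integrableOn_log_norm_sub (R : ℝ) (w : ℂ) :
    IntegrableOn (fun z : ℂ => Real.log ‖z - w‖) (closedBall 0 R) := by
  have hf : IsFiniteMeasure (volume.restrict (closedBall (0 : ℂ) R)) :=
    ⟨by rw [Measure.restrict_apply_univ]; exact measure_closedBall_lt_top⟩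
  refine Integrable.mono' ((integrable_const (1 : ℝ)).add (integrableOn_log_norm_sub_sq R w))
    (Measurable.aestronglyMeasurable (by fun_prop)) (ae_of_all _ fun z => ?_)
  exact abs_le_one_add_sq _

/-! ### Averages over circles and smoothing kernels -/

lemma continuous_circleAverage_center {φ : ℂ → ℝ} (hφ : Continuous φ) (r : ℝ) :
    Continuous fun z => circleAverage φ z r := by
  unfold Real.circleAverage
  have h : Continuous (Function.uncurry fun (z : ℂ) (θ : ℝ) => φ (circleMap z r θ)) :=
    hφ.comp (by unfold circleMap; fun_prop)
  exact continuous_const.mul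
    (intervalIntegral.continuous_parametric_intervalIntegral_of_continuous' (μ := volume)
      h 0 (2 * Real.pi))

lemma circleAverage_eq_setIntegral (f : ℂ → ℝ) (z : ℂ) (r : ℝ) :
    circleAverage f z r =
      (2 * Real.pi)⁻¹ * ∫ θ in Ioc 0 (2 * Real.pi), f (circleMap z r θ) := by
  rw [Real.circleAverage, intervalIntegral.integral_of_le Real.two_pi_pos.le, smul_eq_mul]

lemma abs_circleAverage_le {φ : ℂ → ℝ} {B : ℝ} (hB : ∀ z, |φ z| ≤ B) (z : ℂ) (r : ℝ) :
    |circleAverage φ z r| ≤ B := by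
  rw [Real.circleAverage, smul_eq_mul, abs_mul, abs_of_pos (inv_pos.2 Real.two_pi_pos)]
  have := intervalIntegral.norm_integral_le_of_norm_le_const (a := 0) (b := 2 * Real.pi)
    (f := fun θ => φ (circleMap z r θ)) (C := B) (fun θ _ => hB _)
  rw [sub_zero, abs_of_pos Real.two_pi_pos] at this
  rw [inv_mul_le_iff₀ Real.two_pi_pos, mul_comm (2 * Real.pi)]
  exact this

lemma circleAverage_eq_zero_of_support {φ : ℂ → ℝ} {A r : ℝ} (hr : 0 ≤ r)
    (hA : ∀ z, A < ‖z‖ → φ z = 0) {z : ℂ} (hz : A + r < ‖z‖) : circleAverage φ z r = 0 := by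
  have : ∀ θ, φ (circleMap z r θ) = 0 := fun θ => hA _ <| by
    have h1 : ‖circleMap z r θ - z‖ = r := by
      simp [circleMap, abs_of_nonneg hr]
    have h2 : ‖z‖ ≤ ‖circleMap z r θ‖ + ‖circleMap z r θ - z‖ := by
      have := norm_sub_le (circleMap z r θ) (circleMap z r θ - z)
      rwa [sub_sub_cancel] at this
    linarith
  simp [Real.circleAverage, this]

/-- Self-adjointness of the circular mean operator. -/
lemma integral_mul_circleAverage {h φ : ℂ → ℝ} (hm : Measurable h)
    (hloc : ∀ ρ, IntegrableOn h (closedBall 0 ρ)) (hφ : Continuous φ) {A r B : ℝ} (hr : 0 ≤ r)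
    (hA : ∀ z, A < ‖z‖ → φ z = 0) (hB : ∀ z, |φ z| ≤ B) :
    ∫ z, h z * circleAverage φ z r = ∫ v, φ v * circleAverage h v r := by
  set Θ : Measure ℝ := volume.restrict (Ioc 0 (2 * Real.pi)) with hΘ
  have hΘf : IsFiniteMeasure Θ := ⟨by
    rw [hΘ, Measure.restrict_apply_univ]; exact measure_Ioc_lt_top⟩
  let F : ℝ × ℂ → ℝ := fun q => h q.2 * φ (circleMap q.2 r q.1)
  have hcm : Continuous fun q : ℝ × ℂ => circleMap q.2 r q.1 := by unfold circleMap; fun_prop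
  have hFm : Measurable F := (hm.comp measurable_snd).mul (hφ.comp hcm).measurable
  have hdom : Integrable (fun q : ℝ × ℂ =>
      (closedBall (0 : ℂ) (A + r)).indicator (fun z => B * |h z|) q.2) (Θ.prod volume) := by
    have h1 : Integrable ((closedBall (0 : ℂ) (A + r)).indicator (fun z => B * |h z|)) :=
      (integrable_indicator_iff measurableSet_closedBall).2 ((hloc (A + r)).abs.const_mul B)
    exact h1.comp_snd Θ
  have hF : Integrable F (Θ.prod volume) := by
    refine hdom.mono' hFm.aestronglyMeasurable (ae_of_all _ fun q => ?_)
    simp only [F, Real.norm_eq_abs, abs_mul]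
    by_cases hq : q.2 ∈ closedBall (0 : ℂ) (A + r)
    · rw [indicator_of_mem hq, mul_comm]
      exact mul_le_mul_of_nonneg_right (hB _) (abs_nonneg _)
    · rw [indicator_of_notMem hq]
      simp only [mem_closedBall, dist_zero_right, not_le] at hq
      have : φ (circleMap q.2 r q.1) = 0 := hA _ <| by
        have h1 : ‖circleMap q.2 r q.1 - q.2‖ = r := by
          simp [circleMap, abs_of_nonneg hr]
        have h2 := norm_sub_le (circleMap q.2 r q.1) (circleMap q.2 r q.1 - q.2)
        rw [sub_sub_cancel] at h2
        linarith
      simp [this]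
  -- For each angle this is a translation of the plane, so it preserves the product measure. It
  -- moves the circular shift from `φ` to `h` at the cost of replacing `r` by `-r`, which leaves
  -- circle averages unchanged.
  let T : ℝ × ℂ → ℝ × ℂ := fun q => (q.1, circleMap q.2 (-r) q.1)
  have hcm' : Continuous fun q : ℝ × ℂ => circleMap q.2 (-r) q.1 := by unfold circleMap; fun_prop
  have hT : MeasurePreserving T (Θ.prod volume) (Θ.prod volume) := by
    refine MeasurePreserving.skew_product (f := id) (g := fun θ z => circleMap z (-r) θ)
      (MeasurePreserving.id Θ) hcm'.measurable (ae_of_all _ fun θ => ?_)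
    exact (measurePreserving_add_right volume _).map_eq
  have hFT : Integrable (F ∘ T) (Θ.prod volume) := hT.integrable_comp_of_integrable hF
  have hFT' : ∀ θ v, (F ∘ T) (θ, v) = φ v * h (circleMap v (-r) θ) := fun θ v => by
    simp only [F, T, Function.comp]
    rw [mul_comm]
    congr 2
    simp [circleMap]
  calc ∫ z, h z * circleAverage φ z r
      = (2 * Real.pi)⁻¹ * ∫ z, ∫ θ, F (θ, z) ∂Θ := by
        rw [← integral_const_mul]
        refine integral_congr_ae (ae_of_all _ fun z => ?_)
        simp only [F]
        rw [circleAverage_eq_setIntegral, integral_const_mul]; ring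
    _ = (2 * Real.pi)⁻¹ * ∫ θ, ∫ z, F (θ, z) ∂volume ∂Θ := by
        rw [integral_integral_swap (f := fun θ z => F (θ, z)) hF]
    _ = (2 * Real.pi)⁻¹ * ∫ θ, ∫ v, (F ∘ T) (θ, v) ∂volume ∂Θ := by
        congr 1
        refine integral_congr_ae (ae_of_all _ fun θ => ?_)
        simp only [Function.comp, T]
        exact (integral_add_right_eq_self (fun z => F (θ, z)) _).symm
    _ = (2 * Real.pi)⁻¹ * ∫ v, ∫ θ, (F ∘ T) (θ, v) ∂Θ := by
        rw [integral_integral_swap (f := fun θ z => (F ∘ T) (θ, z)) hFT]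
    _ = _ := by
        rw [← integral_const_mul]
        refine integral_congr_ae (ae_of_all _ fun v => ?_)
        simp only [hFT']
        rw [← Real.circleAverage_neg_radius, circleAverage_eq_setIntegral, integral_const_mul]
        ring

/-- The difference of the potentials of the uniform distributions on the circles of radii `2ε`
and `ε`. -/
noncomputable def ringKernel (ε : ℝ) (x : ℂ) : ℝ :=
  (Real.log (2 * ε) + Real.posLog ((2 * ε)⁻¹ * ‖x‖)) - (Real.log ε + Real.posLog (ε⁻¹ * ‖x‖))

lemma log_add_posLog {ρ : ℝ} (hρ : 0 < ρ) (t : ℝ) (ht : 0 ≤ t) :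
    Real.log ρ + Real.posLog (ρ⁻¹ * t) = Real.log (max ρ t) := by
  rw [Real.posLog_eq_log_max_one (by positivity), ← Real.log_mul hρ.ne' (by positivity),
    mul_max_of_nonneg _ _ hρ.le, mul_one, mul_inv_cancel_left₀ hρ.ne']

/-- In this form nonnegativity, continuity at `0` and vanishing for `|x| ≥ 2ε` are visible. -/
lemma ringKernel_eq {ε : ℝ} (hε : 0 < ε) (x : ℂ) :
    ringKernel ε x = Real.log (max (2 * ε) ‖x‖) - Real.log (max ε ‖x‖) := by
  rw [ringKernel, log_add_posLog hε _ (norm_nonneg _),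
    log_add_posLog (by positivity) _ (norm_nonneg _)]

lemma ringKernel_nonneg {ε : ℝ} (hε : 0 < ε) (x : ℂ) : 0 ≤ ringKernel ε x := by
  rw [ringKernel_eq hε, sub_nonneg]
  exact Real.log_le_log (lt_max_of_lt_left hε) (max_le_max_right _ (by linarith))

lemma ringKernel_eq_zero {ε : ℝ} (hε : 0 < ε) {x : ℂ} (hx : 2 * ε ≤ ‖x‖) :
    ringKernel ε x = 0 := by
  rw [ringKernel_eq hε, max_eq_right hx, max_eq_right (by linarith), sub_self]

lemma continuous_ringKernel {ε : ℝ} (hε : 0 < ε) : Continuous (ringKernel ε) := by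
  have : ringKernel ε = fun x => Real.log (max (2 * ε) ‖x‖) - Real.log (max ε ‖x‖) :=
    funext (ringKernel_eq hε)
  rw [this]
  refine Continuous.sub (Continuous.log (by fun_prop) fun x => ?_)
    (Continuous.log (by fun_prop) fun x => ?_)
  · exact (lt_max_of_lt_left (by linarith)).ne'
  · exact (lt_max_of_lt_left hε).ne'

lemma hasCompactSupport_ringKernel {ε : ℝ} (hε : 0 < ε) : HasCompactSupport (ringKernel ε) := by
  refine HasCompactSupport.of_support_subset_isCompact (isCompact_closedBall (0 : ℂ) (2 * ε)) ?_
  intro x hx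
  by_contra h
  simp only [mem_closedBall, dist_zero_right, not_le] at h
  exact hx (ringKernel_eq_zero hε h.le)

lemma integrable_ringKernel {ε : ℝ} (hε : 0 < ε) : Integrable (ringKernel ε) :=
  (continuous_ringKernel hε).integrable_of_hasCompactSupport (hasCompactSupport_ringKernel hε)

lemma integral_ringKernel_pos {ε : ℝ} (hε : 0 < ε) : 0 < ∫ x, ringKernel ε x := by
  refine (continuous_ringKernel hε).integral_pos_of_hasCompactSupport_nonneg_nonzero
    (hasCompactSupport_ringKernel hε) (ringKernel_nonneg hε) (x := 0) ?_
  rw [ringKernel_eq hε, norm_zero, max_eq_left (by linarith), max_eq_left hε.le, sub_ne_zero]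
  exact (Real.log_lt_log hε (by linarith)).ne'

/-- The difference of the circular means of `φ` of radii `2ε` and `ε`. -/
noncomputable def ringMean (φ : ℂ → ℝ) (ε : ℝ) (z : ℂ) : ℝ :=
  circleAverage φ z (2 * ε) - circleAverage φ z ε

lemma continuous_ringMean {φ : ℂ → ℝ} (hφ : Continuous φ) (ε : ℝ) :
    Continuous (ringMean φ ε) :=
  (continuous_circleAverage_center hφ _).sub (continuous_circleAverage_center hφ _)

lemma abs_ringMean_le {φ : ℂ → ℝ} {B : ℝ} (hB : ∀ z, |φ z| ≤ B) (ε : ℝ) (z : ℂ) :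
    |ringMean φ ε z| ≤ 2 * B := by
  have h1 := abs_le.1 (abs_circleAverage_le hB z (2 * ε))
  have h2 := abs_le.1 (abs_circleAverage_le hB z ε)
  rw [ringMean, abs_le]; constructor <;> linarith

lemma ringMean_eq_zero {φ : ℂ → ℝ} {A ε : ℝ} (hε : 0 < ε)
    (hA : ∀ z, A < ‖z‖ → φ z = 0) {z : ℂ} (hz : A + 2 * ε < ‖z‖) : ringMean φ ε z = 0 := by
  rw [ringMean, circleAverage_eq_zero_of_support (by positivity) hA hz,
    circleAverage_eq_zero_of_support hε.le hA (by linarith), sub_zero]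

lemma integrable_mul_ringMean {h φ : ℂ → ℝ}
    (hloc : ∀ ρ, IntegrableOn h (closedBall 0 ρ)) (hφ : Continuous φ) {A ε B : ℝ} (hε : 0 < ε)
    (hA : ∀ z, A < ‖z‖ → φ z = 0) (hB : ∀ z, |φ z| ≤ B) :
    Integrable fun z => h z * ringMean φ ε z := by
  have h1 : IntegrableOn (fun z => h z * ringMean φ ε z) (closedBall 0 (A + 2 * ε)) :=
    (hloc _).mul_bdd (c := 2 * B) (continuous_ringMean hφ ε).aestronglyMeasurable
      (ae_of_all _ fun z => abs_ringMean_le hB ε z)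
  refine (integrableOn_iff_integrable_of_support_subset fun z hz => ?_).1 h1
  by_contra h2
  simp only [mem_closedBall, dist_zero_right, not_le] at h2
  exact hz (by simp [ringMean_eq_zero hε hA h2])

lemma integrable_mul_circleAverage {h φ : ℂ → ℝ}
    (hloc : ∀ ρ, IntegrableOn h (closedBall 0 ρ)) (hφ : Continuous φ) {A r B : ℝ} (hr : 0 ≤ r)
    (hA : ∀ z, A < ‖z‖ → φ z = 0) (hB : ∀ z, |φ z| ≤ B) :
    Integrable fun z => h z * circleAverage φ z r := by
  have h1 : IntegrableOn (fun z => h z * circleAverage φ z r) (closedBall 0 (A + r)) :=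
    (hloc _).mul_bdd (c := B) (continuous_circleAverage_center hφ r).aestronglyMeasurable
      (ae_of_all _ fun z => abs_circleAverage_le hB z r)
  refine (integrableOn_iff_integrable_of_support_subset fun z hz => ?_).1 h1
  by_contra h2
  simp only [mem_closedBall, dist_zero_right, not_le] at h2
  exact hz (by simp [circleAverage_eq_zero_of_support hr hA h2])

/-- Circular means preserve the integral, by self-adjointness against the constant `1`. Additive
constants in a potential are therefore invisible to ring means. -/
lemma integral_ringMean {φ : ℂ → ℝ} (hφ : Continuous φ) {A ε B : ℝ} (hε : 0 < ε)
    (hA : ∀ z, A < ‖z‖ → φ z = 0) (hB : ∀ z, |φ z| ≤ B) : ∫ z, ringMean φ ε z = 0 := by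
  have hloc : ∀ ρ, IntegrableOn (fun _ : ℂ => (1 : ℝ)) (closedBall 0 ρ) := fun ρ =>
    integrableOn_const measure_closedBall_lt_top.ne
  have key : ∀ r, 0 ≤ r → ∫ z, circleAverage φ z r = ∫ v, φ v := fun r hr => by
    have := integral_mul_circleAverage (h := fun _ => 1) measurable_const hloc hφ hr hA hB
    simpa [Real.circleAverage_const] using this
  have hi : ∀ r, 0 ≤ r → Integrable fun z => circleAverage φ z r := fun r hr => by
    simpa using integrable_mul_circleAverage hloc hφ hr hA hB
  simp only [ringMean]
  rw [integral_sub (hi _ (by positivity)) (hi _ hε.le), key _ (by positivity), key _ hε.le,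
    sub_self]

/-- The logarithmic potential of the ring mean of `φ` is a smoothing of `φ`. -/
lemma integral_log_mul_ringMean {φ : ℂ → ℝ} (hφ : Continuous φ) {A ε B : ℝ} (hε : 0 < ε)
    (hA : ∀ z, A < ‖z‖ → φ z = 0) (hB : ∀ z, |φ z| ≤ B) (w : ℂ) :
    ∫ z, Real.log ‖z - w‖ * ringMean φ ε z = ∫ v, φ v * ringKernel ε (v - w) := by
  have hloc : ∀ ρ, IntegrableOn (fun z : ℂ => Real.log ‖z - w‖) (closedBall 0 ρ) := fun ρ =>
    integrableOn_log_norm_sub ρ w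
  have key : ∀ r, 0 < r → ∫ z, Real.log ‖z - w‖ * circleAverage φ z r =
      ∫ v, φ v * (Real.log r + Real.posLog (r⁻¹ * ‖v - w‖)) := fun r hr => by
    rw [integral_mul_circleAverage (by fun_prop) hloc hφ hr.le hA hB]
    refine integral_congr_ae (ae_of_all _ fun v => ?_)
    simp only
    rw [circleAverage_log_norm_sub_const_eq_log_radius_add_posLog hr.ne']
  have hcs : HasCompactSupport φ :=
    HasCompactSupport.of_support_subset_isCompact (isCompact_closedBall (0 : ℂ) A) fun z hz => by
      by_contra h
      simp only [mem_closedBall, dist_zero_right, not_le] at h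
      exact hz (hA z h)
  have hi : ∀ r, 0 < r → Integrable fun v =>
      φ v * (Real.log r + Real.posLog (r⁻¹ * ‖v - w‖)) := fun r hr => by
    refine Continuous.integrable_of_hasCompactSupport ?_ hcs.mul_right
    exact hφ.mul (continuous_const.add (Real.continuous_posLog.comp (by fun_prop)))
  simp only [ringMean, ringKernel, mul_sub]
  rw [integral_sub (integrable_mul_circleAverage hloc hφ (by positivity) hA hB)
    (integrable_mul_circleAverage hloc hφ hε.le hA hB), key _ (by positivity), key _ hε,
    integral_sub (hi _ (by positivity)) (hi _ hε)]

/-- The kernel is nonnegative and lives on `|v - w| ≤ 2ε`, where `φ` differs from `φ w` by at most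
`δ`. -/
lemma abs_integral_mul_ringKernel_sub_le {φ : ℂ → ℝ} (hφ : Continuous φ) {ε δ : ℝ} (hε : 0 < ε)
    (hδ : ∀ v w, ‖v - w‖ ≤ 2 * ε → |φ v - φ w| ≤ δ) (w : ℂ) :
    |(∫ v, φ v * ringKernel ε (v - w)) - (∫ x, ringKernel ε x) * φ w| ≤
      (∫ x, ringKernel ε x) * δ := by
  have hk : ∫ v, ringKernel ε (v - w) = ∫ x, ringKernel ε x :=
    integral_sub_right_eq_self (ringKernel ε) w
  have hki : Integrable fun v => ringKernel ε (v - w) := (integrable_ringKernel hε).comp_sub_right w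
  have hcs : HasCompactSupport fun v => ringKernel ε (v - w) :=
    (hasCompactSupport_ringKernel hε).comp_homeomorph (Homeomorph.subRight w)
  have hc : Continuous fun v => ringKernel ε (v - w) := (continuous_ringKernel hε).comp
      (by fun_prop)
  have hi : Integrable fun v => φ v * ringKernel ε (v - w) :=
    (hφ.mul hc).integrable_of_hasCompactSupport hcs.mul_left
  rw [← hk, ← integral_mul_const, ← integral_mul_const, ← integral_sub hi (hki.mul_const _)]
  refine (abs_integral_le_integral_abs).trans (integral_mono (hi.sub (hki.mul_const _)).abs
    (hki.mul_const _) fun v => ?_)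
  simp only
  rw [show φ v * ringKernel ε (v - w) - ringKernel ε (v - w) * φ w =
    ringKernel ε (v - w) * (φ v - φ w) by ring, abs_mul, abs_of_nonneg (ringKernel_nonneg hε _)]
  rcases le_or_gt ‖v - w‖ (2 * ε) with h | h
  · exact mul_le_mul_of_nonneg_left (hδ v w h) (ringKernel_nonneg hε _)
  · simp [ringKernel_eq_zero hε h.le]

end RandomZeros

namespace RandomZeros

open Metric
open Real (circleAverage)

/-! ### Logarithmic potentials of polynomials -/

lemma exists_roots_eq_map (q : Polynomial ℂ) :
    ∃ w : Fin q.roots.card → ℂ, q.roots = Finset.univ.val.map w := by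
  refine ⟨fun i => q.roots.toList.get (i.cast (by simp)), ?_⟩
  have h : (Finset.univ.val.map fun i : Fin q.roots.toList.length => q.roots.toList.get i) =
      q.roots := by
    rw [Fin.univ_val_map, List.ofFn_get, Multiset.coe_toList]
  conv_lhs => rw [← h]
  rw [Fin.univ_val_map, Fin.univ_val_map]
  congr 1
  exact (List.ofFn_congr (by simp) _)

/-- A polynomial with a chosen enumeration of its roots. -/
structure RootList (q : Polynomial ℂ) (d : ℕ) (w : Fin d → ℂ) : Prop where
  roots_eq : q.roots = Finset.univ.val.map w
  ne_zero : q ≠ 0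

namespace RootList

variable {q : Polynomial ℂ} {d : ℕ} {w : Fin d → ℂ}

lemma card_le (h : RootList q d w) : d ≤ q.natDegree := by
  have := Polynomial.card_roots' q
  rw [h.roots_eq] at this
  simpa using this

lemma mem_roots (h : RootList q d w) (i : Fin d) : q.eval (w i) = 0 := by
  have : w i ∈ q.roots := by rw [h.roots_eq]; simp
  exact (Polynomial.mem_roots'.1 this).2

lemma norm_eval (h : RootList q d w) (z : ℂ) :
    ‖q.eval z‖ = ‖q.leadingCoeff‖ * ∏ i, ‖z - w i‖ := by
  conv_lhs => rw [(IsAlgClosed.splits q).eq_prod_roots, h.roots_eq]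
  rw [Polynomial.eval_mul, Polynomial.eval_C, norm_mul, Multiset.map_map,
    Polynomial.eval_multiset_prod, Multiset.map_map, ← norm_prod]
  congr 2
  simp [Finset.prod]

lemma log_norm_eval (h : RootList q d w) {z : ℂ} (hz : ∀ i, z ≠ w i) :
    Real.log ‖q.eval z‖ = Real.log ‖q.leadingCoeff‖ + ∑ i, Real.log ‖z - w i‖ := by
  have h1 : ∀ i ∈ Finset.univ, ‖z - w i‖ ≠ 0 := fun i _ => by
    simpa [sub_eq_zero] using hz i
  rw [h.norm_eval, Real.log_mul (by simpa using h.ne_zero) (Finset.prod_ne_zero_iff.2 h1),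
    Real.log_prod h1]

/-- Expansion from the value at `0` rather than the leading coefficient, because the a priori lower
bound will be on `|q(0)|`. -/
lemma log_norm_eval_eq_add (h : RootList q d w) (h0 : q.eval 0 ≠ 0) {z : ℂ}
    (hz : ∀ i, z ≠ w i) :
    Real.log ‖q.eval z‖ = Real.log ‖q.eval 0‖ +
      ∑ i, (Real.log ‖z - w i‖ - Real.log ‖w i‖) := by
  have hw : ∀ i, (0 : ℂ) ≠ w i := fun i hi => h0 (by
    have := h.mem_roots i; rwa [← hi] at this)
  rw [h.log_norm_eval hz, h.log_norm_eval hw, Finset.sum_sub_distrib]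
  simp only [zero_sub, norm_neg]; ring

/-- Jensen's formula: the circular mean of `log |z - w|` is `log max(ρ, |w|)`. The roots, where the
sum formula for `log |q|` fails, form a finite set that the average ignores. -/
lemma circleAverage_log_norm_eval (h : RootList q d w) (h0 : q.eval 0 ≠ 0) {ρ : ℝ} (hρ : 0 < ρ) :
    circleAverage (fun z => Real.log ‖q.eval z‖) 0 ρ =
      Real.log ‖q.eval 0‖ + ∑ i, Real.posLog (ρ * ‖w i‖⁻¹) := by
  have hw : ∀ i, w i ≠ 0 := fun i hi => h0 (by
    have := h.mem_roots i; rwa [hi] at this)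
  have hint : ∀ i, CircleIntegrable (fun z => Real.log ‖z - w i‖) 0 ρ := fun i =>
    MeromorphicOn.circleIntegrable_log_norm fun _ _ => by fun_prop
  have h1 : circleAverage (fun z => Real.log ‖q.eval z‖) 0 ρ =
      circleAverage (fun z => Real.log ‖q.eval 0‖ +
        ∑ i, (Real.log ‖z - w i‖ - Real.log ‖w i‖)) 0 ρ := by
    refine Real.circleAverage_congr_codiscreteWithin ?_ hρ.ne'
    filter_upwards [compl_finite_mem_codiscreteWithin (finite_range w)] with z hz
    refine h.log_norm_eval_eq_add h0 fun i hi => hz ⟨i, hi.symm⟩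
  rw [h1, Real.circleAverage_fun_add (circleIntegrable_const _ _ _), Real.circleAverage_const,
    Real.circleAverage_fun_sum]
  · congr 1
    refine Finset.sum_congr rfl fun i _ => ?_
    rw [Real.circleAverage_fun_sub (hint i) (circleIntegrable_const _ _ _),
      Real.circleAverage_const,
      circleAverage_log_norm_sub_const_eq_log_radius_add_posLog hρ.ne', zero_sub, norm_neg,
      log_add_posLog hρ _ (norm_nonneg _)]
    have hwi : 0 < ‖w i‖ := norm_pos_iff.2 (hw i)
    rw [← Real.log_div (lt_max_of_lt_left hρ).ne' hwi.ne',
      Real.posLog_eq_log_max_one (by positivity)]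
    congr 1
    rw [div_eq_mul_inv, max_mul_of_nonneg _ _ (inv_nonneg.2 hwi.le), mul_inv_cancel₀ hwi.ne',
      max_comm]
  · exact fun i _ => (hint i).fun_sub (circleIntegrable_const _ _ _)
  · exact CircleIntegrable.fun_sum _ fun i _ => (hint i).fun_sub (circleIntegrable_const _ _ _)

end RootList

lemma exists_rootList {q : Polynomial ℂ} (hq : q ≠ 0) :
    ∃ (d : ℕ) (w : Fin d → ℂ), RootList q d w := by
  obtain ⟨w, hw⟩ := exists_roots_eq_map q
  exact ⟨_, w, hw, hq⟩

lemma ae_notMem_range {d : ℕ} (w : Fin d → ℂ) : ∀ᵐ z : ℂ, z ∉ range w :=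
  (measure_eq_zero_iff_ae_notMem).1 ((finite_range w).measure_zero volume)

/-- For `|w| > 2R` the moduli `|z - w|` and `|w|` agree up to a factor `2`. For `|w| ≤ 2R` the size
of `log |w|` is absorbed by the positive logarithm, whose sum over the roots Jensen's formula
controls; only `log |z - w|` is left to integrate. -/
lemma abs_log_norm_sub_sub_log_le {R : ℝ} (hR : 0 < R) {z w : ℂ} (hz : ‖z‖ ≤ R) (hw : w ≠ 0)
    (hzw : z ≠ w) :
    |Real.log ‖z - w‖ - Real.log ‖w‖| ≤ Real.posLog (2 * R * ‖w‖⁻¹) +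
      (Real.log 2 + |Real.log (2 * R)|) + if ‖w‖ ≤ 2 * R then |Real.log ‖z - w‖| else 0 := by
  have hw0 : 0 < ‖w‖ := norm_pos_iff.2 hw
  have hzw0 : 0 < ‖z - w‖ := norm_pos_iff.2 (sub_ne_zero.2 hzw)
  have hlog2 : 0 < Real.log 2 := Real.log_pos (by norm_num)
  have hpos : 0 ≤ Real.posLog (2 * R * ‖w‖⁻¹) := Real.posLog_nonneg
  split_ifs with h
  · have h1 : Real.log (2 * R) - Real.log ‖w‖ ≤ Real.posLog (2 * R * ‖w‖⁻¹) := by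
      rw [← Real.log_div (by positivity) hw0.ne', div_eq_mul_inv]
      exact le_max_right _ _
    have h2 : Real.log ‖w‖ ≤ Real.log (2 * R) := Real.log_le_log hw0 h
    rw [abs_le]
    have h3 := neg_abs_le (Real.log ‖z - w‖)
    have h4 := le_abs_self (Real.log ‖z - w‖)
    have h5 := neg_abs_le (Real.log (2 * R))
    have h6 := le_abs_self (Real.log (2 * R))
    constructor <;> linarith
  · push Not at h
    have h1 : ‖z - w‖ ≤ 2 * ‖w‖ := by
      have := norm_sub_le z w; linarith
    have h2 : ‖w‖ ≤ 2 * ‖z - w‖ := by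
      have : ‖w‖ ≤ ‖z‖ + ‖z - w‖ := by
        have := norm_sub_le z (z - w); rwa [sub_sub_cancel] at this
      linarith
    have h3 := Real.log_le_log hzw0 h1
    have h4 := Real.log_le_log hw0 h2
    rw [Real.log_mul (by norm_num) hw0.ne'] at h3
    rw [Real.log_mul (by norm_num) hzw0.ne'] at h4
    have h5 := abs_nonneg (Real.log (2 * R))
    rw [abs_le]; constructor <;> linarith

lemma integrableOn_log_norm_eval_sq (q : Polynomial ℂ) (hq : q ≠ 0) (c R : ℝ) :
    IntegrableOn (fun z => (c * Real.log ‖q.eval z‖) ^ 2) (closedBall 0 R) := by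
  obtain ⟨d, w, hw⟩ := exists_rootList hq
  have hf : IsFiniteMeasure (volume.restrict (closedBall (0 : ℂ) R)) :=
    ⟨by rw [Measure.restrict_apply_univ]; exact measure_closedBall_lt_top⟩
  have hdom : IntegrableOn (fun z => c ^ 2 * (2 * (Real.log ‖q.leadingCoeff‖) ^ 2 +
      2 * (d * ∑ i, (Real.log ‖z - w i‖) ^ 2))) (closedBall 0 R) :=
    ((integrable_const _).add (((integrable_finsetSum _ fun i _ =>
      integrableOn_log_norm_sub_sq R (w i)).const_mul _).const_mul _)).const_mul _
  refine Integrable.mono' hdom (Measurable.aestronglyMeasurable ?_) ?_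
  · have : Measurable fun z => q.eval z := q.continuous.measurable
    fun_prop
  · refine ae_restrict_of_ae ?_
    filter_upwards [ae_notMem_range w] with z hz
    rw [Real.norm_eq_abs, abs_of_nonneg (sq_nonneg _),
      hw.log_norm_eval fun i hi => hz ⟨i, hi.symm⟩, mul_pow]
    refine mul_le_mul_of_nonneg_left ?_ (sq_nonneg _)
    have h1 := sq_sum_le_card_mul_sum_sq (s := Finset.univ) (f := fun i => Real.log ‖z - w i‖)
    rw [Finset.card_univ, Fintype.card_fin] at h1
    nlinarith [sq_nonneg (Real.log ‖q.leadingCoeff‖ - ∑ i, Real.log ‖z - w i‖)]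

/-- A uniform `L²` bound on a disk for the normalized logarithm of the modulus of a polynomial. -/
lemma exists_integral_log_norm_eval_sq_le {R C : ℝ} (hR : 0 < R) (hC : 0 ≤ C) :
    ∃ K, ∀ n : ℕ, 0 < n → ∀ q : Polynomial ℂ, q.natDegree ≤ n →
      Real.exp (-(n * C)) ≤ ‖q.eval 0‖ → (∀ z, ‖z‖ = 2 * R → ‖q.eval z‖ ≤ Real.exp (n * C)) →
      ∫ z in closedBall 0 R, ((n : ℝ)⁻¹ * Real.log ‖q.eval z‖) ^ 2 ≤ K := by
  -- `C` bounds the normalized `|log |q(0)||`, `2C` the normalized Jensen sum, and the rest is the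
  -- constant contributed by each root.
  set K₁ := 3 * C + (Real.log 2 + |Real.log (2 * R)|) with hK₁
  refine ⟨(2 * K₁ ^ 2) * volume.real (closedBall (0 : ℂ) R) + 2 * logSqIntegral (R + 2 * R),
    fun n hn q hdeg h0 hup => ?_⟩
  have hn' : (0 : ℝ) < n := by exact_mod_cast hn
  have hq0 : q.eval 0 ≠ 0 := norm_pos_iff.1 ((Real.exp_pos _).trans_le h0)
  have hq : q ≠ 0 := by rintro rfl; simp at hq0
  obtain ⟨d, w, hw⟩ := exists_rootList hq
  have hd : (d : ℝ) ≤ n := by exact_mod_cast hw.card_le.trans hdeg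
  have hw0 : ∀ i, w i ≠ 0 := fun i hi => hq0 (by
    have := hw.mem_roots i; rwa [hi] at this)
  have hc1 : -(n * C) ≤ Real.log ‖q.eval 0‖ :=
    (Real.le_log_iff_exp_le (norm_pos_iff.2 hq0)).2 h0
  have hnC : 0 ≤ n * C := by positivity
  have havg : circleAverage (fun z => Real.log ‖q.eval z‖) 0 (2 * R) ≤ n * C := by
    refine Real.circleAverage_mono_on_of_le_circle ?_ fun z hz => ?_
    · exact MeromorphicOn.circleIntegrable_log_norm fun z _ =>
        (Polynomial.differentiable q).analyticAt z |>.meromorphicAt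
    · rw [abs_of_pos (by positivity), mem_sphere_zero_iff_norm] at hz
      rcases eq_or_ne (q.eval z) 0 with h | h
      · simpa [h] using hnC
      · exact (Real.log_le_iff_le_exp (norm_pos_iff.2 h)).2 (hup z hz)
  -- Jensen at radius `2R` now yields both `log |q(0)| ≤ nC` and `S ≤ 2nC`.
  rw [hw.circleAverage_log_norm_eval hq0 (by positivity)] at havg
  set S := ∑ i, Real.posLog (2 * R * ‖w i‖⁻¹) with hS
  have hS0 : 0 ≤ S := Finset.sum_nonneg fun i _ => Real.posLog_nonneg
  set near : Finset (Fin d) := Finset.univ.filter fun i => ‖w i‖ ≤ 2 * R with hnear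
  have hpt : ∀ z : ℂ, ‖z‖ ≤ R → z ∉ range w → ((n : ℝ)⁻¹ * Real.log ‖q.eval z‖) ^ 2 ≤
      2 * K₁ ^ 2 + 2 * ((n : ℝ)⁻¹ * ∑ i ∈ near, (Real.log ‖z - w i‖) ^ 2) := by
    intro z hz hzw
    have hz' : ∀ i, z ≠ w i := fun i hi => hzw ⟨i, hi.symm⟩
    set T := ∑ i ∈ near, |Real.log ‖z - w i‖| with hT
    have hT0 : 0 ≤ T := Finset.sum_nonneg fun i _ => abs_nonneg _
    have h1 : |Real.log ‖q.eval z‖| ≤ n * K₁ + T := by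
      rw [hw.log_norm_eval_eq_add hq0 hz']
      have h2 : |∑ i, (Real.log ‖z - w i‖ - Real.log ‖w i‖)| ≤
          S + d * (Real.log 2 + |Real.log (2 * R)|) + T := by
        refine (Finset.abs_sum_le_sum_abs _ _).trans ?_
        refine (Finset.sum_le_sum fun i _ =>
          abs_log_norm_sub_sub_log_le hR hz (hw0 i) (hz' i)).trans (le_of_eq ?_)
        rw [Finset.sum_add_distrib, Finset.sum_add_distrib, Finset.sum_const, Finset.card_univ,
          Fintype.card_fin, nsmul_eq_mul, hT, hnear, Finset.sum_filter]
      have h3 : d * (Real.log 2 + |Real.log (2 * R)|) ≤ n * (Real.log 2 + |Real.log (2 * R)|) :=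
        mul_le_mul_of_nonneg_right hd (by have := Real.log_pos (one_lt_two); positivity)
      have h4 : |Real.log ‖q.eval 0‖| ≤ n * C := abs_le.2 ⟨hc1, by linarith⟩
      refine (abs_add_le _ _).trans ?_
      have : n * K₁ = n * C + 2 * (n * C) + n * (Real.log 2 + |Real.log (2 * R)|) := by
        rw [hK₁]; ring
      linarith
    have h5 : |(n : ℝ)⁻¹ * Real.log ‖q.eval z‖| ≤ K₁ + (n : ℝ)⁻¹ * T := by
      rw [abs_mul, abs_of_pos (inv_pos.2 hn'), inv_mul_le_iff₀ hn', mul_add,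
        mul_inv_cancel_left₀ hn'.ne']
      exact h1
    -- Cauchy–Schwarz; the factor `n` is compensated by the normalization, so that the bound stays
    -- uniform in `n`.
    have h6 : T ^ 2 ≤ n * ∑ i ∈ near, (Real.log ‖z - w i‖) ^ 2 := by
      refine (sq_sum_le_card_mul_sum_sq).trans ?_
      simp only [sq_abs]
      refine mul_le_mul_of_nonneg_right ?_ (Finset.sum_nonneg fun i _ => sq_nonneg _)
      refine le_trans ?_ hd
      have := Finset.card_le_univ near
      rw [Fintype.card_fin] at this
      exact_mod_cast this
    have h7 : ((n : ℝ)⁻¹ * T) ^ 2 ≤ (n : ℝ)⁻¹ * ∑ i ∈ near, (Real.log ‖z - w i‖) ^ 2 := by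
      rw [mul_pow, sq, mul_assoc]
      refine mul_le_mul_of_nonneg_left ?_ (inv_nonneg.2 hn'.le)
      rw [inv_mul_le_iff₀ hn']; exact h6
    calc ((n : ℝ)⁻¹ * Real.log ‖q.eval z‖) ^ 2 = |(n : ℝ)⁻¹ * Real.log ‖q.eval z‖| ^ 2 :=
          (sq_abs _).symm
      _ ≤ (K₁ + (n : ℝ)⁻¹ * T) ^ 2 := pow_le_pow_left₀ (abs_nonneg _) h5 2
      _ ≤ 2 * K₁ ^ 2 + 2 * ((n : ℝ)⁻¹ * T) ^ 2 := by nlinarith [sq_nonneg (K₁ - (n : ℝ)⁻¹ * T)]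
      _ ≤ _ := by linarith
  have hf : IsFiniteMeasure (volume.restrict (closedBall (0 : ℂ) R)) :=
    ⟨by rw [Measure.restrict_apply_univ]; exact measure_closedBall_lt_top⟩
  have hi1 : ∀ i ∈ near, IntegrableOn (fun z => (Real.log ‖z - w i‖) ^ 2) (closedBall 0 R) :=
    fun i _ => integrableOn_log_norm_sub_sq R (w i)
  have hi2 : IntegrableOn (fun z => 2 * ((n : ℝ)⁻¹ * ∑ i ∈ near, (Real.log ‖z - w i‖) ^ 2))
      (closedBall 0 R) := ((integrable_finsetSum _ hi1).const_mul _).const_mul _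
  calc ∫ z in closedBall 0 R, ((n : ℝ)⁻¹ * Real.log ‖q.eval z‖) ^ 2
      ≤ ∫ z in closedBall 0 R,
          (2 * K₁ ^ 2 + 2 * ((n : ℝ)⁻¹ * ∑ i ∈ near, (Real.log ‖z - w i‖) ^ 2)) := by
        refine integral_mono_ae (integrableOn_log_norm_eval_sq q hq _ R)
          ((integrable_const _).add hi2) ?_
        filter_upwards [ae_restrict_of_ae (ae_notMem_range w), ae_restrict_mem
            measurableSet_closedBall]
          with z hz hzR
        exact hpt z (by simpa using hzR) hz
    _ = 2 * K₁ ^ 2 * volume.real (closedBall (0 : ℂ) R) +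
          2 * ((n : ℝ)⁻¹ * ∑ i ∈ near, ∫ z in closedBall 0 R, (Real.log ‖z - w i‖) ^ 2) := by
        rw [integral_add (integrable_const _) hi2, integral_const_mul, integral_const_mul,
          integral_const_mul, integral_finsetSum _ hi1]
        simp [mul_comm, mul_assoc]
    _ ≤ _ := by
        gcongr
        rw [inv_mul_le_iff₀ hn']
        have hL0 : 0 ≤ logSqIntegral (R + 2 * R) := integral_nonneg fun _ => sq_nonneg _
        calc ∑ i ∈ near, ∫ z in closedBall 0 R, (Real.log ‖z - w i‖) ^ 2
            ≤ ∑ i ∈ near, logSqIntegral (R + 2 * R) := Finset.sum_le_sum fun i hi =>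
              integral_log_norm_sub_sq_le (Finset.mem_filter.1 hi).2
          _ ≤ n * logSqIntegral (R + 2 * R) := by
              rw [Finset.sum_const, nsmul_eq_mul]
              refine mul_le_mul_of_nonneg_right (le_trans ?_ hd) hL0
              have := Finset.card_le_univ near
              rw [Fintype.card_fin] at this
              exact_mod_cast this

/-! ### Zero measures -/

lemma zeroMeasure_eq_sum {q : Polynomial ℂ} {d : ℕ} {w : Fin d → ℂ} (h : RootList q d w) :
    zeroMeasure q = ∑ i, Measure.dirac (w i) := by
  rw [zeroMeasure, h.roots_eq, Multiset.map_map]; rfl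

lemma integral_zeroMeasure {q : Polynomial ℂ} {d : ℕ} {w : Fin d → ℂ} (h : RootList q d w)
    {φ : ℂ → ℝ} : ∫ z, φ z ∂(zeroMeasure q) = ∑ i, φ (w i) := by
  rw [zeroMeasure_eq_sum h, integral_finsetSum_measure fun i _ => integrable_dirac (by simp)]
  simp

lemma zeroMeasure_C_mul {c : ℂ} (hc : c ≠ 0) (q : Polynomial ℂ) :
    zeroMeasure (Polynomial.C c * q) = zeroMeasure q := by
  rw [zeroMeasure, Polynomial.roots_C_mul q hc, zeroMeasure]

lemma integrableOn_log_norm_eval (q : Polynomial ℂ) (hq : q ≠ 0) (c R : ℝ) :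
    IntegrableOn (fun z => c * Real.log ‖q.eval z‖) (closedBall 0 R) := by
  have hf : IsFiniteMeasure (volume.restrict (closedBall (0 : ℂ) R)) :=
    ⟨by rw [Measure.restrict_apply_univ]; exact measure_closedBall_lt_top⟩
  refine Integrable.mono' ((integrable_const (1 : ℝ)).add (integrableOn_log_norm_eval_sq q hq c R))
    (Measurable.aestronglyMeasurable ?_) (ae_of_all _ fun z => abs_le_one_add_sq _)
  have : Measurable fun z => q.eval z := q.continuous.measurable
  fun_prop

/-- Linear statistics of zeros, up to smoothing, are linear statistics of `log |q|`. -/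
lemma abs_integral_zeroMeasure_sub_le {φ : ℂ → ℝ} (hφ : Continuous φ) {A B ε δ : ℝ} (hε : 0 < ε)
    (hA : ∀ z, A < ‖z‖ → φ z = 0) (hB : ∀ z, |φ z| ≤ B) (hδ0 : 0 ≤ δ)
    (hδ : ∀ v w, ‖v - w‖ ≤ 2 * ε → |φ v - φ w| ≤ δ) {n : ℕ} (hn : 0 < n) {q : Polynomial ℂ}
    (hq : q ≠ 0) (hdeg : q.natDegree ≤ n) :
    |(∫ z, ((n : ℝ)⁻¹ * Real.log ‖q.eval z‖) * ringMean φ ε z) -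
      (∫ x, ringKernel ε x) * ((n : ℝ)⁻¹ * ∫ z, φ z ∂(zeroMeasure q))| ≤
      (∫ x, ringKernel ε x) * δ := by
  obtain ⟨d, w, hw⟩ := exists_rootList hq
  have hn' : (0 : ℝ) < n := by exact_mod_cast hn
  have hd : (d : ℝ) ≤ n := by exact_mod_cast hw.card_le.trans hdeg
  set κ := ∫ x, ringKernel ε x with hκ
  have hκ0 : 0 < κ := integral_ringKernel_pos hε
  have hae := ae_notMem_range w
  have hloc : ∀ i, ∀ ρ, IntegrableOn (fun z : ℂ => Real.log ‖z - w i‖) (closedBall 0 ρ) :=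
    fun i ρ => integrableOn_log_norm_sub ρ (w i)
  have hi : ∀ i, Integrable fun z => Real.log ‖z - w i‖ * ringMean φ ε z := fun i =>
    integrable_mul_ringMean (hloc i) hφ hε hA hB
  have hi0 : Integrable (ringMean φ ε) := by
    simpa using integrable_mul_ringMean (h := fun _ => 1)
      (fun ρ => integrableOn_const measure_closedBall_lt_top.ne) hφ hε hA hB
  -- The leading coefficient drops out because the ring mean has integral zero.
  have h1 : ∫ z, ((n : ℝ)⁻¹ * Real.log ‖q.eval z‖) * ringMean φ ε z =
      (n : ℝ)⁻¹ * ∑ i, ∫ v, φ v * ringKernel ε (v - w i) := by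
    calc _ = ∫ z, (n : ℝ)⁻¹ * (Real.log ‖q.leadingCoeff‖ * ringMean φ ε z +
            ∑ i, Real.log ‖z - w i‖ * ringMean φ ε z) := by
          refine integral_congr_ae ?_
          filter_upwards [hae] with z hz
          rw [hw.log_norm_eval fun i hi => hz ⟨i, hi.symm⟩, ← Finset.sum_mul]; ring
      _ = _ := by
          rw [integral_const_mul, integral_add (hi0.const_mul _)
            (integrable_finsetSum _ fun i _ => hi i), integral_const_mul,
            integral_ringMean hφ hε hA hB, integral_finsetSum _ fun i _ => hi i, mul_zero, zero_add]
          simp_rw [integral_log_mul_ringMean hφ hε hA hB]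
  rw [h1, integral_zeroMeasure hw, Finset.mul_sum, Finset.mul_sum, Finset.mul_sum,
    ← Finset.sum_sub_distrib]
  refine (Finset.abs_sum_le_sum_abs _ _).trans ?_
  calc _ ≤ ∑ i : Fin d, (n : ℝ)⁻¹ * (κ * δ) := by
        refine Finset.sum_le_sum fun i _ => ?_
        have := abs_integral_mul_ringKernel_sub_le hφ hε hδ (w i)
        rw [show (n : ℝ)⁻¹ * (∫ v, φ v * ringKernel ε (v - w i)) - κ * ((n : ℝ)⁻¹ * φ (w i)) =
          (n : ℝ)⁻¹ * ((∫ v, φ v * ringKernel ε (v - w i)) - κ * φ (w i)) by ring, abs_mul,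
          abs_of_pos (inv_pos.2 hn')]
        exact mul_le_mul_of_nonneg_left this (inv_nonneg.2 hn'.le)
    _ = (d * (n : ℝ)⁻¹) * (κ * δ) := by
        rw [Finset.sum_const, Finset.card_univ, Fintype.card_fin, nsmul_eq_mul]; ring
    _ ≤ 1 * (κ * δ) := by
        refine mul_le_mul_of_nonneg_right ?_ (by positivity)
        rw [← div_eq_mul_inv, div_le_one hn']; exact hd
    _ = κ * δ := one_mul _

end RandomZeros

namespace RandomZeros

open Metric
open Real (circleAverage)

/-! ### From pointwise convergence of potentials to convergence of zeros -/

section Convergence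

variable {Ω : Type*} [MeasurableSpace Ω] {P : Measure Ω}

/-- Truncation turns convergence in probability into convergence of expectations, which can then be
integrated over `z`. -/
lemma tendsto_integral_min_of_tendstoInMeasure [IsProbabilityMeasure P] {X : ℕ → Ω → ℝ}
    (hX : ∀ n, Measurable (X n)) {c : ℝ}
    (h : TendstoInMeasure P X atTop (fun _ => c)) {M : ℝ} (hM : 0 < M) :
    Tendsto (fun n => ∫ ω, min |X n ω - c| M ∂P) atTop (𝓝 0) := by
  rw [tendstoInMeasure_iff_measureReal_dist] at h
  have hnn : ∀ n ω, 0 ≤ min |X n ω - c| M := fun n ω => le_min (abs_nonneg _) hM.le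
  refine tendsto_order.2 ⟨fun x hx => Eventually.of_forall fun n =>
    hx.trans_le (integral_nonneg (hnn n)), fun η hη => ?_⟩
  have h1 := (h (η / 2) (half_pos hη)).eventually (gt_mem_nhds (show (0 : ℝ) < η / (2 * M) by
    positivity))
  filter_upwards [h1] with n hn
  set E := {ω | η / 2 ≤ dist (X n ω) c} with hE
  have hEm : MeasurableSet E := measurableSet_le measurable_const ((hX n).dist measurable_const)
  have h2 : ∫ ω, min |X n ω - c| M ∂P ≤ ∫ ω, (η / 2 + E.indicator (fun _ => M) ω) ∂P := by
    refine integral_mono_of_nonneg (ae_of_all _ (hnn n))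
      ((integrable_const _).add ((integrable_const _).indicator hEm)) (ae_of_all _ fun ω => ?_)
    simp only
    by_cases hω : ω ∈ E
    · rw [indicator_of_mem hω]
      linarith [min_le_right |X n ω - c| M]
    · rw [indicator_of_notMem hω, add_zero]
      simp only [hE, mem_ofPred_eq, not_le, Real.dist_eq] at hω
      exact (min_le_left _ _).trans hω.le
  refine h2.trans_lt ?_
  rw [integral_add (integrable_const _) ((integrable_const _).indicator hEm),
    integral_indicator_const _ hEm]
  simp only [integral_const, probReal_univ, smul_eq_mul]
  rw [lt_div_iff₀ (by positivity)] at hn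
  linarith

lemma tendstoInMeasure_mul_of_tendsto [IsProbabilityMeasure P] {X : ℕ → Ω → ℝ} {x s : ℝ} {c : ℕ → ℝ}
    (h : TendstoInMeasure P X atTop (fun _ => x)) (hc : Tendsto c atTop (𝓝 s)) :
    TendstoInMeasure P (fun n ω => c n * X n ω) atTop (fun _ => s * x) := by
  rw [tendstoInMeasure_iff_measureReal_dist] at h ⊢
  intro η hη
  have hS : 0 < |s| + 1 := by positivity
  refine squeeze_zero' (Eventually.of_forall fun n => measureReal_nonneg) ?_
    (h (η / (2 * (|s| + 1))) (by positivity))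
  have h1 : ∀ᶠ n in atTop, |c n| < |s| + 1 := hc.abs.eventually (gt_mem_nhds (by linarith))
  have h2 : Tendsto (fun n => |c n - s| * |x|) atTop (𝓝 0) := by
    have : Tendsto (fun n => c n - s) atTop (𝓝 0) := by simpa using hc.sub_const s
    simpa using (this.abs).mul_const |x|
  filter_upwards [h1, h2.eventually (gt_mem_nhds (half_pos hη))] with n hn1 hn2
  refine measureReal_mono fun ω hω => ?_
  simp only [mem_ofPred_eq, Real.dist_eq] at hω ⊢
  rw [div_le_iff₀ (by positivity)]
  have h3 : |c n * X n ω - s * x| ≤ |c n| * |X n ω - x| + |c n - s| * |x| := by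
    rw [← abs_mul, ← abs_mul]
    refine le_trans (le_of_eq ?_) (abs_add_le _ _)
    congr 1; ring
  have h4 : |c n| * |X n ω - x| ≤ (|s| + 1) * |X n ω - x| :=
    mul_le_mul_of_nonneg_right hn1.le (abs_nonneg _)
  linarith

/-- `U` is, up to constants, the logarithmic potential of `μ`: a smoothed form. -/
def IsPotential (U : ℂ → ℝ) (μ : Measure ℂ) : Prop :=
  ∀ (φ : ℂ → ℝ) (A B ε δ : ℝ), Continuous φ → 0 < ε → 0 ≤ δ → (∀ z, A < ‖z‖ → φ z = 0) →
    (∀ z, |φ z| ≤ B) → (∀ v w, ‖v - w‖ ≤ 2 * ε → |φ v - φ w| ≤ δ) →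
    |(∫ z, U z * ringMean φ ε z) - (∫ x, ringKernel ε x) * ∫ z, φ z ∂μ| ≤
      (∫ x, ringKernel ε x) * δ

/-- Random polynomials of degree at most `n` whose normalized log-moduli converge in probability
to `U`, with matching a priori bounds. -/
structure LogConvergence (P : Measure Ω) (q : ℕ → Ω → Polynomial ℂ) (U : ℂ → ℝ) : Prop where
  measurable_eval : ∀ n, Measurable fun x : Ω × ℂ => (q n x.1).eval x.2
  natDegree_le : ∀ n ω, (q n ω).natDegree ≤ n
  tendsto : ∀ z ≠ 0, TendstoInMeasure P
    (fun (n : ℕ) ω => (n : ℝ)⁻¹ * Real.log ‖(q n ω).eval z‖) atTop (fun _ => U z)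
  upper : ∀ R : ℝ, ∃ C : ℝ, Tendsto (fun n : ℕ => P.real {ω | ∃ z, ‖z‖ ≤ R ∧
    Real.exp (n * C) < ‖(q n ω).eval z‖}) atTop (𝓝 0)
  lower : ∃ C : ℝ, Tendsto (fun n : ℕ => P.real {ω | ‖(q n ω).eval 0‖ < Real.exp (-(n * C))})
    atTop (𝓝 0)
  measurable_limit : Measurable U
  bounded_limit : ∀ R : ℝ, ∃ C : ℝ, ∀ z, ‖z‖ ≤ R → |U z| ≤ C

namespace LogConvergence

variable {q : ℕ → Ω → Polynomial ℂ} {U : ℂ → ℝ}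

lemma integrableOn_limit (h : LogConvergence P q U) (R : ℝ) : IntegrableOn U (closedBall 0 R) := by
  obtain ⟨C, hC⟩ := h.bounded_limit R
  exact IntegrableOn.of_bound measure_closedBall_lt_top h.measurable_limit.aestronglyMeasurable C
    ((ae_restrict_mem measurableSet_closedBall).mono fun z hz => hC z (by simpa using hz))

lemma measurable_log (h : LogConvergence P q U) (n : ℕ) :
    Measurable fun x : Ω × ℂ => (n : ℝ)⁻¹ * Real.log ‖(q n x.1).eval x.2‖ := by
  have := h.measurable_eval n
  fun_prop

/-- Fubini, then dominated convergence in `z`; the exceptional point `z = 0` is a null set. -/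
lemma tendsto_integral_min [IsProbabilityMeasure P] (h : LogConvergence P q U) (R : ℝ) {M : ℝ}
    (hM : 0 < M) :
    Tendsto (fun n : ℕ => ∫ ω, (∫ z in closedBall 0 R,
      min |(n : ℝ)⁻¹ * Real.log ‖(q n ω).eval z‖ - U z| M) ∂P) atTop (𝓝 0) := by
  have hf : IsFiniteMeasure (volume.restrict (closedBall (0 : ℂ) R)) :=
    ⟨by rw [Measure.restrict_apply_univ]; exact measure_closedBall_lt_top⟩
  have hmeas : ∀ n : ℕ, Measurable fun x : Ω × ℂ =>
      min |(n : ℝ)⁻¹ * Real.log ‖(q n x.1).eval x.2‖ - U x.2| M := fun n =>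
    (continuous_abs.measurable.comp ((h.measurable_log n).sub
      (h.measurable_limit.comp measurable_snd))).min measurable_const
  have hbd : ∀ t : ℝ, ‖min |t| M‖ ≤ M := fun t => by
    rw [Real.norm_eq_abs, abs_of_nonneg (le_min (abs_nonneg _) hM.le)]
    exact min_le_right _ _
  have hswap : ∀ n : ℕ, ∫ ω, (∫ z in closedBall 0 R,
      min |(n : ℝ)⁻¹ * Real.log ‖(q n ω).eval z‖ - U z| M) ∂P =
      ∫ z in closedBall 0 R, ∫ ω,
        min |(n : ℝ)⁻¹ * Real.log ‖(q n ω).eval z‖ - U z| M ∂P := fun n =>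
    integral_integral_swap (Integrable.of_bound (hmeas n).aestronglyMeasurable M
      (ae_of_all _ fun x => hbd _))
  simp_rw [hswap]
  have := tendsto_integral_of_dominated_convergence
    (μ := volume.restrict (closedBall (0 : ℂ) R))
    (F := fun (n : ℕ) z => ∫ ω, min |(n : ℝ)⁻¹ * Real.log ‖(q n ω).eval z‖ - U z| M ∂P)
    (f := fun _ => 0) (fun _ => M) (fun n => ?_) (integrable_const _) (fun n => ?_) ?_
  · simpa using this
  · have := (hmeas n).stronglyMeasurable.integral_prod_left' (μ := P)
    exact this.aestronglyMeasurable
  · refine ae_of_all _ fun z => ?_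
    have := norm_integral_le_of_norm_le_const (μ := P)
      (f := fun ω => min |(n : ℝ)⁻¹ * Real.log ‖(q n ω).eval z‖ - U z| M) (C := M)
      (ae_of_all _ fun ω => hbd _)
    simpa using this
  · have h0 : ∀ᵐ z : ℂ, z ≠ 0 := (measure_eq_zero_iff_ae_notMem (s := {0})).1 (by simp)
    filter_upwards [ae_restrict_of_ae h0] with z hz
    refine tendsto_integral_min_of_tendstoInMeasure (fun n => ?_) (h.tendsto z hz) hM
    exact (h.measurable_log n).comp measurable_prodMk_right

/-- What the truncation at `M` cuts off is controlled by the `L²` bound and is small for large `M`.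
-/
lemma abs_le_min_add_sq_div {M : ℝ} (hM : 0 < M) (x : ℝ) : |x| ≤ min |x| M + x ^ 2 / M := by
  rcases le_total |x| M with h | h
  · rw [min_eq_left h]
    have : 0 ≤ x ^ 2 / M := by positivity
    linarith
  · rw [min_eq_right h]
    have : |x| ≤ x ^ 2 / M := by
      rw [le_div_iff₀ hM, ← sq_abs, sq]
      exact mul_le_mul_of_nonneg_left h (abs_nonneg _)
    linarith

/-- Convergence in `L¹` on disks, in probability. -/
lemma tendsto_measure_integral_abs [IsProbabilityMeasure P] (h : LogConvergence P q U) {R : ℝ}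
    (hR : 0 < R) {ε : ℝ}
    (hε : 0 < ε) :
    Tendsto (fun n : ℕ => P.real {ω | ε ≤ ∫ z in closedBall 0 R,
      |(n : ℝ)⁻¹ * Real.log ‖(q n ω).eval z‖ - U z|}) atTop (𝓝 0) := by
  have hf : IsFiniteMeasure (volume.restrict (closedBall (0 : ℂ) R)) :=
    ⟨by rw [Measure.restrict_apply_univ]; exact measure_closedBall_lt_top⟩
  obtain ⟨C₁, hC₁⟩ := h.upper (2 * R)
  obtain ⟨C₂, hC₂⟩ := h.lower
  obtain ⟨C₃, hC₃⟩ := h.bounded_limit R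
  set C := max 0 (max C₁ C₂) with hC
  obtain ⟨K, hK⟩ := exists_integral_log_norm_eval_sq_le hR (le_max_left 0 (max C₁ C₂))
  set K' := |2 * K + 2 * (C₃ ^ 2 * volume.real (closedBall (0 : ℂ) R))| with hK'
  have hK'0 : 0 ≤ K' := abs_nonneg _
  -- Chosen to make the truncation error `K' / M` at most `ε / 2`, where `K'` will bound the
  -- integral of the squared difference.
  set M := 2 * K' / ε + 1 with hM
  have hM0 : 0 < M := by positivity
  have hKM : K' / M ≤ ε / 2 := by
    rw [div_le_iff₀ hM0, hM]
    have : ε / 2 * (2 * K' / ε + 1) = K' + ε / 2 := by field_simp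
    linarith
  have hmin := (h.tendsto_integral_min R hM0).const_mul (ε / 2)⁻¹
  have hsum := (hC₁.add hC₂).add hmin
  simp only [mul_zero, add_zero] at hsum
  refine squeeze_zero' (Eventually.of_forall fun n => measureReal_nonneg) ?_ hsum
  filter_upwards [eventually_gt_atTop 0] with n hn
  have hn' : (0 : ℝ) < n := by exact_mod_cast hn
  set G : Ω → ℝ := fun ω => ∫ z in closedBall 0 R,
      min |(n : ℝ)⁻¹ * Real.log ‖(q n ω).eval z‖ - U z| M with hG
  have hmeas : Measurable fun x : Ω × ℂ =>
      min |(n : ℝ)⁻¹ * Real.log ‖(q n x.1).eval x.2‖ - U x.2| M :=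
    (continuous_abs.measurable.comp ((h.measurable_log n).sub
      (h.measurable_limit.comp measurable_snd))).min measurable_const
  have hbd : ∀ t : ℝ, ‖min |t| M‖ ≤ M := fun t => by
    rw [Real.norm_eq_abs, abs_of_nonneg (le_min (abs_nonneg _) hM0.le)]
    exact min_le_right _ _
  have hGm : StronglyMeasurable G := hmeas.stronglyMeasurable.integral_prod_right'
  have hG0 : ∀ ω, 0 ≤ G ω := fun ω => integral_nonneg fun z => le_min (abs_nonneg _) hM0.le
  have hGi : Integrable G P := by
    refine Integrable.of_bound hGm.aestronglyMeasurable
      (M * (volume.restrict (closedBall (0 : ℂ) R)).real univ) (ae_of_all _ fun ω => ?_)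
    exact norm_integral_le_of_norm_le_const (ae_of_all _ fun z => hbd _)
  have hmarkov : P.real {ω | ε / 2 ≤ G ω} ≤ (ε / 2)⁻¹ * ∫ ω, G ω ∂P := by
    rw [inv_mul_eq_div, le_div_iff₀ (by positivity), mul_comm]
    exact mul_meas_ge_le_integral_of_nonneg (ae_of_all _ hG0) hGi _
  refine le_trans ?_ (add_le_add le_rfl hmarkov)
  refine le_trans ?_ (add_le_add (measureReal_union_le _ _) le_rfl)
  refine le_trans (measureReal_mono ?_) (measureReal_union_le _ _)
  intro ω hω
  simp only [mem_ofPred_eq, mem_union] at hω ⊢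
  -- Outside three unlikely events (too large on the disk of radius `2R`, too small at `0`, large
  -- truncated distance) the deterministic `L²` bound applies.
  by_contra hcon
  push Not at hcon
  obtain ⟨⟨hup, hlow⟩, hGlt⟩ := hcon
  have hCC₁ : C₁ ≤ C := (le_max_left _ _).trans (le_max_right _ _)
  have hCC₂ : C₂ ≤ C := (le_max_right _ _).trans (le_max_right _ _)
  have hlow' : Real.exp (-(n * C)) ≤ ‖(q n ω).eval 0‖ := by
    refine le_trans (Real.exp_le_exp.2 ?_) hlow
    have := mul_le_mul_of_nonneg_left hCC₂ hn'.le
    linarith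
  have hq : q n ω ≠ 0 := fun h0 => by
    rw [h0, Polynomial.eval_zero, norm_zero] at hlow'
    exact absurd hlow' (not_le.2 (Real.exp_pos _))
  have hsq := hK n hn (q n ω) (h.natDegree_le n ω) hlow' fun z hz =>
    (hup z hz.le).trans (Real.exp_le_exp.2 (mul_le_mul_of_nonneg_left hCC₁ hn'.le))
  set f : ℂ → ℝ := fun z => (n : ℝ)⁻¹ * Real.log ‖(q n ω).eval z‖ with hfdef
  have hfsq : IntegrableOn (fun z => f z ^ 2) (closedBall 0 R) :=
    integrableOn_log_norm_eval_sq _ hq _ R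
  have hfi : IntegrableOn f (closedBall 0 R) := integrableOn_log_norm_eval _ hq _ R
  have hdiff : IntegrableOn (fun z => f z - U z) (closedBall 0 R) :=
    hfi.sub (h.integrableOn_limit R)
  have hdom : IntegrableOn (fun z => 2 * f z ^ 2 + 2 * C₃ ^ 2) (closedBall 0 R) :=
    (hfsq.const_mul 2).add (integrable_const _)
  have hpt : ∀ᵐ z ∂(volume.restrict (closedBall (0 : ℂ) R)),
      (f z - U z) ^ 2 ≤ 2 * f z ^ 2 + 2 * C₃ ^ 2 := by
    filter_upwards [ae_restrict_mem measurableSet_closedBall] with z hz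
    have h1 : |U z| ≤ C₃ := hC₃ z (by simpa using hz)
    have h2 : U z ^ 2 ≤ C₃ ^ 2 := by
      rw [← sq_abs]; exact pow_le_pow_left₀ (abs_nonneg _) h1 2
    nlinarith [sq_nonneg (f z + U z)]
  have hdsq : IntegrableOn (fun z => (f z - U z) ^ 2) (closedBall 0 R) := by
    refine Integrable.mono' hdom (hdiff.aestronglyMeasurable.pow 2) ?_
    filter_upwards [hpt] with z hz
    rwa [Real.norm_eq_abs, abs_of_nonneg (sq_nonneg _)]
  have hdsq_le : ∫ z in closedBall 0 R, (f z - U z) ^ 2 ≤ K' := by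
    refine (integral_mono_ae hdsq hdom hpt).trans ?_
    rw [integral_add (hfsq.const_mul 2) (integrable_const _), integral_const_mul]
    refine le_trans ?_ (le_abs_self _)
    have : ∫ _ in closedBall (0 : ℂ) R, 2 * C₃ ^ 2 =
        2 * (C₃ ^ 2 * volume.real (closedBall (0 : ℂ) R)) := by
      simp; ring
    rw [this]
    linarith
  have hmini : IntegrableOn (fun z => min |f z - U z| M) (closedBall 0 R) := by
    refine Integrable.of_bound ?_ M (ae_of_all _ fun z => hbd _)
    exact (hmeas.comp measurable_prodMk_left).aestronglyMeasurable
  have hfinal : ∫ z in closedBall 0 R, |f z - U z| ≤ G ω + K' / M := by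
    calc ∫ z in closedBall 0 R, |f z - U z|
        ≤ ∫ z in closedBall 0 R, (min |f z - U z| M + (f z - U z) ^ 2 / M) :=
          integral_mono hdiff.abs (Integrable.add hmini (hdsq.div_const M)) fun z =>
            abs_le_min_add_sq_div hM0 _
      _ = G ω + (∫ z in closedBall 0 R, (f z - U z) ^ 2) / M := by
          rw [integral_add hmini (hdsq.div_const M), integral_div]
      _ ≤ _ := by gcongr
  linarith

/-- Convergence of the normalized zero counting measures. -/
theorem tendsto_zeros [IsProbabilityMeasure P] (h : LogConvergence P q U) {μ : Measure ℂ}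
    (hμ : IsPotential U μ)
    {φ : ℂ → ℝ} (hφ : Continuous φ) (hφc : HasCompactSupport φ) :
    TendstoInMeasure P (fun (n : ℕ) ω => (n : ℝ)⁻¹ * ∫ z, φ z ∂(zeroMeasure (q n ω)))
      atTop (fun _ => ∫ z, φ z ∂μ) := by
  obtain ⟨A, hA0, hA⟩ : ∃ A : ℝ, 0 < A ∧ ∀ z, A < ‖z‖ → φ z = 0 := by
    obtain ⟨A, hA⟩ := hφc.isCompact.isBounded.subset_closedBall (0 : ℂ)
    refine ⟨max A 1, by positivity, fun z hz => ?_⟩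
    by_contra h0
    have := hA (subset_tsupport _ h0)
    simp only [mem_closedBall, dist_zero_right] at this
    exact absurd ((le_max_left A 1).trans_lt hz) (not_lt.2 this)
  obtain ⟨B, hB⟩ : ∃ B : ℝ, ∀ z, |φ z| ≤ B := by
    obtain ⟨B, hB⟩ := hφ.bounded_above_of_compact_support hφc
    exact ⟨B, hB⟩
  have hB0 : 0 ≤ B := (abs_nonneg _).trans (hB 0)
  rw [tendstoInMeasure_iff_measureReal_dist]
  intro η hη
  have huc := hφc.uniformContinuous_of_continuous hφ
  obtain ⟨ε', hε', hmod⟩ := Metric.uniformContinuous_iff.1 huc (η / 4) (by positivity)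
  set ε := ε' / 4 with hεdef
  have hε : 0 < ε := by positivity
  have hδ : ∀ v w, ‖v - w‖ ≤ 2 * ε → |φ v - φ w| ≤ η / 4 := fun v w hvw => by
    have := hmod (a := v) (b := w) (by rw [dist_eq_norm]; linarith)
    rw [Real.dist_eq] at this
    exact this.le
  set κ := ∫ x, ringKernel ε x with hκ
  have hκ0 : 0 < κ := integral_ringKernel_pos hε
  obtain ⟨C₂, hC₂⟩ := h.lower
  -- The ring mean vanishes outside this disk and is bounded by `2B`, so this threshold costs at
  -- most `κ η / 4`.
  have hL1 := h.tendsto_measure_integral_abs (R := A + 2 * ε) (by positivity)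
    (ε := κ * η / (4 * (2 * B + 1))) (by positivity)
  have hsum := hC₂.add hL1
  rw [add_zero] at hsum
  refine squeeze_zero' (Eventually.of_forall fun n => measureReal_nonneg) ?_ hsum
  filter_upwards [eventually_gt_atTop 0] with n hn
  refine le_trans (measureReal_mono ?_) (measureReal_union_le _ _)
  intro ω hω
  simp only [mem_ofPred_eq, mem_union] at hω ⊢
  by_contra hcon
  push Not at hcon
  obtain ⟨hlow, hint⟩ := hcon
  have hq : q n ω ≠ 0 := fun h0 => by
    rw [h0, Polynomial.eval_zero, norm_zero] at hlow
    exact absurd hlow (not_le.2 (Real.exp_pos _))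
  have h1 := abs_integral_zeroMeasure_sub_le hφ hε hA hB (by positivity) hδ hn hq
    (h.natDegree_le n ω)
  have h2 := hμ φ A B ε (η / 4) hφ hε (by positivity) hA hB hδ
  rw [← hκ] at h1 h2
  set f : ℂ → ℝ := fun z => (n : ℝ)⁻¹ * Real.log ‖(q n ω).eval z‖ with hfdef
  have hfloc : ∀ ρ, IntegrableOn f (closedBall 0 ρ) := fun ρ => integrableOn_log_norm_eval _ hq _ ρ
  have h3 : |(∫ z, f z * ringMean φ ε z) - ∫ z, U z * ringMean φ ε z| ≤ κ * (η / 4) := by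
    have hdi : IntegrableOn (fun z => f z - U z) (closedBall 0 (A + 2 * ε)) :=
      (hfloc _).sub (h.integrableOn_limit _)
    rw [← integral_sub (integrable_mul_ringMean hfloc hφ hε hA hB)
      (integrable_mul_ringMean h.integrableOn_limit hφ hε hA hB)]
    have h4 : ∫ z, (f z * ringMean φ ε z - U z * ringMean φ ε z) =
        ∫ z in closedBall 0 (A + 2 * ε), (f z * ringMean φ ε z - U z * ringMean φ ε z) := by
      refine (setIntegral_eq_integral_of_forall_compl_eq_zero fun z hz => ?_).symm
      simp only [mem_closedBall, dist_zero_right, not_le] at hz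
      simp [ringMean_eq_zero hε hA hz]
    rw [h4]
    calc _ ≤ ∫ z in closedBall 0 (A + 2 * ε), |f z * ringMean φ ε z - U z * ringMean φ ε z| :=
          abs_integral_le_integral_abs
      _ ≤ ∫ z in closedBall 0 (A + 2 * ε), |f z - U z| * (2 * B + 1) := by
          refine integral_mono_of_nonneg (ae_of_all _ fun z => abs_nonneg _)
            (hdi.abs.mul_const _) (ae_of_all _ fun z => ?_)
          simp only
          rw [← sub_mul, abs_mul]
          have := abs_ringMean_le hB ε z
          exact mul_le_mul_of_nonneg_left (by linarith) (abs_nonneg _)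
      _ ≤ κ * (η / 4) := by
          rw [integral_mul_const]
          have : κ * η / (4 * (2 * B + 1)) * (2 * B + 1) = κ * (η / 4) := by field_simp
          rw [← this]
          exact mul_le_mul_of_nonneg_right hint.le (by positivity)
  set X := (n : ℝ)⁻¹ * ∫ z, φ z ∂(zeroMeasure (q n ω)) with hX
  set Y := ∫ z, φ z ∂μ with hY
  rw [Real.dist_eq] at hω
  -- Three errors of size `κ η / 4`: smoothing for the zeros, replacing the random potential by `U`,
  -- smoothing for `μ`.
  have h5 : κ * |X - Y| ≤ κ * (3 * (η / 4)) := by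
    rw [← abs_of_pos hκ0, ← abs_mul, abs_of_pos hκ0]
    have e1 := abs_le.1 h1
    have e2 := abs_le.1 h2
    have e3 := abs_le.1 h3
    rw [abs_le]
    constructor <;> nlinarith [e1.1, e1.2, e2.1, e2.2, e3.1, e3.2]
  have h6 := le_of_mul_le_mul_left h5 hκ0
  linarith

end LogConvergence

end Convergence

end RandomZeros

namespace RandomZeros

open Metric
open Real (circleAverage)

/-! ### Convex radial potentials -/

/-- Convex functions on the line with slopes in `[0,1]` which are bounded below. -/
structure RadialPotential (J : ℝ → ℝ) : Prop where
  convexOn : ConvexOn ℝ univ J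
  monotone : Monotone J
  sub_le : ∀ s t, s ≤ t → J t ≤ J s + (t - s)
  bddBelow : ∃ c, ∀ s, c ≤ J s

namespace RadialPotential

variable {J : ℝ → ℝ}

/-- The right derivative. -/
noncomputable def rightDeriv (J : ℝ → ℝ) (x : ℝ) : ℝ := derivWithin J (Ioi x) x

lemma continuous (h : RadialPotential J) : Continuous J :=
  continuousOn_univ.1 (h.convexOn.continuousOn isOpen_univ)

lemma rightDeriv_le_slope (h : RadialPotential J) {x y : ℝ} (hxy : x < y) :
    rightDeriv J x ≤ slope J x y :=
  h.convexOn.rightDeriv_le_slope_of_mem_interior (by simp) (mem_univ _) hxy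

lemma slope_le_rightDeriv (h : RadialPotential J) {x y : ℝ} (hxy : x < y) :
    slope J x y ≤ rightDeriv J y :=
  (h.convexOn.slope_le_leftDeriv_of_mem_interior (mem_univ _) (by simp) hxy).trans
    (h.convexOn.leftDeriv_le_rightDeriv_of_mem_interior (by simp))

lemma monotone_rightDeriv (h : RadialPotential J) : Monotone (rightDeriv J) := by
  have := h.convexOn.monotoneOn_rightDeriv
  rw [interior_univ, monotoneOn_univ] at this
  exact this

lemma rightDeriv_nonneg (h : RadialPotential J) (x : ℝ) : 0 ≤ rightDeriv J x := by
  refine le_trans ?_ (h.slope_le_rightDeriv (sub_one_lt x))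
  rw [slope_def_field]
  exact div_nonneg (sub_nonneg.2 (h.monotone (by linarith))) (by linarith)

lemma rightDeriv_le_one (h : RadialPotential J) (x : ℝ) : rightDeriv J x ≤ 1 := by
  refine (h.rightDeriv_le_slope (lt_add_one x)).trans ?_
  rw [slope_def_field, div_le_one (by linarith)]
  linarith [h.sub_le x (x + 1) (by linarith)]

lemma hasDerivWithinAt_rightDeriv (h : RadialPotential J) (x : ℝ) :
    HasDerivWithinAt J (rightDeriv J x) (Ioi x) x :=
  h.convexOn.hasDerivWithinAt_rightDeriv_of_mem_interior (by simp)

/-- A convex function bounded below has slope at most `(J 0 - c)/(-s)` between `s` and `0`. This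
limit is what makes the right derivative equal to, and not merely differ by a constant from, the
mass of `(-∞, x]`. -/
lemma tendsto_rightDeriv_atBot (h : RadialPotential J) :
    Tendsto (rightDeriv J) atBot (𝓝 0) := by
  obtain ⟨c, hc⟩ := h.bddBelow
  have h1 : Tendsto (fun s : ℝ => (J 0 - c) / -s) atBot (𝓝 0) :=
    tendsto_const_nhds.div_atTop tendsto_neg_atBot_atTop
  refine tendsto_of_tendsto_of_tendsto_of_le_of_le' tendsto_const_nhds h1
    (Eventually.of_forall h.rightDeriv_nonneg) ?_
  filter_upwards [eventually_lt_atBot 0] with s hs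
  refine (h.rightDeriv_le_slope hs).trans ?_
  rw [slope_def_field, zero_sub]
  exact div_le_div_of_nonneg_right (by linarith [hc s]) (by linarith)

lemma continuousAt_slope_left (h : RadialPotential J) {x y : ℝ} (hxy : x ≠ y) :
    ContinuousAt (fun t => slope J t y) x := by
  simp only [slope_def_field]
  exact (continuousAt_const.sub h.continuous.continuousAt).div
    (continuousAt_const.sub continuousAt_id) (sub_ne_zero.2 hxy.symm)

/-- From above: for fixed `y` with slope from `x` close to the right derivative at `x`, the slope
from `t` to `y` bounds the right derivative at `t` and is continuous in `t`. -/
lemma continuousWithinAt_rightDeriv (h : RadialPotential J) (x : ℝ) :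
    ContinuousWithinAt (rightDeriv J) (Ici x) x := by
  refine tendsto_order.2 ⟨fun a ha => ?_, fun a ha => ?_⟩
  · filter_upwards [self_mem_nhdsWithin] with t ht
    exact ha.trans_le (h.monotone_rightDeriv ht)
  · have h1 := (hasDerivWithinAt_iff_tendsto_slope' self_notMem_Ioi).1
      (h.hasDerivWithinAt_rightDeriv x)
    obtain ⟨y, hy, hxy⟩ := ((h1.eventually (gt_mem_nhds ha)).and self_mem_nhdsWithin).exists
    have hxy' : x < y := hxy
    have h2 := (h.continuousAt_slope_left hxy'.ne).eventually (gt_mem_nhds hy)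
    filter_upwards [mem_nhdsWithin_of_mem_nhds h2,
      mem_nhdsWithin_of_mem_nhds (gt_mem_nhds hxy')] with t ht1 ht2
    exact (h.rightDeriv_le_slope ht2).trans_lt ht1

/-- The Stieltjes function given by the right derivative. -/
noncomputable def stieltjes (h : RadialPotential J) : StieltjesFunction ℝ where
  toFun := rightDeriv J
  mono' := h.monotone_rightDeriv
  right_continuous' := h.continuousWithinAt_rightDeriv

lemma hasDerivWithinAt_leftDeriv (h : RadialPotential J) (x : ℝ) :
    HasDerivWithinAt J (derivWithin J (Iio x) x) (Iio x) x :=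
  h.convexOn.hasDerivWithinAt_leftDeriv_of_mem_interior (by simp)

/-- The reason why open half-lines, hence open disks, carry the left derivative. -/
lemma tendsto_rightDeriv_left (h : RadialPotential J) (x : ℝ) :
    Tendsto (rightDeriv J) (𝓝[<] x) (𝓝 (derivWithin J (Iio x) x)) := by
  refine tendsto_order.2 ⟨fun a ha => ?_, fun a ha => ?_⟩
  · have h1 := (hasDerivWithinAt_iff_tendsto_slope' self_notMem_Iio).1
      (h.hasDerivWithinAt_leftDeriv x)
    obtain ⟨y, hy, hxy⟩ := ((h1.eventually (lt_mem_nhds ha)).and self_mem_nhdsWithin).exists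
    have hxy' : y < x := hxy
    have h2 := (h.continuousAt_slope_left hxy'.ne').eventually (lt_mem_nhds hy)
    filter_upwards [mem_nhdsWithin_of_mem_nhds h2,
      mem_nhdsWithin_of_mem_nhds (lt_mem_nhds hxy')] with t ht1 ht2
    rw [slope_comm] at ht1
    exact ht1.trans_le (h.slope_le_rightDeriv ht2)
  · filter_upwards [self_mem_nhdsWithin] with t ht
    exact ((h.rightDeriv_le_slope ht).trans
      (h.convexOn.slope_le_leftDeriv_of_mem_interior (mem_univ _) (by simp) ht)).trans_lt ha

lemma leftDeriv_nonneg (h : RadialPotential J) (x : ℝ) : 0 ≤ derivWithin J (Iio x) x :=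
  ge_of_tendsto (h.tendsto_rightDeriv_left x) (Eventually.of_forall h.rightDeriv_nonneg)

instance isFiniteMeasure_stieltjes (h : RadialPotential J) : IsFiniteMeasure h.stieltjes.measure :=
  h.stieltjes.isFiniteMeasure_of_forall_abs_le (C := 1) fun x =>
    abs_le.2 ⟨by have := h.rightDeriv_nonneg x; exact le_trans (by norm_num) this,
      h.rightDeriv_le_one x⟩

lemma stieltjes_Iio (h : RadialPotential J) (x : ℝ) :
    h.stieltjes.measure (Iio x) = ENNReal.ofReal (derivWithin J (Iio x) x) := by
  rw [h.stieltjes.measure_Iio h.tendsto_rightDeriv_atBot, sub_zero,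
    leftLim_eq_of_tendsto (f := h.stieltjes) (h.tendsto_rightDeriv_left x)]

lemma stieltjes_real_Iic (h : RadialPotential J) (x : ℝ) :
    h.stieltjes.measure.real (Iic x) = rightDeriv J x := by
  rw [measureReal_def, h.stieltjes.measure_Iic h.tendsto_rightDeriv_atBot, sub_zero]
  exact ENNReal.toReal_ofReal (h.rightDeriv_nonneg x)

lemma integral_rightDeriv (h : RadialPotential J) {x S : ℝ} (hxS : x ≤ S) :
    ∫ y in Ioc x S, rightDeriv J y = J S - J x := by
  rw [← intervalIntegral.integral_of_le hxS]
  exact intervalIntegral.integral_eq_sub_of_hasDeriv_right h.continuous.continuousOn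
    (fun y _ => h.hasDerivWithinAt_rightDeriv y) h.monotone_rightDeriv.intervalIntegrable

/-- Fubini for the indicator of `s ≤ y`: integrating in `y` over `(x, S]` gives `S - max s x`,
integrating in `s` gives the right derivative at `y`, whose integral is the increment of `J`. -/
lemma integral_sub_max (h : RadialPotential J) {x S : ℝ} (hxS : x ≤ S) :
    ∫ s in Iic S, (S - max s x) ∂h.stieltjes.measure = J S - J x := by
  have hf : IsFiniteMeasure (volume.restrict (Ioc x S)) :=
    ⟨by rw [Measure.restrict_apply_univ]; exact measure_Ioc_lt_top⟩
  have hset : MeasurableSet {p : ℝ × ℝ | p.1 ≤ p.2} := measurableSet_le measurable_fst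
      measurable_snd
  let F : ℝ × ℝ → ℝ := {p : ℝ × ℝ | p.1 ≤ p.2}.indicator fun _ => 1
  have hF : Integrable F ((h.stieltjes.measure.restrict (Iic S)).prod
      (volume.restrict (Ioc x S))) := (integrable_const _).indicator hset
  have hswap := integral_integral_swap (f := fun s y => F (s, y)) hF
  have h1 : ∀ s ∈ Iic S, ∫ y in Ioc x S, F (s, y) = S - max s x := by
    intro s hs
    have : ∀ y, F (s, y) = (Ici s).indicator (fun _ => 1) y := fun y => by simp [F, indicator]
    simp_rw [this]
    rw [setIntegral_indicator measurableSet_Ici, setIntegral_const, smul_eq_mul, mul_one]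
    rcases le_or_gt s x with h2 | h2
    · have : Ioc x S ∩ Ici s = Ioc x S := inter_eq_left.2 fun y hy => h2.trans hy.1.le
      rw [this, max_eq_right h2, Real.volume_real_Ioc_of_le hxS]
    · have : Ioc x S ∩ Ici s = Icc s S := by
        ext y; simp only [mem_inter_iff, mem_Ioc, mem_Ici, mem_Icc]
        constructor
        · rintro ⟨⟨_, h3⟩, h4⟩; exact ⟨h4, h3⟩
        · rintro ⟨h3, h4⟩; exact ⟨⟨h2.trans_le h3, h4⟩, h3⟩
      rw [this, max_eq_left h2.le, Real.volume_real_Icc_of_le hs]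
  have h3 : ∀ y ∈ Ioc x S, ∫ s in Iic S, F (s, y) ∂h.stieltjes.measure = rightDeriv J y := by
    intro y hy
    have : ∀ s, F (s, y) = (Iic y).indicator (fun _ => 1) s := fun s => by simp [F, indicator]
    simp_rw [this]
    rw [setIntegral_indicator measurableSet_Iic, setIntegral_const, smul_eq_mul, mul_one,
      inter_eq_right.2 (Iic_subset_Iic.2 hy.2), h.stieltjes_real_Iic]
  rw [setIntegral_congr_fun measurableSet_Iic h1, setIntegral_congr_fun measurableSet_Ioc h3,
    h.integral_rightDeriv hxS] at hswap
  exact hswap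

lemma integrableOn_max (h : RadialPotential J) (x S : ℝ) :
    IntegrableOn (fun s => S - max s x) (Iic S) h.stieltjes.measure := by
  refine IntegrableOn.of_bound (measure_lt_top _ _) (by fun_prop) (|S| + |x|)
    ((ae_restrict_mem measurableSet_Iic).mono fun s hs => ?_)
  have hs' : s ≤ S := hs
  have h1 := neg_abs_le S
  have h2 := le_abs_self S
  have h3 := neg_abs_le x
  have h4 := le_abs_self x
  rw [Real.norm_eq_abs, abs_le]
  constructor
  · rcases max_cases s x with ⟨h5, _⟩ | ⟨h5, _⟩ <;> rw [h5] <;> linarith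
  · linarith [le_max_right s x]

lemma integral_max (h : RadialPotential J) {x S : ℝ} (hxS : x ≤ S) :
    ∫ s in Iic S, max s x ∂h.stieltjes.measure =
      S * h.stieltjes.measure.real (Iic S) - J S + J x := by
  have h1 := h.integral_sub_max hxS
  have h2 : ∫ s in Iic S, max s x ∂h.stieltjes.measure =
      ∫ s in Iic S, (S - (S - max s x)) ∂h.stieltjes.measure := by simp
  rw [h2, integral_sub (integrable_const _) (h.integrableOn_max x S), h1]
  simp; ring

end RadialPotential

/-! ### Radial measures on the plane -/

/-- The uniform distribution on `(0, 2π]`. -/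
noncomputable def uniformAngle : Measure ℝ :=
  ENNReal.ofReal (2 * Real.pi)⁻¹ • volume.restrict (Ioc 0 (2 * Real.pi))

instance isProbabilityMeasure_uniformAngle : IsProbabilityMeasure uniformAngle := by
  refine ⟨?_⟩
  rw [uniformAngle, Measure.smul_apply, Measure.restrict_apply_univ, Real.volume_Ioc, sub_zero,
    smul_eq_mul, ← ENNReal.ofReal_mul (by positivity), inv_mul_cancel₀ Real.two_pi_pos.ne',
    ENNReal.ofReal_one]

lemma integral_uniformAngle (f : ℂ → ℝ) (c : ℂ) (r : ℝ) :
    ∫ θ, f (circleMap c r θ) ∂uniformAngle = circleAverage f c r := by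
  rw [uniformAngle, integral_smul_measure, circleAverage_eq_setIntegral,
    ENNReal.toReal_ofReal (by positivity), smul_eq_mul]

/-- The rotationally invariant measure whose log-radii are distributed according to `m`. -/
noncomputable def radialMeasure (m : Measure ℝ) : Measure ℂ :=
  (m.prod uniformAngle).map fun p => circleMap 0 (Real.exp p.1) p.2

lemma measurable_polarMap : Measurable fun p : ℝ × ℝ => circleMap 0 (Real.exp p.1) p.2 := by
  unfold circleMap; fun_prop

lemma norm_polarMap (p : ℝ × ℝ) : ‖circleMap 0 (Real.exp p.1) p.2‖ = Real.exp p.1 := by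
  simp [circleMap]

instance isFiniteMeasure_radialMeasure (m : Measure ℝ) [IsFiniteMeasure m] :
    IsFiniteMeasure (radialMeasure m) := by
  unfold radialMeasure; infer_instance

lemma integral_radialMeasure (m : Measure ℝ) [IsFiniteMeasure m] {f : ℂ → ℝ}
    (hf : Integrable f (radialMeasure m)) :
    ∫ z, f z ∂(radialMeasure m) = ∫ s, circleAverage f 0 (Real.exp s) ∂m := by
  have hf' : Integrable (fun p : ℝ × ℝ => f (circleMap 0 (Real.exp p.1) p.2))
      (m.prod uniformAngle) := hf.comp_measurable measurable_polarMap
  rw [radialMeasure, integral_map measurable_polarMap.aemeasurable hf.aestronglyMeasurable,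
    integral_prod _ hf']
  simp_rw [integral_uniformAngle]

lemma radialMeasure_ball (m : Measure ℝ) [IsFiniteMeasure m] {r : ℝ} (hr : 0 < r) :
    radialMeasure m (ball 0 r) = m (Iio (Real.log r)) := by
  have : (fun p : ℝ × ℝ => circleMap 0 (Real.exp p.1) p.2) ⁻¹' ball 0 r =
      Iio (Real.log r) ×ˢ univ := by
    ext p
    simp only [mem_preimage, mem_ball_zero_iff, norm_polarMap, mem_prod, mem_univ, and_true,
        mem_Iio]
    exact (Real.lt_log_iff_exp_lt hr).symm
  rw [radialMeasure, Measure.map_apply measurable_polarMap measurableSet_ball, this,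
    Measure.prod_prod, measure_univ, mul_one]

lemma radialMeasure_restrict (m : Measure ℝ) [IsFiniteMeasure m] (S : ℝ) :
    (radialMeasure m).restrict (closedBall 0 (Real.exp S)) = radialMeasure
        (m.restrict (Iic S)) := by
  have : (fun p : ℝ × ℝ => circleMap 0 (Real.exp p.1) p.2) ⁻¹' closedBall 0 (Real.exp S) =
      Iic S ×ˢ univ := by
    ext p
    simp only [mem_preimage, mem_closedBall_zero_iff, norm_polarMap, mem_prod, mem_univ, and_true,
      mem_Iic, Real.exp_le_exp]
  rw [radialMeasure, Measure.restrict_map measurable_polarMap measurableSet_closedBall, this,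
    ← Measure.prod_restrict, Measure.restrict_univ, radialMeasure]

lemma circleAverage_comp_rotation (f : ℂ → ℝ) {w : ℂ} (hw : ‖w‖ = 1) (r : ℝ) :
    circleAverage (fun z => f (w * z)) 0 r = circleAverage f 0 r := by
  rw [Real.circleAverage_eq_integral_add (f := f) w.arg, Real.circleAverage]
  congr 2
  ext θ
  congr 1
  have h1 : w = Complex.exp (w.arg * Complex.I) := by
    conv_lhs => rw [← Complex.norm_mul_exp_arg_mul_I w, hw]
    simp
  conv_lhs => rw [h1]
  simp only [circleMap, zero_add]
  push_cast
  rw [add_mul, Complex.exp_add]; ring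

lemma rotationInvariant_radialMeasure (m : Measure ℝ) [IsFiniteMeasure m] :
    RotationInvariant (radialMeasure m) := by
  intro w hw
  refine ext_of_forall_integral_eq_of_IsFiniteMeasure fun f => ?_
  have hm : Measurable fun z : ℂ => w * z := by fun_prop
  have hi : ∀ g : ℂ → ℝ, Continuous g → (∀ z, ‖g z‖ ≤ ‖f‖) → Integrable g (radialMeasure m) :=
    fun g hg hb => Integrable.of_bound hg.aestronglyMeasurable ‖f‖ (ae_of_all _ hb)
  rw [integral_map hm.aemeasurable f.continuous.aestronglyMeasurable,
    integral_radialMeasure m (hi (fun z => f (w * z)) (by fun_prop) fun z => f.norm_coe_le_norm _),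
    integral_radialMeasure m (hi f f.continuous fun z => f.norm_coe_le_norm _)]
  simp_rw [circleAverage_comp_rotation f hw]

/-! ### The plane measure with a given radial potential. -/

namespace RadialPotential

variable {J : ℝ → ℝ}

/-- The plane measure with potential `z ↦ J (log |z|)`. -/
noncomputable def measure (h : RadialPotential J) : Measure ℂ := radialMeasure h.stieltjes.measure

instance isFiniteMeasure_measure (h : RadialPotential J) : IsFiniteMeasure h.measure := by
  unfold measure; infer_instance

lemma hasRadialProfile (h : RadialPotential J) {I : ℝ → EReal} (hI : ∀ x, I x = (J x : EReal))
    (b : ℝ≥0) : HasRadialProfile (b • h.measure) b I := by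
  refine ⟨fun w hw => ?_, fun r hr => ⟨?_, derivWithin J (Iio (Real.log r)) (Real.log r),
    ⟨J, hI, ?_⟩, ?_⟩⟩
  · rw [Measure.map_smul, show h.measure.map (fun z => w * z) = h.measure from
      rotationInvariant_radialMeasure _ w hw]
  · exact measure_ne_top _ _
  · exact (hasDerivWithinAt_Iio_iff_Iic).1 (h.hasDerivWithinAt_leftDeriv _)
  · rw [measureReal_def, Measure.smul_apply, measure, radialMeasure_ball _ hr, h.stieltjes_Iio,
      ENNReal.smul_def, smul_eq_mul, ENNReal.toReal_mul,
      ENNReal.toReal_ofReal (h.leftDeriv_nonneg _)]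
    rfl

lemma measure_real_closedBall_le_one (h : RadialPotential J) (S : ℝ) :
    (h.measure.restrict (closedBall 0 (Real.exp S))).real univ ≤ 1 := by
  rw [measure, radialMeasure_restrict, measureReal_def, radialMeasure,
    Measure.map_apply measurable_polarMap MeasurableSet.univ, preimage_univ, ← univ_prod_univ,
    Measure.prod_prod, measure_univ (μ := uniformAngle), mul_one, Measure.restrict_apply_univ,
    ← measureReal_def,
    h.stieltjes_real_Iic]
  exact h.rightDeriv_le_one S

/-- Averaging `log |z - w|` over the circle of log-radius `s` gives `max s (log |z|)`, which reduces
the claim to `integral_max`. Only the mass in a disk is used, and it produces `J(log |z|)` up to a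
constant. -/
lemma integral_log_norm_sub (h : RadialPotential J) {S : ℝ} {z : ℂ} (hz : z ≠ 0)
    (hzS : ‖z‖ ≤ Real.exp S)
    (hint : Integrable (fun w => Real.log ‖z - w‖)
        (h.measure.restrict (closedBall 0 (Real.exp S)))) :
    ∫ w in closedBall 0 (Real.exp S), Real.log ‖z - w‖ ∂h.measure =
      S * h.stieltjes.measure.real (Iic S) - J S + J (Real.log ‖z‖) := by
  have hz0 : 0 < ‖z‖ := norm_pos_iff.2 hz
  rw [measure, radialMeasure_restrict] at hint ⊢
  rw [integral_radialMeasure _ hint, ← h.integral_max ((Real.log_le_iff_le_exp hz0).2 hzS)]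
  refine integral_congr_ae (ae_of_all _ fun s => ?_)
  simp only [norm_sub_rev z]
  rw [circleAverage_log_norm_sub_const_eq_log_radius_add_posLog (Real.exp_pos s).ne',
    zero_sub, norm_neg, log_add_posLog (Real.exp_pos s) _ (norm_nonneg _)]
  rcases le_total (Real.exp s) ‖z‖ with h1 | h1
  · rw [max_eq_right h1, max_eq_right ((Real.le_log_iff_exp_le hz0).2 h1)]
  · rw [max_eq_left h1, Real.log_exp, max_eq_left ((Real.log_le_iff_le_exp hz0).2 h1)]

/-- On a disk carrying the ring mean, `J(log |z|)` is a constant plus the logarithmic potential of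
the restricted measure. The constant is killed, Fubini brings the ring mean onto `log |z - w|`, and
the smoothing error is integrated against a measure of mass at most `1`. -/
theorem isPotential (h : RadialPotential J) : IsPotential (fun z => J (Real.log ‖z‖))
    h.measure := by
  intro φ A B ε δ hφ hε hδ0 hA hB hδ
  -- The ring mean vanishes outside this radius; the `1` only ensures positivity.
  set R := max 1 (A + 2 * ε) with hR
  have hR0 : 0 < R := lt_max_of_lt_left one_pos
  set S := Real.log R with hS
  have hexp : Real.exp S = R := Real.exp_log hR0
  set ν := h.measure.restrict (closedBall 0 (Real.exp S)) with hν
  have hνf : IsFiniteMeasure ν := by rw [hν]; infer_instance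
  set ψ := ringMean φ ε with hψ
  have hψc : Continuous ψ := continuous_ringMean hφ ε
  have hψB : ∀ z, |ψ z| ≤ 2 * B := abs_ringMean_le hB ε
  have hB0 : 0 ≤ B := (abs_nonneg _).trans (hB 0)
  have hψ0 : ∀ z, R < ‖z‖ → ψ z = 0 := fun z hz =>
    ringMean_eq_zero hε hA ((le_max_right _ _).trans_lt hz)
  have hlogi : ∀ w : ℂ, Integrable (fun z => Real.log ‖z - w‖ * ψ z) := fun w =>
    integrable_mul_ringMean (fun ρ => integrableOn_log_norm_sub ρ w) hφ hε hA hB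
  have hψi : Integrable ψ := by
    simpa using integrable_mul_ringMean (h := fun _ => 1)
      (fun ρ => integrableOn_const measure_closedBall_lt_top.ne) hφ hε hA hB
  have hfR : IsFiniteMeasure (volume.restrict (closedBall (0 : ℂ) R)) :=
    ⟨by rw [Measure.restrict_apply_univ]; exact measure_closedBall_lt_top⟩
  have hFm : Measurable fun p : ℂ × ℂ => Real.log ‖p.1 - p.2‖ * ψ p.1 := by
    have := hψc.measurable
    fun_prop
  have hF : Integrable (fun p : ℂ × ℂ => Real.log ‖p.1 - p.2‖ * ψ p.1) (volume.prod ν) := by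
    rw [integrable_prod_iff' hFm.aestronglyMeasurable]
    refine ⟨ae_of_all _ hlogi, ?_⟩
    refine Integrable.of_bound
      (hFm.norm.stronglyMeasurable.integral_prod_left' (μ := volume)).aestronglyMeasurable
      (2 * B * (volume.real (closedBall (0 : ℂ) R) + logSqIntegral (R + R))) ?_
    filter_upwards [ae_restrict_mem measurableSet_closedBall] with w hw
    rw [hexp, mem_closedBall_zero_iff] at hw
    rw [Real.norm_eq_abs, abs_of_nonneg (integral_nonneg fun _ => norm_nonneg _)]
    have h1 : ∫ z, ‖Real.log ‖z - w‖ * ψ z‖ =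
        ∫ z in closedBall 0 R, ‖Real.log ‖z - w‖ * ψ z‖ := by
      refine (setIntegral_eq_integral_of_forall_compl_eq_zero fun z hz => ?_).symm
      simp only [mem_closedBall, dist_zero_right, not_le] at hz
      simp [hψ0 z hz]
    rw [h1]
    have h2 : IntegrableOn (fun z => 1 + (Real.log ‖z - w‖) ^ 2) (closedBall 0 R) :=
      (integrable_const _).add (integrableOn_log_norm_sub_sq R w)
    calc ∫ z in closedBall 0 R, ‖Real.log ‖z - w‖ * ψ z‖
        ≤ ∫ z in closedBall 0 R, (1 + (Real.log ‖z - w‖) ^ 2) * (2 * B) := by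
          refine integral_mono (hlogi w).norm.integrableOn (h2.mul_const _) fun z => ?_
          simp only [norm_mul, Real.norm_eq_abs]
          exact mul_le_mul (abs_le_one_add_sq _) (hψB z) (abs_nonneg _) (by positivity)
      _ = 2 * B * (volume.real (closedBall (0 : ℂ) R) +
            ∫ z in closedBall 0 R, (Real.log ‖z - w‖) ^ 2) := by
          rw [integral_mul_const, integral_add (integrable_const _)
            (integrableOn_log_norm_sub_sq R w)]
          simp [mul_comm]
      _ ≤ _ := by
          have := integral_log_norm_sub_sq_le (R := R) hw
          gcongr
  have hpot : ∀ᵐ z : ℂ, J (Real.log ‖z‖) * ψ z =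
      (J S - S * h.stieltjes.measure.real (Iic S)) * ψ z + ∫ w, Real.log ‖z - w‖ * ψ z ∂ν := by
    have hne : ∀ᵐ z : ℂ, z ≠ 0 := (measure_eq_zero_iff_ae_notMem (s := {0})).1 (by simp)
    filter_upwards [hF.prod_right_ae, hne] with z hz hz0
    by_cases hψz : ψ z = 0
    · simp [hψz]
    · have hzR : ‖z‖ ≤ Real.exp S := by
        rw [hexp]; by_contra hc; exact hψz (hψ0 z (not_le.1 hc))
      have hi : Integrable (fun w => Real.log ‖z - w‖) ν := by
        have := hz.mul_const (ψ z)⁻¹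
        simpa [mul_assoc, hψz] using this
      rw [integral_mul_const, h.integral_log_norm_sub hz0 hzR hi]
      ring
  have hUψ : ∫ z, J (Real.log ‖z‖) * ψ z = ∫ w, (∫ v, φ v * ringKernel ε (v - w)) ∂ν := by
    rw [integral_congr_ae hpot, integral_add (hψi.const_mul _) hF.integral_prod_left,
      integral_const_mul, integral_ringMean hφ hε hA hB, mul_zero, zero_add,
      integral_integral_swap (f := fun z w => Real.log ‖z - w‖ * ψ z) hF]
    simp_rw [hψ, integral_log_mul_ringMean hφ hε hA hB]
  have hφμ : ∫ z, φ z ∂h.measure = ∫ z, φ z ∂ν := by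
    refine (setIntegral_eq_integral_of_forall_compl_eq_zero fun z hz => ?_).symm
    rw [hexp, mem_closedBall, dist_zero_right, not_le] at hz
    refine hA z (lt_of_le_of_lt ?_ hz)
    exact le_trans (by linarith) (le_max_right _ _)
  have hφi : Integrable φ ν := Integrable.of_bound hφ.aestronglyMeasurable B (ae_of_all _ hB)
  have hΦi : Integrable (fun w => ∫ v, φ v * ringKernel ε (v - w)) ν := by
    have := hF.integral_prod_right
    simpa only [hψ, integral_log_mul_ringMean hφ hε hA hB] using this
  set κ := ∫ x, ringKernel ε x with hκ
  have hκ0 : 0 < κ := integral_ringKernel_pos hε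
  rw [hUψ, hφμ, ← integral_const_mul, ← integral_sub hΦi (hφi.const_mul _)]
  have := norm_integral_le_of_norm_le_const (μ := ν)
    (f := fun w => (∫ v, φ v * ringKernel ε (v - w)) - κ * φ w) (C := κ * δ)
    (ae_of_all _ fun w => abs_integral_mul_ringKernel_sub_le hφ hε hδ w)
  refine this.trans ?_
  exact mul_le_of_le_one_right (by positivity) (h.measure_real_closedBall_le_one S)

end RadialPotential

end RandomZeros

namespace RandomZeros

/-! ### Suprema of affine functions -/

/-- The conjugate of `-g` with respect to the index set `S ⊆ [0,∞)`. -/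
noncomputable def supAffine (S : Set ℝ≥0) (g : ℝ≥0 → ℝ) (s : ℝ) : ℝ :=
  ⨆ t : S, (s * (t : ℝ≥0) + g t)

section supAffine

variable {S : Set ℝ≥0} {g : ℝ≥0 → ℝ}

lemma bddAbove_supAffine (h1 : ∀ t ∈ S, t ≤ 1) {B : ℝ} (hB : ∀ t ∈ S, g t ≤ B) (s : ℝ) :
    BddAbove (range fun t : S => s * (t : ℝ≥0) + g t) := by
  refine ⟨|s| + B, ?_⟩
  rintro _ ⟨⟨t, ht⟩, rfl⟩
  have ht1 : (t : ℝ) ≤ 1 := h1 t ht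
  have : s * t ≤ |s| * 1 :=
    mul_le_mul (le_abs_self s) ht1 t.coe_nonneg (abs_nonneg s)
  linarith [hB t ht]

lemma le_supAffine (h1 : ∀ t ∈ S, t ≤ 1) {B : ℝ} (hB : ∀ t ∈ S, g t ≤ B) (s : ℝ) {t : ℝ≥0}
    (ht : t ∈ S) : s * t + g t ≤ supAffine S g s :=
  le_ciSup (bddAbove_supAffine h1 hB s) ⟨t, ht⟩

lemma supAffine_le (h0 : (0 : ℝ≥0) ∈ S) {s C : ℝ} (h : ∀ t ∈ S, s * t + g t ≤ C) :
    supAffine S g s ≤ C :=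
  have : Nonempty S := ⟨⟨0, h0⟩⟩
  ciSup_le fun t => h t t.2

lemma exists_lt_of_lt_supAffine (h0 : (0 : ℝ≥0) ∈ S) {s C : ℝ} (h : C < supAffine S g s) :
    ∃ t ∈ S, C < s * t + g t := by
  have : Nonempty S := ⟨⟨0, h0⟩⟩
  obtain ⟨t, ht⟩ := exists_lt_of_lt_ciSup h
  exact ⟨t, t.2, ht⟩

/-- The affine functions have slopes in `[0,1]`, and the index `0` contributes a constant, which
bounds the supremum below. -/
lemma radialPotential_supAffine (h0 : (0 : ℝ≥0) ∈ S) (h1 : ∀ t ∈ S, t ≤ 1) {B : ℝ}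
    (hB : ∀ t ∈ S, g t ≤ B) : RadialPotential (supAffine S g) where
  convexOn := by
    refine ⟨convex_univ, fun x _ y _ α β hα hβ hαβ => supAffine_le h0 fun t ht => ?_⟩
    have hx := mul_le_mul_of_nonneg_left (le_supAffine h1 hB x ht) hα
    have hy := mul_le_mul_of_nonneg_left (le_supAffine h1 hB y ht) hβ
    have : g t = α * g t + β * g t := by rw [← add_mul, hαβ, one_mul]
    simp only [smul_eq_mul]
    linarith
  monotone := fun x y hxy => supAffine_le h0 fun t ht =>
    le_trans (by gcongr) (le_supAffine h1 hB y ht)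
  sub_le := fun x y hxy => supAffine_le h0 fun t ht => by
    have := le_supAffine h1 hB x ht
    have ht1 : (t : ℝ) ≤ 1 := h1 t ht
    nlinarith
  bddBelow := ⟨g 0, fun s => by simpa using le_supAffine h1 hB s h0⟩

lemma legendreFenchel_eq_supAffine (h0 : (0 : ℝ≥0) ∈ S) (h1 : ∀ t ∈ S, t ≤ 1) {B : ℝ}
    (hB : ∀ t ∈ S, g t ≤ B) {f : ℝ≥0 → EReal} (hf : ∀ t ∈ S, f t = ((-g t : ℝ) : EReal))
    (hf' : ∀ t ∉ S, f t = ⊤) (s : ℝ) : legendreFenchel f s = (supAffine S g s : EReal) := by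
  refine le_antisymm (iSup_le fun t => ?_) (le_of_forall_lt fun c hc => ?_)
  · by_cases ht : t ∈ S
    · rw [hf t ht, ← EReal.coe_sub, EReal.coe_le_coe_iff, sub_neg_eq_add]
      exact le_supAffine h1 hB s ht
    · rw [hf' t ht]; simp
  · have key : ∀ t ∈ S, (((s * t + g t : ℝ)) : EReal) ≤ legendreFenchel f s := fun t ht => by
      refine le_trans (le_of_eq ?_) (le_iSup _ t)
      rw [hf t ht, ← EReal.coe_sub, sub_neg_eq_add]
    induction c with
    | bot => exact lt_of_lt_of_le (EReal.bot_lt_coe _) (key 0 h0)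
    | top => exact absurd hc (by simp)
    | coe c =>
      obtain ⟨t, ht, hlt⟩ := exists_lt_of_lt_supAffine h0 (EReal.coe_lt_coe_iff.1 hc)
      exact lt_of_lt_of_le (EReal.coe_lt_coe_iff.2 hlt) (key t ht)

end supAffine

/-! ### Entropy and factorials -/

/-- The exponential rate of the factors produced by differentiation. -/
noncomputable def entropy (a t : ℝ) : ℝ :=
  (t + a) * Real.log (t + a) - t * Real.log t + (1 - a) * Real.log (1 - a)

lemma continuous_entropy (a : ℝ) : Continuous (entropy a) := by
  unfold entropy
  exact ((Real.continuous_mul_log.comp (continuous_id.add continuous_const)).sub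
    Real.continuous_mul_log).add continuous_const

/-- From `m^m / m! ≤ e^m`. -/
lemma sub_le_log_factorial (m : ℕ) :
    m * Real.log m - m ≤ Real.log (m.factorial : ℝ) := by
  rcases m.eq_zero_or_pos with rfl | hm
  · simp
  have hm' : (0 : ℝ) < m := by exact_mod_cast hm
  have hf : (0 : ℝ) < m.factorial := by exact_mod_cast m.factorial_pos
  have h := Real.pow_div_factorial_le_exp (m : ℝ) hm'.le m
  have h2 := Real.log_le_log (div_pos (pow_pos hm' m) hf) h
  rw [Real.log_exp, Real.log_div (pow_pos hm' m).ne' hf.ne', Real.log_pow] at h2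
  linarith

/-- Induction using `log((m+2)/(m+1)) ≥ 1/(m+2)`. -/
lemma log_factorial_succ_le (m : ℕ) :
    Real.log ((m + 1).factorial : ℝ) ≤
      (m + 1) * Real.log (m + 1) - (m + 1) + (Real.log (m + 1) + 1) := by
  induction m with
  | zero => simp
  | succ m ih =>
    have hf : (0 : ℝ) < (m + 1).factorial := by exact_mod_cast (m + 1).factorial_pos
    have h1 : (0 : ℝ) < m + 1 := by positivity
    have h2 : (0 : ℝ) < m + 1 + 1 := by positivity
    rw [Nat.factorial_succ, Nat.cast_mul, Real.log_mul (by positivity) hf.ne']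
    push_cast
    have h3 := Real.one_sub_inv_le_log_of_pos (div_pos h2 h1)
    rw [inv_div, Real.log_div h2.ne' h1.ne'] at h3
    have h4 : (1 : ℝ) - (m + 1) / (m + 1 + 1) = 1 / (m + 1 + 1) := by field_simp; ring
    rw [h4, div_le_iff₀ h2] at h3
    linarith

lemma abs_log_factorial_sub_le {m n : ℕ} (hmn : m ≤ n) :
    |Real.log (m.factorial : ℝ) - (m * Real.log m - m)| ≤ Real.log (n + 1) + 1 := by
  have h0 : 0 ≤ Real.log ((n : ℝ) + 1) := Real.log_nonneg (by linarith [n.cast_nonneg (α := ℝ)])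
  rw [abs_of_nonneg (sub_nonneg.2 (sub_le_log_factorial m))]
  cases m with
  | zero => simp; linarith
  | succ m =>
    have h1 := log_factorial_succ_le m
    have h2 : Real.log ((m : ℝ) + 1) ≤ Real.log (n + 1) := by
      apply Real.log_le_log (by positivity)
      have : ((m + 1 : ℕ) : ℝ) ≤ n := by exact_mod_cast hmn
      push_cast at this; linarith
    push_cast
    linarith

/-- The factor by which the normalized `N`-th derivative multiplies the coefficient of `z^k`. -/
noncomputable def derivFactor (a : ℝ) (n N k : ℕ) : ℝ :=
  k.descFactorial N / (n : ℝ) ^ N * Real.exp (N + n * ((1 - a) * Real.log (1 - a)))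

lemma derivFactor_pos (a : ℝ) {n N k : ℕ} (hn : 0 < n) (hNk : N ≤ k) :
    0 < derivFactor a n N k := by
  have : (0 : ℝ) < k.descFactorial N := by
    exact_mod_cast Nat.descFactorial_pos.2 hNk
  have : (0 : ℝ) < n := by exact_mod_cast hn
  unfold derivFactor; positivity

lemma derivFactor_nonneg (a : ℝ) (n N k : ℕ) : 0 ≤ derivFactor a n N k := by
  unfold derivFactor; positivity

lemma derivFactor_of_lt (a : ℝ) {n N k : ℕ} (h : k < N) : derivFactor a n N k = 0 := by
  simp [derivFactor, Nat.descFactorial_of_lt h]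

lemma div_mul_log_div {k n : ℕ} (hn : 0 < n) :
    (k / n : ℝ) * Real.log (k / n) = (k * Real.log k - k * Real.log n) / n := by
  rcases k.eq_zero_or_pos with rfl | hk
  · simp
  have hn' : (n : ℝ) ≠ 0 := by exact_mod_cast hn.ne'
  have hk' : (k : ℝ) ≠ 0 := by exact_mod_cast hk.ne'
  rw [Real.log_div hk' hn']
  ring

/-- `k!/(k-N)!` is expanded by the factorial bounds. The linear terms `-k + (k - N)` cancel against
`e^N`, and `n^(-N)` rescales `k log k` to `(k/n) log (k/n)`. Each of the two factorials contributes
an error `log(n+1) + 1`. -/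
lemma abs_log_derivFactor_sub_le (a : ℝ) {n N k : ℕ} (hn : 0 < n) (hNk : N ≤ k) (hkn : k ≤ n) :
    |(n : ℝ)⁻¹ * Real.log (derivFactor a n N k) -
      ((k / n : ℝ) * Real.log (k / n) - ((k - N : ℕ) / n : ℝ) * Real.log ((k - N : ℕ) / n) +
        (1 - a) * Real.log (1 - a))| ≤ 2 * (Real.log (n + 1) + 1) / n := by
  have hn' : (0 : ℝ) < n := by exact_mod_cast hn
  have hd : (0 : ℝ) < k.descFactorial N := by
    exact_mod_cast Nat.descFactorial_pos.2 hNk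
  have hf : (0 : ℝ) < (k - N).factorial := by exact_mod_cast (k - N).factorial_pos
  have h1 := abs_le.1 (abs_log_factorial_sub_le hkn)
  have h2 := abs_le.1 (abs_log_factorial_sub_le ((Nat.sub_le k N).trans hkn))
  have h3 : Real.log (k.factorial : ℝ) =
      Real.log ((k - N).factorial : ℝ) + Real.log (k.descFactorial N : ℝ) := by
    rw [← Real.log_mul hf.ne' hd.ne', ← Nat.cast_mul, Nat.factorial_mul_descFactorial hNk]
  rw [div_mul_log_div hn, div_mul_log_div hn]
  have h4 : Real.log (derivFactor a n N k) = Real.log (k.descFactorial N : ℝ) -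
      N * Real.log n + (N + n * ((1 - a) * Real.log (1 - a))) := by
    rw [derivFactor, Real.log_mul (by positivity) (Real.exp_pos _).ne', Real.log_exp,
      Real.log_div hd.ne' (by positivity), Real.log_pow]
  have h5 : ((k - N : ℕ) : ℝ) = k - N := Nat.cast_sub hNk
  rw [h5] at h2 ⊢
  rw [h4, le_div_iff₀ hn', ← abs_of_pos hn', ← abs_mul, abs_of_pos hn']
  have h6 : ((n : ℝ)⁻¹ * (Real.log (k.descFactorial N : ℝ) - N * Real.log n +
      (N + n * ((1 - a) * Real.log (1 - a)))) - ((k * Real.log k - k * Real.log n) / n -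
      ((k - N : ℝ) * Real.log (k - N) - (k - N : ℝ) * Real.log n) / n +
      (1 - a) * Real.log (1 - a))) * n =
      (Real.log (k.factorial : ℝ) - (k * Real.log k - k)) -
      (Real.log ((k - N).factorial : ℝ) - ((k - N : ℝ) * Real.log (k - N) - (k - N))) := by
    rw [h3]; field_simp; ring
  rw [h6, abs_le]
  constructor <;> linarith

lemma tendsto_log_add_one_div_nat :
    Tendsto (fun n : ℕ => 2 * (Real.log (n + 1) + 1) / n) atTop (𝓝 0) := by
  have h1 : Tendsto (fun n : ℕ => Real.log (n + 1) / (n + 1)) atTop (𝓝 0) := by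
    have := (Real.isLittleO_log_id_atTop.tendsto_div_nhds_zero).comp
      (tendsto_natCast_atTop_atTop.comp (tendsto_add_atTop_nat 1))
    refine this.congr fun n => ?_
    simp
  have h2 : Tendsto (fun n : ℕ => ((n : ℝ))⁻¹) atTop (𝓝 0) :=
    tendsto_inv_atTop_zero.comp tendsto_natCast_atTop_atTop
  have h3 := ((h1.mul (h2.const_add 1)).add h2).const_mul 2
  simp only [add_zero, mul_one, mul_zero] at h3
  refine h3.congr' ?_
  filter_upwards [eventually_gt_atTop 0] with n hn
  have : (0 : ℝ) < n := by exact_mod_cast hn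
  field_simp

end RandomZeros

namespace RandomZeros

/-! ### Consequences of assumption A1 -/

section profile

variable {c : ℕ → ℕ → ℂ} {p : ℝ≥0 → ℝ≥0} {T₀ : ℝ≥0∞}

lemma AssumptionA1.eventually_abs_sub_le (h : AssumptionA1 c p T₀) {A : ℝ≥0} (hA : 0 < A)
    {ε : ℝ} (hε : 0 < ε) : ∀ᶠ n : ℕ in atTop, ∀ k : ℕ, (k : ℝ≥0) ≤ A * n →
      |‖c n k‖ ^ (1 / (n : ℝ)) - p (k / n)| ≤ ε := by
  filter_upwards [(h.tendsto_sup A hA).eventually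
    (gt_mem_nhds (ENNReal.ofReal_pos.2 hε))] with n hn k hk
  have h1 : edist (‖c n k‖₊ ^ (1 / (n : ℝ))) (p (k / n)) ≤ ENNReal.ofReal ε :=
    (le_iSup₂ (f := fun (k : ℕ) (_ : (k : ℝ≥0) ≤ A * n) =>
      edist (‖c n k‖₊ ^ (1 / (n : ℝ))) (p (k / n))) k hk).trans hn.le
  rw [edist_dist, ENNReal.ofReal_le_ofReal_iff hε.le, NNReal.dist_eq, NNReal.coe_rpow,
    coe_nnnorm] at h1
  exact h1

lemma AssumptionA1.continuousAt (h : AssumptionA1 c p T₀) {t : ℝ≥0} (ht : (t : ℝ≥0∞) < T₀) :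
    ContinuousAt p t :=
  h.continuousOn.continuousAt
    ((isOpen_Iio.preimage ENNReal.continuous_coe).mem_nhds ht)

/-- If `1 < t < T₀`, the coefficients with `k/n` slightly above `t` are zero, while their `n`-th
roots should approach `p t > 0`. -/
lemma AssumptionA1.threshold_le_one (h : AssumptionA1 c p T₀)
    (hc : ∀ n k, n < k → c n k = 0) : T₀ ≤ 1 := by
  by_contra! hT
  obtain ⟨t, ht1, htT⟩ := ENNReal.lt_iff_exists_nnreal_btwn.1 hT
  have ht1 : 1 < t := by exact_mod_cast ht1
  have hlim : Tendsto (fun n : ℕ => ((⌈t * n⌉₊ : ℕ) : ℝ≥0) / n) atTop (𝓝 t) := by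
    rw [← NNReal.tendsto_coe]
    refine ((tendsto_nat_ceil_mul_div_atTop t.coe_nonneg).comp
      tendsto_natCast_atTop_atTop).congr fun n => ?_
    simp only [Function.comp_apply, NNReal.coe_div, NNReal.coe_natCast]
    rw [← NNReal.coe_natCast n, ← NNReal.coe_mul]
    exact congrArg (fun m : ℕ => (m : ℝ) / n) (Nonneg.nat_ceil_coe (t * (n : ℝ≥0)))
  have hp : Tendsto (fun n : ℕ => (p (((⌈t * n⌉₊ : ℕ) : ℝ≥0) / n) : ℝ)) atTop (𝓝 (p t)) :=
    (NNReal.continuous_coe.tendsto _).comp ((h.continuousAt htT).tendsto.comp hlim)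
  have hpt : (0 : ℝ) < p t := h.pos_of_lt t htT
  -- `A = t + 1` suffices because `⌈t n⌉ ≤ t n + 1 ≤ (t + 1) n`.
  obtain ⟨n, hn1, hn2, hn0⟩ := ((hp.eventually (lt_mem_nhds (half_lt_self hpt))).and
    ((h.eventually_abs_sub_le (A := t + 1) (by positivity) (half_pos hpt)).and
      (eventually_gt_atTop 0))).exists
  have hn0' : (1 : ℝ≥0) ≤ n := by exact_mod_cast hn0
  have h3 := hn2 ⌈t * n⌉₊ ((Nat.ceil_lt_add_one zero_le).le.trans
    (by rw [add_mul, one_mul]; gcongr))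
  have h4 : n < ⌈t * n⌉₊ := by
    rw [Nat.lt_ceil]
    calc (n : ℝ≥0) = 1 * n := (one_mul _).symm
      _ < t * n := by gcongr
  rw [hc n _ h4, norm_zero, Real.zero_rpow (by positivity), zero_sub, abs_neg,
    NNReal.abs_eq] at h3
  linarith

lemma AssumptionA1.le_threshold (h : AssumptionA1 c p T₀) {t : ℝ≥0} (ht : p t ≠ 0) :
    (t : ℝ≥0∞) ≤ T₀ :=
  not_lt.1 fun h' => ht (h.zero_of_gt t h')

lemma AssumptionA1.exists_coe_eq (h : AssumptionA1 c p T₀) (hc : ∀ n k, n < k → c n k = 0) :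
    ∃ T : ℝ≥0, T₀ = T ∧ T ≤ 1 := by
  have h1 := h.threshold_le_one hc
  lift T₀ to ℝ≥0 using ne_top_of_le_ne_top ENNReal.one_ne_top h1 with T
  exact ⟨T, rfl, by exact_mod_cast h1⟩

lemma AssumptionA1.continuousOn_Iic (h : AssumptionA1 c p T₀) {T : ℝ≥0} (hT : T₀ = T) :
    ContinuousOn p (Iic T) := fun t ht => by
  rcases (mem_Iic.1 ht).lt_or_eq with h1 | h1
  · exact (h.continuousAt (by rw [hT]; exact_mod_cast h1)).continuousWithinAt
  · rw [h1]; exact h.leftContinuous T hT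

lemma AssumptionA1.exists_le (h : AssumptionA1 c p T₀) (hc : ∀ n k, n < k → c n k = 0) :
    ∃ B : ℝ, 0 < B ∧ ∀ t, (p t : ℝ) ≤ B := by
  obtain ⟨T, hT, -⟩ := h.exists_coe_eq hc
  have hK : IsCompact (Iic T) := by
    rw [← Icc_bot]; exact isCompact_Icc
  obtain ⟨B, hB⟩ := hK.bddAbove_image (h.continuousOn_Iic hT)
  refine ⟨B + 1, by positivity, fun t => ?_⟩
  rcases le_or_gt t T with h1 | h1
  · have : p t ≤ B := hB ⟨t, h1, rfl⟩
    have : (p t : ℝ) ≤ B := this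
    linarith
  · rw [h.zero_of_gt t (by rw [hT]; exact_mod_cast h1)]
    simp; positivity

/-- The logarithm of the profile of the differentiated polynomials, where it is finite. -/
noncomputable def logRate (p : ℝ≥0 → ℝ≥0) (a t : ℝ≥0) : ℝ :=
  Real.log (p (t + a)) + entropy a t

/-- The set where `logProfileDeriv` is finite. -/
def rateSupport (p : ℝ≥0 → ℝ≥0) (a : ℝ≥0) : Set ℝ≥0 := {t | p (t + a) ≠ 0}

/-- The exponential growth rate of the differentiated polynomials on the circle of
log-radius `s`. -/
noncomputable def growthRate (p : ℝ≥0 → ℝ≥0) (a : ℝ≥0) : ℝ → ℝ :=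
  supAffine (rateSupport p a) (logRate p a)

/-- The profile of the coefficients of the differentiated polynomials at radius `x`. -/
noncomputable def coeffProfile (p : ℝ≥0 → ℝ≥0) (a : ℝ≥0) (x : ℝ) (t : ℝ≥0) : ℝ :=
  p (t + a) * Real.exp (entropy a t + t * Real.log x)

/-- The product form of `coeffProfile` stays meaningful where `p` vanishes, in particular possibly
at the threshold itself; the exponential form is restricted to the support. -/
lemma coeffProfile_eq_exp {a : ℝ≥0} (x : ℝ) {t : ℝ≥0} (ht : t ∈ rateSupport p a) :
    coeffProfile p a x t = Real.exp (Real.log x * t + logRate p a t) := by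
  have hp : (0 : ℝ) < p (t + a) := NNReal.coe_pos.2 (pos_iff_ne_zero.2 ht)
  rw [coeffProfile, logRate, show Real.log x * t + (Real.log (p (t + a)) + entropy a t) =
    Real.log (p (t + a)) + (entropy a t + t * Real.log x) by ring,
    Real.exp_add (Real.log _), Real.exp_log hp]

variable {a : ℝ≥0}

lemma AssumptionA1.zero_mem_rateSupport (h : AssumptionA1 c p T₀) (haT : (a : ℝ≥0∞) < T₀) :
    0 ∈ rateSupport p a := by
  have := h.pos_of_lt a haT
  simpa [rateSupport] using this.ne'

lemma AssumptionA1.add_le_one (h : AssumptionA1 c p T₀) (hc : ∀ n k, n < k → c n k = 0)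
    {t : ℝ≥0} (ht : t ∈ rateSupport p a) : t + a ≤ 1 := by
  have := (h.le_threshold ht).trans (h.threshold_le_one hc)
  exact_mod_cast this

lemma AssumptionA1.le_one_of_mem (h : AssumptionA1 c p T₀) (hc : ∀ n k, n < k → c n k = 0) :
    ∀ t ∈ rateSupport p a, t ≤ 1 := fun _ ht =>
  le_self_add.trans (h.add_le_one hc ht)

lemma exists_abs_entropy_le (a : ℝ) : ∃ B, ∀ t : ℝ≥0, t ≤ 1 → |entropy a t| ≤ B := by
  obtain ⟨B, hB⟩ := (isCompact_Icc (a := (0 : ℝ)) (b := 1)).exists_bound_of_continuousOn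
    (continuous_entropy a).continuousOn
  exact ⟨B, fun t ht => hB t ⟨t.coe_nonneg, by exact_mod_cast ht⟩⟩

lemma AssumptionA1.exists_logRate_le (h : AssumptionA1 c p T₀)
    (hc : ∀ n k, n < k → c n k = 0) : ∃ B, ∀ t ∈ rateSupport p a, logRate p a t ≤ B := by
  obtain ⟨B₁, hB₁, h1⟩ := h.exists_le hc
  obtain ⟨B₂, h2⟩ := exists_abs_entropy_le a
  refine ⟨Real.log B₁ + B₂, fun t ht => add_le_add ?_ ?_⟩
  · exact Real.log_le_log (NNReal.coe_pos.2 (pos_iff_ne_zero.2 ht)) (h1 _)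
  · exact (le_abs_self _).trans (h2 t (h.le_one_of_mem hc t ht))

lemma AssumptionA1.radialPotential (h : AssumptionA1 c p T₀)
    (hc : ∀ n k, n < k → c n k = 0) (haT : (a : ℝ≥0∞) < T₀) :
    RadialPotential (growthRate p a) := by
  obtain ⟨B, hB⟩ := h.exists_logRate_le (a := a) hc
  exact radialPotential_supAffine (h.zero_mem_rateSupport haT) (h.le_one_of_mem hc) hB

/-- The cut-off `t ≤ 1 - a` is automatic on the support since `T₀ ≤ 1`; elsewhere the negated
logarithm is `⊤` and does not affect the supremum. -/
lemma AssumptionA1.legendreFenchel_eq (h : AssumptionA1 c p T₀)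
    (hc : ∀ n k, n < k → c n k = 0) (haT : (a : ℝ≥0∞) < T₀) (s : ℝ) :
    legendreFenchel (fun t => -logProfileDeriv p a t) s = (growthRate p a s : EReal) := by
  obtain ⟨B, hB⟩ := h.exists_logRate_le (a := a) hc
  refine legendreFenchel_eq_supAffine (h.zero_mem_rateSupport haT) (h.le_one_of_mem hc) hB
    (fun t ht => ?_) (fun t ht => ?_) s
  · have h1 : (t : ℝ) ≤ 1 - a := by
      have : ((t + a : ℝ≥0) : ℝ) ≤ 1 := h.add_le_one hc ht
      push_cast at this; linarith
    have hp : (0 : ℝ) < p (t + a) := NNReal.coe_pos.2 (pos_iff_ne_zero.2 ht)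
    have h2 : logProfile p (t + a) = (Real.log (p (t + a)) : EReal) := by
      rw [logProfile, ENNReal.log_pos_real (by exact_mod_cast ht) ENNReal.coe_ne_top]
      rfl
    simp only [logProfileDeriv, if_pos h1, h2]
    rw [← EReal.coe_add, ← EReal.coe_neg]
    rfl
  · have h2 : logProfile p (t + a) = ⊥ := by
      have : p (t + a) = 0 := not_not.1 ht
      simp [logProfile, this]
    simp only [logProfileDeriv, h2, EReal.bot_add, ite_self, EReal.neg_bot]

lemma AssumptionA1.logProfileDeriv_zero (h : AssumptionA1 c p T₀)
    (hc : ∀ n k, n < k → c n k = 0) (t : ℝ≥0) :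
    logProfileDeriv p 0 t = logProfile p t := by
  unfold logProfileDeriv
  split_ifs with h1
  · simp
  · have : p t = 0 := by
      refine h.zero_of_gt t ((h.threshold_le_one hc).trans_lt ?_)
      have : (1 : ℝ) < t := by simpa using h1
      exact_mod_cast this
    simp [logProfile, this]

lemma AssumptionA1.coeffProfile_le (h : AssumptionA1 c p T₀) (hc : ∀ n k, n < k → c n k = 0)
    (x : ℝ) (t : ℝ≥0) : coeffProfile p a x t ≤ Real.exp (growthRate p a (Real.log x)) := by
  obtain ⟨B, hB⟩ := h.exists_logRate_le (a := a) hc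
  by_cases ht : t ∈ rateSupport p a
  · rw [coeffProfile_eq_exp x ht, Real.exp_le_exp]
    exact le_supAffine (h.le_one_of_mem hc) hB _ ht
  · have : p (t + a) = 0 := not_not.1 ht
    rw [coeffProfile, this, NNReal.coe_zero, zero_mul]
    positivity

end profile

end RandomZeros

namespace RandomZeros

/-! ### Asymptotics of the coefficients -/

section coefficients

variable {c : ℕ → ℕ → ℂ} {p : ℝ≥0 → ℝ≥0} {T₀ : ℝ≥0∞} {a : ℝ≥0} {N : ℕ → ℕ}

/-- The macroscopic degree of the monomial to which differentiation sends `z^k`. -/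
noncomputable def shiftedDegree (a : ℝ≥0) (n k : ℕ) : ℝ≥0 := (k : ℝ≥0) / n - a

lemma coe_shiftedDegree (a : ℝ≥0) (n k : ℕ) :
    (shiftedDegree a n k : ℝ) = max (k / n - a : ℝ) 0 := by
  simp [shiftedDegree, NNReal.coe_sub_def]

lemma natCast_div_mem_Icc {n k : ℕ} (hkn : k ≤ n) : (k / n : ℝ) ∈ Icc (0 : ℝ) 1 :=
  ⟨by positivity, div_le_one_of_le₀ (by exact_mod_cast hkn) (by positivity)⟩

lemma shiftedDegree_le_one (a : ℝ≥0) {n k : ℕ} (hkn : k ≤ n) : shiftedDegree a n k ≤ 1 := by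
  have h : (shiftedDegree a n k : ℝ) ≤ 1 := by
    rw [coe_shiftedDegree]
    exact max_le (by linarith [(natCast_div_mem_Icc hkn).2, a.coe_nonneg]) zero_le_one
  exact h

/-- The truncated subtraction in `shiftedDegree` is harmless: if `k ≥ m` but `k/n < a`, then `k/n`
lies between `m/n` and `a`. -/
lemma abs_sub_shiftedDegree_le (a : ℝ≥0) {n m k : ℕ} (hmk : m ≤ k) :
    |((k - m : ℕ) / n : ℝ) - shiftedDegree a n k| ≤ |(m / n : ℝ) - a| ∧
    |(k / n : ℝ) - (shiftedDegree a n k + a)| ≤ |(m / n : ℝ) - a| := by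
  have h0 : (0 : ℝ) ≤ (k / n : ℝ) - m / n := by
    rw [← sub_div]
    exact div_nonneg (sub_nonneg.2 (by exact_mod_cast hmk)) (by positivity)
  rw [coe_shiftedDegree, Nat.cast_sub hmk, sub_div]
  rcases max_cases (k / n - a : ℝ) 0 with ⟨h, h1⟩ | ⟨h, h1⟩ <;> rw [h]
  · constructor
    · rw [abs_sub_comm (m / n : ℝ)]
      exact le_of_eq (by congr 1; ring)
    · simp
  · rw [zero_add, sub_zero, abs_of_nonneg h0, abs_of_neg h1, abs_of_neg (by linarith)]
    constructor <;> linarith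

/-- Four errors of `ε/4`: the factorials, two uses of the uniform continuity of `t log t` on
`[0,1]`, and the power of `x`. -/
lemma eventually_abs_log_derivFactor_sub_le (ha : a ≤ 1)
    (hN : Tendsto (fun n => (N n : ℝ) / n) atTop (𝓝 a)) {x : ℝ} (hx : 0 < x) {ε : ℝ}
    (hε : 0 < ε) : ∀ᶠ n : ℕ in atTop, ∀ k, N n ≤ k → k ≤ n →
      |(n : ℝ)⁻¹ * Real.log (derivFactor a n (N n) k * x ^ (k - N n)) -
        (entropy a (shiftedDegree a n k) + shiftedDegree a n k * Real.log x)| ≤ ε := by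
  obtain ⟨δ, hδ, hunif⟩ := Metric.uniformContinuousOn_iff.1
    ((isCompact_Icc (a := (0 : ℝ)) (b := 1)).uniformContinuousOn_of_continuous
      Real.continuous_mul_log.continuousOn) (ε / 4) (by positivity)
  have hl : 0 < |Real.log x| + 1 := by positivity
  have hη : 0 < min δ (ε / 4 / (|Real.log x| + 1)) := lt_min hδ (by positivity)
  filter_upwards [(tendsto_order.1 tendsto_log_add_one_div_nat).2 (ε / 4) (by positivity),
    Metric.tendsto_nhds.1 hN _ hη, eventually_gt_atTop 0] with n h1 h2 hn k hNk hkn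
  rw [Real.dist_eq] at h2
  have hn' : (0 : ℝ) < n := by exact_mod_cast hn
  obtain ⟨h3, h4⟩ := abs_sub_shiftedDegree_le a (n := n) hNk
  set τ := shiftedDegree a n k with hτ
  have hτ1 : (τ : ℝ) ≤ 1 := shiftedDegree_le_one a hkn
  have hτa : (τ + a : ℝ) ≤ 1 := by
    rw [hτ, coe_shiftedDegree, ← max_add_add_right]
    exact max_le (by linarith [(natCast_div_mem_Icc hkn).2]) (by simpa using ha)
  have h5 := h2.trans_le (min_le_left _ _)
  have h6 := h2.trans_le (min_le_right _ _)
  have h7 := hunif _ (natCast_div_mem_Icc hkn) (τ + a) ⟨by positivity, hτa⟩ (h4.trans_lt h5)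
  have h8 := hunif _ (natCast_div_mem_Icc ((Nat.sub_le k (N n)).trans hkn)) τ
    ⟨τ.coe_nonneg, hτ1⟩ (h3.trans_lt h5)
  have h9 : |((k - N n : ℕ) / n : ℝ) * Real.log x - τ * Real.log x| ≤ ε / 4 := by
    rw [← sub_mul, abs_mul]
    calc _ ≤ (ε / 4 / (|Real.log x| + 1)) * (|Real.log x| + 1) :=
          mul_le_mul (h3.trans h6.le) (by linarith) (abs_nonneg _) (by positivity)
      _ = ε / 4 := div_mul_cancel₀ _ hl.ne'
  have h10 := (abs_log_derivFactor_sub_le a hn hNk hkn).trans h1.le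
  have h11 : (n : ℝ)⁻¹ * Real.log (derivFactor a n (N n) k * x ^ (k - N n)) =
      (n : ℝ)⁻¹ * Real.log (derivFactor a n (N n) k) + ((k - N n : ℕ) / n : ℝ) * Real.log x := by
    rw [Real.log_mul (derivFactor_pos a hn hNk).ne' (by positivity), Real.log_pow]
    ring
  rw [Real.dist_eq] at h7 h8
  rw [h11, entropy]
  rw [abs_le] at h9 h10 ⊢
  rw [abs_lt] at h7 h8
  constructor <;> linarith

/-- Assumption A1 gives `p (k/n)`. It differs from the claimed value only if `N n / n ≤ k/n < a`,
and then `k/n` is close to `a`, where `p` is continuous. -/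
lemma AssumptionA1.eventually_abs_root_sub_le (h : AssumptionA1 c p T₀) (haT : (a : ℝ≥0∞) < T₀)
    (hN : Tendsto (fun n => (N n : ℝ) / n) atTop (𝓝 a)) {ε : ℝ} (hε : 0 < ε) :
    ∀ᶠ n : ℕ in atTop, ∀ k, N n ≤ k → k ≤ n →
      |‖c n k‖ ^ (1 / (n : ℝ)) - p (shiftedDegree a n k + a)| ≤ ε := by
  obtain ⟨δ, hδ, hcont⟩ := Metric.continuousAt_iff.1 (h.continuousAt haT) (ε / 4) (by positivity)
  filter_upwards [h.eventually_abs_sub_le one_pos (half_pos hε), Metric.tendsto_nhds.1 hN _ hδ]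
    with n h1 h2 k hNk hkn
  have h3 := h1 k (by rw [one_mul]; exact_mod_cast hkn)
  have h4 : shiftedDegree a n k + a = max ((k : ℝ≥0) / n) a := tsub_add_eq_max
  rw [h4]
  rcases le_total a ((k : ℝ≥0) / n) with h5 | h5
  · rw [max_eq_left h5]
    linarith
  · rw [max_eq_right h5]
    have h6 : ((k / n : ℝ≥0) : ℝ) ≤ a := h5
    push_cast at h6
    have h7 : (N n : ℝ) / n ≤ k / n := by gcongr
    rw [Real.dist_eq, abs_lt] at h2
    have h8 := hcont (x := (k : ℝ≥0) / n) (by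
      rw [NNReal.dist_eq, abs_lt]; push_cast
      constructor <;> linarith)
    rw [NNReal.dist_eq, abs_lt] at h8
    rw [abs_le] at h3 ⊢
    constructor <;> linarith

/-- The `n`-th root of the modulus of the `k`-th term of the normalized derivative on the circle
of radius `x`. -/
noncomputable def termRoot (c : ℕ → ℕ → ℂ) (a : ℝ≥0) (x : ℝ) (n m k : ℕ) : ℝ :=
  ‖c n k‖ ^ (1 / (n : ℝ)) * Real.exp ((n : ℝ)⁻¹ * Real.log (derivFactor a n m k * x ^ (k - m)))

lemma termRoot_nonneg (c : ℕ → ℕ → ℂ) (a : ℝ≥0) (x : ℝ) (n m k : ℕ) :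
    0 ≤ termRoot c a x n m k := by
  unfold termRoot; positivity

lemma termRoot_pow (c : ℕ → ℕ → ℂ) (a : ℝ≥0) {x : ℝ} (hx : 0 < x) {n m k : ℕ} (hn : 0 < n)
    (hmk : m ≤ k) :
    termRoot c a x n m k ^ n = ‖c n k‖ * (derivFactor a n m k * x ^ (k - m)) := by
  have hn' : (n : ℝ) ≠ 0 := by exact_mod_cast hn.ne'
  have := derivFactor_pos a hn hmk
  rw [termRoot, mul_pow, ← Real.exp_nat_mul, mul_inv_cancel_left₀ hn', Real.exp_log (by positivity),
    ← Real.rpow_natCast, ← Real.rpow_mul (norm_nonneg _), one_div_mul_cancel hn', Real.rpow_one]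

lemma abs_exp_sub_exp_le {u v : ℝ} (h : |u - v| ≤ 1) :
    |Real.exp u - Real.exp v| ≤ Real.exp v * (2 * |u - v|) := by
  have h1 : Real.exp u - Real.exp v = Real.exp v * (Real.exp (u - v) - 1) := by
    rw [mul_sub, ← Real.exp_add]; simp
  rw [h1, abs_mul, abs_of_pos (Real.exp_pos v)]
  exact mul_le_mul_of_nonneg_left (Real.abs_exp_sub_one_le h) (Real.exp_pos v).le

/-- Comparison of `n`-th roots instead of logarithms keeps the estimate uniform even where `p` is
zero. -/
lemma AssumptionA1.eventually_abs_termRoot_sub_le (h : AssumptionA1 c p T₀)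
    (hc : ∀ n k, n < k → c n k = 0) (haT : (a : ℝ≥0∞) < T₀)
    (hN : Tendsto (fun n => (N n : ℝ) / n) atTop (𝓝 a)) {x : ℝ} (hx : 0 < x) {ε : ℝ}
    (hε : 0 < ε) : ∀ᶠ n : ℕ in atTop, ∀ k, N n ≤ k → k ≤ n →
      |termRoot c a x n (N n) k - coeffProfile p a x (shiftedDegree a n k)| ≤ ε := by
  have ha : a ≤ 1 := by exact_mod_cast haT.le.trans (h.threshold_le_one hc)
  obtain ⟨B, hB0, hB⟩ := h.exists_le hc
  obtain ⟨E, hE⟩ := exists_abs_entropy_le a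
  set M := Real.exp (E + |Real.log x|) with hM
  have hM0 : 0 < M := Real.exp_pos _
  -- Below, `3M` bounds the exponential multiplying the first error `η`, and `2Mη` is the error of
  -- that exponential, multiplied by `p ≤ B`.
  set η := min 1 (ε / (3 * M + 2 * B * M)) with hη
  have hη0 : 0 < η := by positivity
  have hη1 : η ≤ 1 := min_le_left _ _
  have hηε : η * (3 * M + 2 * B * M) ≤ ε := by
    calc _ ≤ ε / (3 * M + 2 * B * M) * (3 * M + 2 * B * M) := by
          gcongr; exact min_le_right _ _
      _ = ε := div_mul_cancel₀ _ (by positivity)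
  filter_upwards [eventually_abs_log_derivFactor_sub_le ha hN hx hη0,
    h.eventually_abs_root_sub_le haT hN hη0] with n h1 h2 k hNk hkn
  replace h1 := h1 k hNk hkn
  replace h2 := h2 k hNk hkn
  rw [termRoot, coeffProfile]
  set τ := shiftedDegree a n k
  have hτ1 : τ ≤ 1 := shiftedDegree_le_one a hkn
  set G := (n : ℝ)⁻¹ * Real.log (derivFactor a n (N n) k * x ^ (k - N n))
  set H := entropy a τ + τ * Real.log x
  have hH : Real.exp H ≤ M := by
    rw [hM, Real.exp_le_exp]
    refine add_le_add ((le_abs_self _).trans (hE τ hτ1)) ?_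
    refine (le_abs_self _).trans ?_
    rw [abs_mul, NNReal.abs_eq]
    exact mul_le_of_le_one_left (abs_nonneg _) hτ1
  have h3 : |Real.exp G - Real.exp H| ≤ M * (2 * η) :=
    (abs_exp_sub_exp_le (h1.trans hη1)).trans (by gcongr)
  have h4 : Real.exp G ≤ 3 * M := by
    have := (abs_le.1 h3).2
    nlinarith
  set u := ‖c n k‖ ^ (1 / (n : ℝ))
  have h5 : u * Real.exp G - p (τ + a) * Real.exp H =
      (u - p (τ + a)) * Real.exp G + p (τ + a) * (Real.exp G - Real.exp H) := by ring
  rw [h5]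
  refine (abs_add_le _ _).trans ?_
  rw [abs_mul, abs_mul, Real.abs_exp, NNReal.abs_eq]
  calc _ ≤ η * (3 * M) + B * (M * (2 * η)) := by
        gcongr
        exact hB _
    _ = η * (3 * M + 2 * B * M) := by ring
    _ ≤ ε := hηε

lemma AssumptionA1.eventually_term_le (h : AssumptionA1 c p T₀)
    (hc : ∀ n k, n < k → c n k = 0) (haT : (a : ℝ≥0∞) < T₀)
    (hN : Tendsto (fun n => (N n : ℝ) / n) atTop (𝓝 a)) {x : ℝ} (hx : 0 < x) {ε : ℝ}
    (hε : 0 < ε) : ∀ᶠ n : ℕ in atTop, ∀ k ∈ Finset.range (n + 1),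
      ‖c n k‖ * (derivFactor a n (N n) k * x ^ (k - N n)) ≤
        Real.exp (n * (growthRate p a (Real.log x) + ε)) := by
  set L := growthRate p a (Real.log x) with hL
  have hη : 0 < Real.exp (L + ε) - Real.exp L := sub_pos.2 (Real.exp_lt_exp.2 (by linarith))
  filter_upwards [h.eventually_abs_termRoot_sub_le hc haT hN hx hη, eventually_gt_atTop 0]
    with n h1 hn k hk
  rcases lt_or_ge k (N n) with hk' | hk'
  · rw [derivFactor_of_lt _ hk', zero_mul, mul_zero]
    positivity
  · rw [← termRoot_pow c a hx hn hk', Real.exp_nat_mul]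
    refine pow_le_pow_left₀ (termRoot_nonneg ..) ?_ n
    have h2 := (abs_le.1 (h1 k hk' (Finset.mem_range_succ_iff.1 hk))).2
    have h3 := h.coeffProfile_le (a := a) hc x (shiftedDegree a n k)
    linarith

lemma AssumptionA1.continuousOn_coeffProfile (h : AssumptionA1 c p T₀) {T : ℝ≥0} (hT : T₀ = T)
    (haT : a ≤ T) (x : ℝ) : ContinuousOn (coeffProfile p a x) (Iic (T - a)) := by
  have h1 : ContinuousOn (fun t => p (t + a)) (Iic (T - a)) :=
    (h.continuousOn_Iic hT).comp (by fun_prop) fun t ht => (le_tsub_iff_right haT).1 ht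
  have h2 : Continuous fun t : ℝ≥0 => entropy a t := (continuous_entropy a).comp
      NNReal.continuous_coe
  exact (NNReal.continuous_coe.comp_continuousOn h1).mul
    (Real.continuous_exp.comp
      (h2.add (NNReal.continuous_coe.mul continuous_const))).continuousOn

/-- A near-maximizer in the support may be an endpoint of `[0, T₀ - a]`; continuity moves it inside,
so that a whole window of indices is nearly maximal. -/
lemma AssumptionA1.exists_lt_coeffProfile (h : AssumptionA1 c p T₀)
    (hc : ∀ n k, n < k → c n k = 0) (haT : (a : ℝ≥0∞) < T₀) (x : ℝ) {ε : ℝ} (hε : 0 < ε) :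
    ∃ t : ℝ≥0, 0 < t ∧ ((t + a : ℝ≥0) : ℝ≥0∞) < T₀ ∧
      Real.exp (growthRate p a (Real.log x) - ε) < coeffProfile p a x t := by
  obtain ⟨T, hT, -⟩ := h.exists_coe_eq hc
  have haT' : a < T := by rw [hT] at haT; exact_mod_cast haT
  obtain ⟨s, hs, hs'⟩ := exists_lt_of_lt_supAffine (h.zero_mem_rateSupport haT)
    (sub_lt_self (growthRate p a (Real.log x)) hε)
  rw [← Real.exp_lt_exp, ← coeffProfile_eq_exp x hs] at hs'
  have hsT : s ≤ T - a := by
    rw [le_tsub_iff_right haT'.le]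
    have := h.le_threshold hs
    rw [hT] at this
    exact_mod_cast this
  have h0 : (0 : ℝ≥0) < T - a := tsub_pos_of_lt haT'
  have hcl : s ∈ closure (Ioo 0 (T - a)) := by
    rw [closure_Ioo h0.ne]; exact ⟨zero_le, hsT⟩
  have : (𝓝[Ioo 0 (T - a)] s).NeBot := mem_closure_iff_nhdsWithin_neBot.1 hcl
  have hev := ((h.continuousOn_coeffProfile hT haT'.le x s hsT).mono
    (fun t ht => ht.2.le : Ioo 0 (T - a) ⊆ Iic (T - a))).eventually (lt_mem_nhds hs')
  obtain ⟨t, ht1, ht2⟩ := (hev.and self_mem_nhdsWithin).exists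
  refine ⟨t, ht2.1, ?_, ht1⟩
  rw [hT]
  exact_mod_cast lt_tsub_iff_right.1 ht2.2

lemma eventually_le_card_Icc {u v : ℝ} (hu : 0 ≤ u) (huv : u < v) (m : ℕ) :
    ∀ᶠ n : ℕ in atTop, m ≤ (Finset.Icc ⌈u * n⌉₊ ⌊v * n⌋₊).card := by
  have h := (tendsto_natCast_atTop_atTop (R := ℝ)).const_mul_atTop (sub_pos.2 huv)
  filter_upwards [h.eventually_ge_atTop (m + 2 : ℝ)] with n hn
  rw [Nat.card_Icc]
  have h1 := Nat.ceil_lt_add_one (a := u * n) (by positivity)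
  have h2 := Nat.lt_floor_add_one (v * n)
  have h3 : ((m + ⌈u * n⌉₊ : ℕ) : ℝ) ≤ ((⌊v * n⌋₊ + 1 : ℕ) : ℝ) := by
    push_cast; linarith
  have h4 : m + ⌈u * n⌉₊ ≤ ⌊v * n⌋₊ + 1 := by exact_mod_cast h3
  omega

lemma AssumptionA1.eventually_le_card_term (h : AssumptionA1 c p T₀)
    (hc : ∀ n k, n < k → c n k = 0) (haT : (a : ℝ≥0∞) < T₀)
    (hN : Tendsto (fun n => (N n : ℝ) / n) atTop (𝓝 a)) {x : ℝ} (hx : 0 < x) {ε : ℝ}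
    (hε : 0 < ε) (m : ℕ) : ∀ᶠ n : ℕ in atTop, m ≤ ((Finset.range (n + 1)).filter fun k =>
      Real.exp (n * (growthRate p a (Real.log x) - ε)) ≤
        ‖c n k‖ * (derivFactor a n (N n) k * x ^ (k - N n))).card := by
  set L := growthRate p a (Real.log x) with hL
  obtain ⟨T, hT, hT1⟩ := h.exists_coe_eq hc
  have haT' : a < T := by rw [hT] at haT; exact_mod_cast haT
  obtain ⟨t, ht0, htT, ht⟩ := h.exists_lt_coeffProfile hc haT x (half_pos hε)
  rw [hT] at htT
  have htT' : t + a < T := by exact_mod_cast htT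
  have hcont : ContinuousAt (coeffProfile p a x) t :=
    (h.continuousOn_coeffProfile hT haT'.le x).continuousAt
      (Iic_mem_nhds (lt_tsub_iff_right.2 htT'))
  obtain ⟨δ, hδ, hball⟩ := Metric.eventually_nhds_iff.1 (hcont.eventually (lt_mem_nhds ht))
  have ht0' : (0 : ℝ) < t := ht0
  have htT1 : (t + a : ℝ) < 1 := by
    have : ((t + a : ℝ≥0) : ℝ) < T := htT'
    have h1 : (T : ℝ) ≤ 1 := hT1
    push_cast at this; linarith
  -- `δ / 2` keeps the profile large, `t / 2` keeps `k` above `N n`, and `1 - (t + a)` keeps `k ≤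
  -- n`.
  set ρ := min (δ / 2) (min (t / 2) (1 - (t + a))) with hρ
  have hρ0 : 0 < ρ := lt_min (by positivity) (lt_min (by positivity) (by linarith))
  have hρδ : ρ < δ := (min_le_left _ _).trans_lt (by linarith)
  have hρt : ρ < t := ((min_le_right _ _).trans (min_le_left _ _)).trans_lt (by linarith)
  have hρ1 : ρ ≤ 1 - (t + a) := (min_le_right _ _).trans (min_le_right _ _)
  have hη : 0 < Real.exp (L - ε / 2) - Real.exp (L - ε) :=
    sub_pos.2 (Real.exp_lt_exp.2 (by linarith))
  have ha0 := a.coe_nonneg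
  filter_upwards [h.eventually_abs_termRoot_sub_le hc haT hN hx hη, eventually_gt_atTop 0,
    eventually_le_card_Icc (u := t + a - ρ) (v := t + a + ρ) (by linarith) (by linarith) m,
    (tendsto_order.1 hN).2 (t + a - ρ) (by linarith)] with n h1 hn hcard hNn
  have hn' : (0 : ℝ) < n := by exact_mod_cast hn
  refine hcard.trans (Finset.card_le_card fun k hk => ?_)
  obtain ⟨hk1, hk2⟩ := Finset.mem_Icc.1 hk
  have hk3 : t + a - ρ ≤ (k / n : ℝ) := (le_div_iff₀ hn').2 (Nat.ceil_le.1 hk1)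
  have hk4 : (k / n : ℝ) ≤ t + a + ρ :=
    (div_le_iff₀ hn').2 ((Nat.le_floor_iff (by positivity)).1 hk2)
  have hkn : k ≤ n := by
    have : (k : ℝ) ≤ n := by
      rw [← div_le_one hn']; linarith
    exact_mod_cast this
  have hNk : N n ≤ k := by
    have : (N n : ℝ) < k := by
      rw [← div_lt_div_iff_of_pos_right hn']; linarith
    exact_mod_cast this.le
  refine Finset.mem_filter.2 ⟨Finset.mem_range_succ_iff.2 hkn, ?_⟩
  rw [← termRoot_pow c a hx hn hNk, Real.exp_nat_mul]
  refine pow_le_pow_left₀ (Real.exp_pos _).le ?_ n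
  have h2 := (abs_le.1 (h1 k hNk hkn)).1
  have h3 : Real.exp (L - ε / 2) < coeffProfile p a x (shiftedDegree a n k) := by
    refine hball ?_
    rw [NNReal.dist_eq, coe_shiftedDegree, max_eq_left (by linarith), abs_lt]
    constructor <;> linarith
  linarith

/-- The index `k = N n` has shifted degree tending to `0`, where the profile is positive because `a
< T₀`. -/
lemma AssumptionA1.exists_eventually_le_lowest_term (h : AssumptionA1 c p T₀)
    (hc : ∀ n k, n < k → c n k = 0) (haT : (a : ℝ≥0∞) < T₀)
    (hN : Tendsto (fun n => (N n : ℝ) / n) atTop (𝓝 a)) (hNn : ∀ n, N n ≤ n) :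
    ∃ C : ℝ, ∀ᶠ n : ℕ in atTop,
      Real.exp (-(n * C)) ≤ ‖c n (N n)‖ * derivFactor a n (N n) (N n) := by
  obtain ⟨T, hT, hT1⟩ := h.exists_coe_eq hc
  have haT' : a < T := by rw [hT] at haT; exact_mod_cast haT
  have hcont : ContinuousAt (coeffProfile p a 1) 0 :=
    (h.continuousOn_coeffProfile hT haT'.le 1).continuousAt
      (Iic_mem_nhds (tsub_pos_of_lt haT'))
  have hpos : 0 < coeffProfile p a 1 0 := by
    rw [coeffProfile_eq_exp 1 (h.zero_mem_rateSupport haT)]; positivity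
  set v := coeffProfile p a 1 0 with hv
  have hlim : Tendsto (fun n => shiftedDegree a n (N n)) atTop (𝓝 0) := by
    rw [← NNReal.tendsto_coe]
    simp only [coe_shiftedDegree]
    simpa using (hN.sub_const (a : ℝ)).max (tendsto_const_nhds (x := (0 : ℝ)))
  refine ⟨-Real.log (v / 4), ?_⟩
  filter_upwards [h.eventually_abs_termRoot_sub_le hc haT hN one_pos
    (show 0 < v / 4 by positivity), eventually_gt_atTop 0,
    (hcont.tendsto.comp hlim).eventually (lt_mem_nhds (half_lt_self hpos))] with n h1 hn h2
  have h3 := (abs_le.1 (h1 (N n) le_rfl (hNn n))).1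
  have h4 := termRoot_pow c a one_pos hn (le_refl (N n))
  rw [one_pow, mul_one] at h4
  rw [← h4, mul_neg, neg_neg, Real.exp_nat_mul, Real.exp_log (by positivity)]
  refine pow_le_pow_left₀ (by positivity) ?_ n
  have h5 : v / 2 < coeffProfile p a 1 (shiftedDegree a n (N n)) := h2
  linarith

end coefficients

end RandomZeros

namespace RandomZeros

/-! ### Zeros of derivatives -/

section derivatives

variable {c : ℕ → ℕ → ℂ} {p : ℝ≥0 → ℝ≥0} {T₀ : ℝ≥0∞} {a : ℝ≥0} {N : ℕ → ℕ}

/-- The normalization of the `m`-th derivative of a polynomial of degree `n`. -/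
noncomputable def derivScale (a : ℝ) (n m : ℕ) : ℝ :=
  ((n : ℝ) ^ m)⁻¹ * Real.exp (m + n * ((1 - a) * Real.log (1 - a)))

lemma derivScale_pos (a : ℝ) {n m : ℕ} (hmn : m ≤ n) : 0 < derivScale a n m := by
  have : (0 : ℝ) < (n : ℝ) ^ m := by
    rcases n.eq_zero_or_pos with rfl | hn
    · rw [Nat.le_zero.1 hmn]; simp
    · have : (0 : ℝ) < n := by exact_mod_cast hn
      positivity
  unfold derivScale; positivity

/-- The normalized `m`-th derivative of `poly c x n`. -/
noncomputable def scaledDerivative (c : ℕ → ℕ → ℂ) (a : ℝ) (x : ℕ → ℂ) (n m : ℕ) : Polynomial ℂ :=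
  Polynomial.C (derivScale a n m : ℂ) * Polynomial.derivative^[m] (poly c x n)

/-- The `k`-th term of the normalized derivative. -/
noncomputable def derivTerm (c : ℕ → ℕ → ℂ) (a : ℝ) (n m : ℕ) (z : ℂ) (k : ℕ) : ℂ :=
  c n k * (derivFactor a n m k * z ^ (k - m))

lemma norm_derivTerm (c : ℕ → ℕ → ℂ) (a : ℝ) (n m : ℕ) (z : ℂ) (k : ℕ) :
    ‖derivTerm c a n m z k‖ = ‖c n k‖ * (derivFactor a n m k * ‖z‖ ^ (k - m)) := by
  rw [derivTerm, norm_mul, norm_mul, norm_pow, Complex.norm_real, Real.norm_eq_abs,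
    abs_of_nonneg (derivFactor_nonneg ..)]

lemma eval_scaledDerivative (c : ℕ → ℕ → ℂ) (a : ℝ) (x : ℕ → ℂ) (n m : ℕ) (z : ℂ) :
    (scaledDerivative c a x n m).eval z =
      ∑ k ∈ Finset.range (n + 1), x k * derivTerm c a n m z k := by
  rw [scaledDerivative, poly, Polynomial.iterate_derivative_sum, Polynomial.eval_mul,
    Polynomial.eval_finsetSum, Finset.mul_sum]
  refine Finset.sum_congr rfl fun k _ => ?_
  rw [Polynomial.iterate_derivative_C_mul, Polynomial.iterate_derivative_X_pow_eq_C_mul,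
    derivTerm, derivFactor, derivScale]
  simp only [Polynomial.eval_mul, Polynomial.eval_C, Polynomial.eval_pow, Polynomial.eval_X]
  push_cast
  ring

lemma natDegree_poly_le (c : ℕ → ℕ → ℂ) (x : ℕ → ℂ) (n : ℕ) : (poly c x n).natDegree ≤ n :=
  Polynomial.natDegree_sum_le_of_forall_le _ _ fun _ hk =>
    (Polynomial.natDegree_C_mul_X_pow_le _ _).trans (Finset.mem_range_succ_iff.1 hk)

lemma natDegree_scaledDerivative_le (c : ℕ → ℕ → ℂ) (a : ℝ) (x : ℕ → ℂ) (n m : ℕ) :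
    (scaledDerivative c a x n m).natDegree ≤ n :=
  (Polynomial.natDegree_C_mul_le _ _).trans ((Polynomial.natDegree_iterate_derivative _ _).trans
    ((Nat.sub_le _ _).trans (natDegree_poly_le c x n)))

lemma zeroMeasure_scaledDerivative (c : ℕ → ℕ → ℂ) (a : ℝ) (x : ℕ → ℂ) {n m : ℕ} (hmn : m ≤ n) :
    zeroMeasure (scaledDerivative c a x n m) =
      zeroMeasure (Polynomial.derivative^[m] (poly c x n)) :=
  zeroMeasure_C_mul (by exact_mod_cast (derivScale_pos a hmn).ne') _

/-- Differentiation kills `k < m` and evaluation at `0` kills `k > m`. -/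
lemma eval_zero_scaledDerivative (c : ℕ → ℕ → ℂ) (a : ℝ) (x : ℕ → ℂ) {n m : ℕ} (hmn : m ≤ n) :
    (scaledDerivative c a x n m).eval 0 = x m * (c n m * derivFactor a n m m) := by
  rw [eval_scaledDerivative, Finset.sum_eq_single_of_mem m (Finset.mem_range_succ_iff.2 hmn)]
  · simp [derivTerm]
  · intro k _ hkm
    rcases lt_or_gt_of_ne hkm with h | h
    · simp [derivTerm, derivFactor_of_lt _ h]
    · simp [derivTerm, zero_pow (Nat.sub_ne_zero_of_lt h)]

variable {Ω : Type*} [MeasurableSpace Ω] {P : Measure Ω} [IsProbabilityMeasure P] {ξ : ℕ → Ω → ℂ}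

theorem AssumptionA1.logConvergence (h : AssumptionA1 c p T₀) (hc : ∀ n k, n < k → c n k = 0)
    (haT : (a : ℝ≥0∞) < T₀) (hN : Tendsto (fun n => (N n : ℝ) / n) atTop (𝓝 a))
    (hNn : ∀ n, N n ≤ n) (hm : ∀ k, Measurable (ξ k)) (hind : iIndepFun ξ P)
    (hid : ∀ k, IdentDistrib (ξ k) (ξ 0) P P) (hnd : ¬ ∃ x : ℂ, ∀ᵐ ω ∂P, ξ 0 ω = x)
    (h0 : P {ω | ξ 0 ω = 0} = 0) (hlog : Integrable (fun ω => Real.log (1 + ‖ξ 0 ω‖)) P) :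
    LogConvergence P (fun n ω => scaledDerivative c a (fun k => ξ k ω) n (N n))
      (fun z => growthRate p a (Real.log ‖z‖)) where
  measurable_eval n := by
    simp only [eval_scaledDerivative, derivTerm]
    refine Finset.measurable_fun_sum _ fun k _ => ?_
    exact ((hm k).comp measurable_fst).mul (by fun_prop)
  natDegree_le n ω := natDegree_scaledDerivative_le ..
  tendsto z hz := by
    have hz' : 0 < ‖z‖ := norm_pos_iff.2 hz
    simp only [eval_scaledDerivative]
    refine tendstoInMeasure_log_norm_sum hm hind hid hnd hlog
      (fun n k => derivTerm c a n (N n) z k) _ (fun ε hε => ?_) (fun ε hε m => ?_)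
    · simp only [norm_derivTerm]
      exact h.eventually_term_le hc haT hN hz' hε
    · simp only [norm_derivTerm]
      exact h.eventually_le_card_term hc haT hN hz' hε m
  upper R := by
    have hx : 0 < max R 1 := by positivity
    -- One unit each for the `ξ k`, the number of terms and the coefficients; the terms are largest
    -- on the circle of radius `max R 1`.
    refine ⟨growthRate p a (Real.log (max R 1)) + 3, ?_⟩
    refine squeeze_zero' (Eventually.of_forall fun n => measureReal_nonneg) ?_
      (tendsto_measure_exists_exp_lt hm hid hlog one_pos)
    filter_upwards [h.eventually_term_le hc haT hN hx one_pos,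
      eventually_natCast_add_one_le_exp one_pos] with n h1 h2
    refine measureReal_mono ?_
    rintro ω ⟨z, hz, hlt⟩
    by_contra hω
    have hω' : ∀ k ∈ Finset.range (n + 1), ‖ξ k ω‖ ≤ Real.exp (1 * n) := fun k hk =>
      not_lt.1 fun hk' => hω ⟨k, hk, hk'⟩
    refine absurd hlt (not_lt.2 ?_)
    rw [eval_scaledDerivative]
    refine (norm_sum_mul_le hω' fun k hk => le_trans ?_ (h1 k hk)).trans ?_
    · rw [norm_derivTerm]
      have := derivFactor_nonneg a n (N n) k
      have hz' : ‖z‖ ≤ max R 1 := hz.trans (le_max_left _ _)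
      gcongr
    · calc _ ≤ Real.exp (1 * n) * (Real.exp (1 * n) *
            Real.exp (n * (growthRate p a (Real.log (max R 1)) + 1))) := by gcongr
        _ = _ := by rw [← Real.exp_add, ← Real.exp_add]; congr 1; ring
  lower := by
    obtain ⟨C, hC⟩ := h.exists_eventually_le_lowest_term hc haT hN hNn
    refine ⟨C + 1, ?_⟩
    refine squeeze_zero' (Eventually.of_forall fun n => measureReal_nonneg) ?_
      (tendsto_measure_norm_lt_exp_neg hm hid h0 N one_pos)
    filter_upwards [hC] with n h1
    refine measureReal_mono fun ω hω => ?_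
    by_contra hω'
    rw [mem_ofPred_eq, not_lt] at hω'
    rw [mem_ofPred_eq, eval_zero_scaledDerivative _ _ _ (hNn n), norm_mul, norm_mul,
      Complex.norm_real, Real.norm_eq_abs, abs_of_nonneg (derivFactor_nonneg ..)] at hω
    refine absurd hω (not_lt.2 ?_)
    calc Real.exp (-(n * (C + 1))) = Real.exp (-(1 * n)) * Real.exp (-(n * C)) := by
          rw [← Real.exp_add]; congr 1; ring
      _ ≤ _ := by gcongr
  measurable_limit := by
    have := (h.radialPotential hc haT).continuous.measurable
    fun_prop
  bounded_limit R := by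
    have hJ := h.radialPotential hc haT
    obtain ⟨b, hb⟩ := hJ.bddBelow
    refine ⟨max |b| |growthRate p a (Real.log (max R 1))|, fun z hz => ?_⟩
    refine abs_le_max_abs_abs (hb _) (hJ.monotone ?_)
    -- At `z = 0` the convention `Real.log 0 = 0` applies, which `max R 1` accommodates.
    rcases (norm_nonneg z).eq_or_lt with h1 | h1
    · rw [← h1, Real.log_zero]
      exact Real.log_nonneg (le_max_right _ _)
    · exact Real.log_le_log h1 (hz.trans (le_max_left _ _))

theorem AssumptionA1.tendstoInProbability (h : AssumptionA1 c p T₀)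
    (hc : ∀ n k, n < k → c n k = 0) (haT : (a : ℝ≥0∞) < T₀)
    (hN : Tendsto (fun n => (N n : ℝ) / n) atTop (𝓝 a)) (hNn : ∀ n, N n ≤ n)
    (hm : ∀ k, Measurable (ξ k)) (hind : iIndepFun ξ P)
    (hid : ∀ k, IdentDistrib (ξ k) (ξ 0) P P) (hnd : ¬ ∃ x : ℂ, ∀ᵐ ω ∂P, ξ 0 ω = x)
    (h0 : P {ω | ξ 0 ω = 0} = 0) (hlog : Integrable (fun ω => Real.log (1 + ‖ξ 0 ω‖)) P) :
    TendstoInProbability P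
      (fun n ω => ((n - N n : ℕ) : ℝ≥0)⁻¹ •
        zeroMeasure (Polynomial.derivative^[N n] (poly c (fun k => ξ k ω) n)))
      ((1 - a)⁻¹ • (h.radialPotential hc haT).measure) := by
  intro φ hφ hφc
  have ha : (a : ℝ) < 1 := by
    have : a < 1 := by exact_mod_cast haT.trans_le (h.threshold_le_one hc)
    exact_mod_cast this
  have h1 := (h.logConvergence hc haT hN hNn hm hind hid hnd h0 hlog).tendsto_zeros
    (h.radialPotential hc haT).isPotential hφ.continuous hφc
  -- Change of normalization from `n` to `D_n`; since `a < 1`, `D_n` vanishes for finitely many `n`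
  -- at most.
  have h2 : Tendsto (fun n : ℕ => (n : ℝ) * ((n - N n : ℕ) : ℝ)⁻¹) atTop
      (𝓝 ((1 - a : ℝ)⁻¹)) := by
    refine ((hN.const_sub 1).inv₀ (by linarith)).congr' ?_
    filter_upwards [eventually_gt_atTop 0] with n hn
    have hn' : (n : ℝ) ≠ 0 := by exact_mod_cast hn.ne'
    rw [one_sub_div hn', inv_div, Nat.cast_sub (hNn n), div_eq_mul_inv]
  refine TendstoInMeasure.congr' ?_ ?_ (tendstoInMeasure_mul_of_tendsto h1 h2)
  · filter_upwards [eventually_gt_atTop 0] with n hn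
    refine Eventually.of_forall fun ω => ?_
    have hn' : (n : ℝ) ≠ 0 := by exact_mod_cast hn.ne'
    simp only []
    rw [zeroMeasure_scaledDerivative _ _ _ (hNn n), integral_smul_nnreal_measure, NNReal.smul_def,
      smul_eq_mul, mul_right_comm, ← mul_assoc, mul_inv_cancel₀ hn', one_mul,
      NNReal.coe_inv, NNReal.coe_natCast, mul_comm]
  · refine Eventually.of_forall fun ω => ?_
    simp only []
    rw [integral_smul_nnreal_measure, NNReal.smul_def, smul_eq_mul, NNReal.coe_inv,
      NNReal.coe_sub (by exact_mod_cast ha.le), NNReal.coe_one]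

end derivatives

end RandomZeros

/-! ### The main theorem. -/

theorem theorem5 {Ω : Type*} [MeasurableSpace Ω] (P : Measure Ω) [IsProbabilityMeasure P]
    (ξ : ℕ → Ω → ℂ)
    (hξ_meas : ∀ k, Measurable (ξ k))
    (hξ_indep : iIndepFun ξ P)
    (hξ_ident : ∀ k, IdentDistrib (ξ k) (ξ 0) P P)
    (hξ_nondeg : ¬ ∃ x : ℂ, ∀ᵐ ω ∂P, ξ 0 ω = x)
    (hξ_zero : P {ω | ξ 0 ω = 0} = 0)
    (hξ_log : Integrable (fun ω => Real.log (1 + ‖ξ 0 ω‖)) P)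
    (c : ℕ → ℕ → ℂ) (hc : ∀ n k, n < k → c n k = 0)
    (p : ℝ≥0 → ℝ≥0) (T₀ : ℝ≥0∞) (hA1 : RandomZeros.AssumptionA1 c p T₀)
    (N : ℕ → ℕ) (hN : ∀ n, N n ≤ n) :
    (Tendsto (fun n => (N n : ℝ) / n) atTop (𝓝 0) →
      ∃ μ : Measure ℂ,
        RandomZeros.HasRadialProfile μ 1
          (RandomZeros.legendreFenchel (fun t => -RandomZeros.logProfile p t)) ∧
        RandomZeros.TendstoInProbability P
          (fun n ω => ((n - N n : ℕ) : ℝ≥0)⁻¹ •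
            RandomZeros.zeroMeasure
              (Polynomial.derivative^[N n] (RandomZeros.poly c (fun k => ξ k ω) n))) μ ∧
        RandomZeros.TendstoInProbability P
          (fun n ω => (n : ℝ≥0)⁻¹ •
            RandomZeros.zeroMeasure (RandomZeros.poly c (fun k => ξ k ω) n)) μ) ∧
    (∀ a : ℝ≥0, 0 < a → a < 1 → (a : ℝ≥0∞) < T₀ →
      Tendsto (fun n => (N n : ℝ) / n) atTop (𝓝 (a : ℝ)) →
      ∃ μ : Measure ℂ,
        RandomZeros.HasRadialProfile μ (1 / (1 - (a : ℝ)))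
          (RandomZeros.legendreFenchel (fun t => -RandomZeros.logProfileDeriv p a t)) ∧
        RandomZeros.TendstoInProbability P
          (fun n ω => ((n - N n : ℕ) : ℝ≥0)⁻¹ •
            RandomZeros.zeroMeasure
              (Polynomial.derivative^[N n] (RandomZeros.poly c (fun k => ξ k ω) n))) μ) := by
  constructor
  · intro hN0
    have h0 : ((0 : ℝ≥0) : ℝ≥0∞) < T₀ := by simpa using hA1.T₀_pos
    refine ⟨(1 - 0 : ℝ≥0)⁻¹ • (hA1.radialPotential hc h0).measure, ?_, ?_, ?_⟩
    · have hI := hA1.legendreFenchel_eq hc h0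
      simp only [hA1.logProfileDeriv_zero hc] at hI
      simpa using (hA1.radialPotential hc h0).hasRadialProfile hI (1 - 0 : ℝ≥0)⁻¹
    · exact hA1.tendstoInProbability hc h0 (by simpa using hN0) hN hξ_meas hξ_indep hξ_ident
        hξ_nondeg hξ_zero hξ_log
    -- Without differentiation: the same result with the zero sequence of orders, hence the same
    -- limit measure.
    · simpa using hA1.tendstoInProbability (N := fun _ => 0) hc h0 (by simp) (by simp) hξ_meas
        hξ_indep hξ_ident hξ_nondeg hξ_zero hξ_log
  · intro a _ ha haT hNa
    refine ⟨(1 - a)⁻¹ • (hA1.radialPotential hc haT).measure, ?_,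
      hA1.tendstoInProbability hc haT hNa hN hξ_meas hξ_indep hξ_ident hξ_nondeg hξ_zero hξ_log⟩
    have h1 := (hA1.radialPotential hc haT).hasRadialProfile
      (hA1.legendreFenchel_eq hc haT) (1 - a)⁻¹
    rwa [NNReal.coe_inv, NNReal.coe_sub ha.le, NNReal.coe_one, ← one_div (1 - (a : ℝ))] at h1
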